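/- **Theorem 3.2.** The predicative Fregean theory $\mathsf{PFT}$ interprets full second-order Peano arithmetic $\mathsf{PA}^2$. Here $\vdash$ is derivability in classical many-sorted first-order logic with identity in every sort, all sorts being non-empty, and the notions are as follows. *Languages.* The signature $L_0$ has a sort of objects and, for each $n\ge 1$, a sort of $n$-ary concepts; for each $n\geq 1$ a predication symbol $R(a_1,\dots,a_n)$ relating $n$-ary concepts and $n$-tuples of objects; and, for all $m,n\ge 1$, a projection function symbol $(R,a_1,\dots,a_m)\mapsto R[a_1,\dots,a_m]$ from $(m+n)$-ary concepts and $m$-tuples of objects to $n$-ary concepts. A formula of an expansion of $L_0$ is $\Sigma^1_1$ if it consists of a block of existential quantifiers over concepts (of various arities) followed by a formula without second-order quantifiers. *The weak background theory.* $\Sigma^1_1\text{-}\mathsf{OS}$ is the $L_0$-theory whose axioms are, for all $m,n\ge 1$, (the universal closures of) - extensionality: $\forall R,S\,[R=S\leftrightarrow\forall\bar a\,(R(\bar a)\leftrightarrow S(\bar a))]$ for $n$-ary $R,S$; - projection: $\forall R\,\forall \bar a,\bar b\,[(R[\bar a])(\bar b)\leftrightarrow R(\bar a,\bar b)]$ for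 $(m+n)$-ary $R$; - the $\Sigma^1_1$-choice schema for $L_0$-formulas: $[\forall\bar x\,\exists R'\,\varphi(R',\bar x)]\rightarrow\exists R\,\forall\bar x\,\varphi(R[\bar x],\bar x)$, where $\varphi$ is $\Sigma^1_1$, possibly with parameters, $\bar x=(x_1,\dots,x_m)$, $R'$ is $n$-ary and $R$ is $(m+n)$-ary and not free in $\varphi$; - the first-order comprehension schema for $L_0$-formulas: $\exists R\,\forall\bar a\,(R(\bar a)\leftrightarrow\varphi(\bar a))$, where $\varphi$ has no second-order quantifiers, possibly has parameters, and $R$ is $n$-ary and not free in $\varphi$. *The predicative Fregean theory.* Let $\mathrm{ProvEquiv}(L_0)$ be the set of $L_0$-formulas $E(R,S)$ whose only free variables are two $n_E$-ary concept variables (for some $n_E\ge1$) such that $\Sigma^1_1\text{-}\mathsf{OS}$ proves that $E$ is an equivalence relation on $n_E$-ary concepts. Let $L_1$ be the expansion of $L_0$ by a function symbol $\partial_E$ from $n_E$-ary concepts to objects for each $E\in\mathrm{ProvEquiv}(L_0)$. The $L_1$-theory $\mathsf{PFT}$ consists of the extensionality and projection axioms, the $\Sigma^1_1$-choice schema and the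 first-order comprehension schema for $L_1$-formulas, and the abstraction principle $$A[E]:\quad \forall R,S\;(\partial_E(R)=\partial_E(S)\leftrightarrow E(R,S))$$ for each $E\in\mathrm{ProvEquiv}(L_0)$. *Second-order Peano arithmetic.* $\mathsf{PA}^2$ has a sort of numbers with $0,1,+,\cdot,<$ and, for each $n\ge1$, a sort of $n$-ary concepts (of numbers) with a predication symbol. Its axioms are (the universal closures of) $m+1\ne0$; $m+1=n+1\to m=n$; $m+0=m$; $m+(n+1)=(m+n)+1$; $m\cdot0=0$; $m\cdot(n+1)=(m\cdot n)+m$; $\neg\, m<0$; $m<n+1\leftrightarrow(m<n\vee m=n)$; the induction axiom $\forall X\,[X0\wedge\forall n\,(Xn\to X(n+1))\to\forall n\,Xn]$; extensionality for $n$-ary concepts, $n\ge 1$; and full comprehension $\exists R\,\forall\bar a\,(R(\bar a)\leftrightarrow\varphi(\bar a))$ for every formula $\varphi$ of the language, possibly with parameters, with $R$ an $n$-ary concept variable not free in $\varphi$, $n\ge1$. *Interpretation.* A theory $T$ interprets a theory $U$ if there is a translation, given by an assignment to each sort of $U$ of a sort of $T$ together with a domain formula, to each relation symbol of $U$ of a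 formula in the language of $T$, and to each function symbol of $U$ of a formula defining its graph (all without parameters, with identity translated as identity and quantifiers relativized to the domain formulas), such that the translation of every theorem of $U$ is a theorem of $T$. -/

import Mathlib

namespace Fregean

/-! ### Many-sorted first-order logic with identity in every sort -/

/-- A many-sorted signature over the set `S` of sorts: function symbols with a list of argument
sorts and a value sort, and relation symbols with a list of argument sorts. -/
structure Signature (S : Type) where
  Fn : Type
  fdom : Fn → List S
  fcod : Fn → S
  Rl : Type
  rdom : Rl → List S

variable {S : Type}

/-- The variables of sort `s` that are available in the context `Γ` (a list of sorts). -/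
inductive Var : List S → S → Type
  | zero {Γ : List S} {s : S} : Var (s :: Γ) s
  | succ {Γ : List S} {s t : S} : Var Γ s → Var (t :: Γ) s

/-- Terms of sort `s` whose variables are among those of the context `Γ`. -/
inductive Term (L : Signature S) (Γ : List S) : S → Type
  | var {s : S} (v : Var Γ s) : Term L Γ s
  | func (f : L.Fn) (ts : ∀ s : S, Var (L.fdom f) s → Term L Γ s) : Term L Γ (L.fcod f)

/-- Formulas all of whose free variables are among those of the context `Γ`. A quantifier binds
the first variable of the extended context. The remaining connectives are the usual classical
abbreviations. -/
inductive Formula (L : Signature S) : List S → Type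
  | falsum {Γ : List S} : Formula L Γ
  | eq {Γ : List S} {s : S} (t u : Term L Γ s) : Formula L Γ
  | rel {Γ : List S} (r : L.Rl) (ts : ∀ s : S, Var (L.rdom r) s → Term L Γ s) : Formula L Γ
  | imp {Γ : List S} (φ ψ : Formula L Γ) : Formula L Γ
  | all {Γ : List S} (s : S) (φ : Formula L (s :: Γ)) : Formula L Γ

/-- Sentences: formulas without free variables. -/
abbrev Sentence (L : Signature S) : Type := Formula L []

/-- A theory is a set of sentences. -/
abbrev Theory (L : Signature S) : Type := Set (Sentence L)

namespace Formula

variable {L : Signature S} {Γ : List S}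

def neg (φ : Formula L Γ) : Formula L Γ := imp φ falsum

def and (φ ψ : Formula L Γ) : Formula L Γ := neg (imp φ (neg ψ))

def or (φ ψ : Formula L Γ) : Formula L Γ := imp (neg φ) ψ

def iff (φ ψ : Formula L Γ) : Formula L Γ := and (imp φ ψ) (imp ψ φ)

def ex (s : S) (φ : Formula L (s :: Γ)) : Formula L Γ := neg (all s (neg φ))

/-- Universal quantification over a block `Δ` of variables. -/
def allBlock : (Δ : List S) → Formula L (Δ ++ Γ) → Formula L Γ
  | [], φ => φ
  | s :: Δ, φ => allBlock Δ (all s φ)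

/-- Universal closure. -/
def close : (Γ : List S) → Formula L Γ → Sentence L
  | [], φ => φ
  | s :: Γ, φ => close Γ (all s φ)

end Formula

/-! ### Renaming and substitution -/

/-- Sort-preserving renamings of variables. -/
abbrev Ren (Γ Δ : List S) : Type := ∀ s : S, Var Γ s → Var Δ s

/-- Sort-preserving substitutions of terms for variables. -/
abbrev Sub (L : Signature S) (Γ Δ : List S) : Type := ∀ s : S, Var Γ s → Term L Δ s

namespace Ren

variable {Γ Δ : List S}

def weak (s : S) : Ren Γ (s :: Γ) := fun _ v => v.succ

def nil : Ren ([] : List S) Γ := fun _ v => nomatch v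

def lift (ρ : Ren Γ Δ) (s : S) : Ren (s :: Γ) (s :: Δ)
  | _, .zero => .zero
  | _, .succ v => .succ (ρ _ v)

/-- A renaming that leaves a block `Θ` of variables alone. -/
def liftBlock (ρ : Ren Γ Δ) : (Θ : List S) → Ren (Θ ++ Γ) (Θ ++ Δ)
  | [] => ρ
  | s :: Θ => (liftBlock ρ Θ).lift s

/-- Weakening by a block `Θ` of variables. -/
def weakBlock : (Θ : List S) → Ren Γ (Θ ++ Γ)
  | [] => fun _ v => v
  | _ :: Θ => fun _ v => (weakBlock Θ _ v).succ

/-- The inclusion of the first block of variables. -/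
def inBlock : (Θ : List S) → Ren Θ (Θ ++ Γ)
  | [] => nil
  | s :: Θ => (inBlock Θ).lift s

end Ren

namespace Term

variable {L : Signature S} {Γ Δ : List S}

def rename (ρ : Ren Γ Δ) : {s : S} → Term L Γ s → Term L Δ s
  | _, var v => var (ρ _ v)
  | _, func f ts => func f (fun s v => (ts s v).rename ρ)

def subst (σ : Sub L Γ Δ) : {s : S} → Term L Γ s → Term L Δ s
  | _, var v => σ _ v
  | _, func f ts => func f (fun s v => (ts s v).subst σ)

end Term

namespace Sub

variable {L : Signature S} {Γ Δ : List S}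

def nil : Sub L [] Γ := fun _ v => nomatch v

def cons {s : S} (t : Term L Δ s) (σ : Sub L Γ Δ) : Sub L (s :: Γ) Δ
  | _, .zero => t
  | _, .succ v => σ _ v

def lift (σ : Sub L Γ Δ) (s : S) : Sub L (s :: Γ) (s :: Δ) :=
  cons (.var .zero) (fun _ v => (σ _ v).rename (Ren.weak s))

/-- The substitution that performs a renaming. -/
def ofRen (ρ : Ren Γ Δ) : Sub L Γ Δ := fun _ v => .var (ρ _ v)

end Sub

namespace Formula

variable {L : Signature S}

def rename : {Γ Δ : List S} → Ren Γ Δ → Formula L Γ → Formula L Δ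
  | _, _, _, falsum => falsum
  | _, _, ρ, eq t u => eq (t.rename ρ) (u.rename ρ)
  | _, _, ρ, rel r ts => rel r (fun s v => (ts s v).rename ρ)
  | _, _, ρ, imp φ ψ => imp (φ.rename ρ) (ψ.rename ρ)
  | _, _, ρ, all s φ => all s (φ.rename (ρ.lift s))

/-- Simultaneous capture-avoiding substitution. -/
def subst : {Γ Δ : List S} → Sub L Γ Δ → Formula L Γ → Formula L Δ
  | _, _, _, falsum => falsum
  | _, _, σ, eq t u => eq (t.subst σ) (u.subst σ)
  | _, _, σ, rel r ts => rel r (fun s v => (ts s v).subst σ)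
  | _, _, σ, imp φ ψ => imp (φ.subst σ) (ψ.subst σ)
  | _, _, σ, all s φ => all s (φ.subst (σ.lift s))

/-- Instantiation of the first variable by a term. -/
def inst {Γ : List S} {s : S} (φ : Formula L (s :: Γ)) (t : Term L Γ s) : Formula L Γ :=
  φ.subst (Sub.cons t (fun _ v => .var v))

end Formula

/-! ### Derivability -/

/-- Natural deduction for classical many-sorted first-order logic with identity, every sort being
non-empty. `Prf T Γ H φ`: the formula `φ` is derivable from the axioms in `T` and the open
assumptions `H`, where the free variables of `φ` and of `H` are those of the context `Γ`. -/
inductive Prf {L : Signature S} (T : Theory L) :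
    (Γ : List S) → List (Formula L Γ) → Formula L Γ → Prop
  | axm {Γ : List S} {H : List (Formula L Γ)} {σ : Sentence L} :
      σ ∈ T → Prf T Γ H (σ.rename Ren.nil)
  | hyp {Γ : List S} {H : List (Formula L Γ)} {φ : Formula L Γ} :
      φ ∈ H → Prf T Γ H φ
  | impI {Γ : List S} {H : List (Formula L Γ)} {φ ψ : Formula L Γ} :
      Prf T Γ (φ :: H) ψ → Prf T Γ H (.imp φ ψ)
  | impE {Γ : List S} {H : List (Formula L Γ)} {φ ψ : Formula L Γ} :
      Prf T Γ H (.imp φ ψ) → Prf T Γ H φ → Prf T Γ H ψ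
  | raa {Γ : List S} {H : List (Formula L Γ)} {φ : Formula L Γ} :
      Prf T Γ (φ.neg :: H) .falsum → Prf T Γ H φ
  | allI {Γ : List S} {H : List (Formula L Γ)} {s : S} {φ : Formula L (s :: Γ)} :
      Prf T (s :: Γ) (H.map (Formula.rename (Ren.weak s))) φ → Prf T Γ H (.all s φ)
  | allE {Γ : List S} {H : List (Formula L Γ)} {s : S} {φ : Formula L (s :: Γ)}
      (t : Term L Γ s) : Prf T Γ H (.all s φ) → Prf T Γ H (φ.inst t)
  | nonempty {Γ : List S} {H : List (Formula L Γ)} (s : S) :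
      Prf T Γ H (.ex s (.eq (.var .zero) (.var .zero)))
  | eqRefl {Γ : List S} {H : List (Formula L Γ)} {s : S} (t : Term L Γ s) :
      Prf T Γ H (.eq t t)
  | eqSubst {Γ : List S} {H : List (Formula L Γ)} {s : S} {t u : Term L Γ s}
      (φ : Formula L (s :: Γ)) :
      Prf T Γ H (.eq t u) → Prf T Γ H (φ.inst t) → Prf T Γ H (φ.inst u)

/-- `T ⊢ σ`. -/
def Proves {L : Signature S} (T : Theory L) (σ : Sentence L) : Prop := Prf T [] [] σ

/-! ### Interpretations -/

/-- A translation of the language `L` into the language `K`: each sort of `L` is assigned a sort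
of `K` together with a domain formula, each relation symbol of `L` a formula of `K`, and each
function symbol of `L` a formula of `K` that defines its graph (the first variable is the value).
There are no parameters, and identity is translated as identity. -/
structure Translation {S S' : Type} (L : Signature S) (K : Signature S') where
  srt : S → S'
  dom : (s : S) → Formula K [srt s]
  rel : (r : L.Rl) → Formula K ((L.rdom r).map srt)
  fn : (f : L.Fn) → Formula K (srt (L.fcod f) :: (L.fdom f).map srt)

namespace Translation

variable {S' : Type} {L : Signature S} {K : Signature S'} (τ : Translation L K)

/-- The variable of the target language that corresponds to a variable of `L`. -/
def var : {Γ : List S} → {s : S} → Var Γ s → Var (Γ.map τ.srt) (τ.srt s)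
  | _, _, .zero => .zero
  | _, _, .succ v => .succ (var v)

/-- The domain formula of the sort `s`, applied to the first variable. -/
def domAt (s : S) (Γ : List S') : Formula K (τ.srt s :: Γ) :=
  (τ.dom s).rename (Ren.lift Ren.nil _)

/-- `∃ y₁ … yₖ (⋀ᵢ (dom(yᵢ) ∧ P i yᵢ) ∧ body(y₁, …, yₖ))`, where `y₁, …, yₖ` correspond to the
variables of the context `Δ`. -/
def exArgs {Γ : List S'} : (Δ : List S) →
    (P : ∀ s : S, Var Δ s → Formula K (τ.srt s :: Γ)) →
    (body : Formula K (Δ.map τ.srt ++ Γ)) → Formula K Γ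
  | [], _, body => body
  | s :: Δ, P, body =>
      exArgs Δ (fun _ v => P _ v.succ)
        (.ex (τ.srt s) (.and (.and (τ.domAt s _)
          ((P s .zero).rename (Ren.lift (Ren.weakBlock (Δ.map τ.srt)) _))) body))

/-- The translation of "the value of the term `t` is `y`", where `y` is the first variable. -/
def term {Γ : List S} : {s : S} → Term L Γ s → Formula K (τ.srt s :: Γ.map τ.srt)
  | _, .var v => .eq (.var .zero) (.var (.succ (τ.var v)))
  | _, .func f ts =>
      τ.exArgs (L.fdom f)
        (fun s v => (term (ts s v)).rename (Ren.lift (Ren.weak _) _))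
        ((τ.fn f).subst (Sub.cons (.var (Ren.weakBlock ((L.fdom f).map τ.srt) _ .zero))
          (Sub.ofRen (Ren.inBlock ((L.fdom f).map τ.srt)))))

/-- The translation of formulas; quantifiers are relativized to the domain formulas. -/
def formula : {Γ : List S} → Formula L Γ → Formula K (Γ.map τ.srt)
  | _, .falsum => .falsum
  | _, .eq (s := s) t u => .ex (τ.srt s) (.and (τ.domAt s _) (.and (τ.term t) (τ.term u)))
  | _, .rel r ts =>
      τ.exArgs (L.rdom r) (fun s v => τ.term (ts s v))
        ((τ.rel r).rename (Ren.inBlock ((L.rdom r).map τ.srt)))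
  | _, .imp φ ψ => .imp (formula φ) (formula ψ)
  | _, .all s φ => .all (τ.srt s) (.imp (τ.domAt s _) (formula φ))

end Translation

/-- The theory `T` interprets the theory `U`: under a suitable translation of the primitives of the
language of `U`, the translations of the theorems of `U` are theorems of `T`. -/
def Interprets {S S' : Type} {K : Signature S'} {L : Signature S} (T : Theory K) (U : Theory L) :
    Prop :=
  ∃ τ : Translation L K, ∀ σ : Sentence L, Proves U σ → Proves T (τ.formula σ)

/-! ### Second-order languages

The sorts are natural numbers: `0` is the sort of objects, and `n ≥ 1` is the sort of `n`-ary
concepts. -/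

/-- The expansion of the signature `X` by a predication symbol for `(n+1)`-ary concepts, for every
`n : ℕ`. -/
def SO (X : Signature ℕ) : Signature ℕ where
  Fn := X.Fn
  fdom := X.fdom
  fcod := X.fcod
  Rl := ℕ ⊕ X.Rl
  rdom := Sum.elim (fun n => (n + 1) :: List.replicate (n + 1) 0) X.rdom

/-- The list consisting of `n` copies of the sort of objects. -/
abbrev objs (n : ℕ) : List ℕ := List.replicate n 0

/-- The variables of the context that consists of `n` object variables. -/
def objIdx : (n : ℕ) → Fin n → Var (objs n) 0
  | 0, i => i.elim0
  | n + 1, i => Fin.cases (motive := fun _ => Var (objs (n + 1)) 0)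
      .zero (fun j => .succ (objIdx n j)) i

/-- The variables of a first block of `n` object variables. -/
def objVar {Γ : List ℕ} (n : ℕ) (i : Fin n) : Var (objs n ++ Γ) 0 :=
  Ren.inBlock (objs n) 0 (objIdx n i)

/-- An `n`-tuple of terms for objects, as a list of arguments. -/
def tuple {L : Signature ℕ} {Γ : List ℕ} : (n : ℕ) → (Fin n → Term L Γ 0) → Sub L (objs n) Γ
  | 0, _ => Sub.nil
  | n + 1, a => Sub.cons (a 0) (tuple n (fun i => a i.succ))

section

variable {X : Signature ℕ}

/-- `R(a₁, …, aₙ₊₁)`. -/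
def pred {Γ : List ℕ} {n : ℕ} (R : Term (SO X) Γ (n + 1)) (a : Fin (n + 1) → Term (SO X) Γ 0) :
    Formula (SO X) Γ :=
  .rel (L := SO X) (Sum.inl n) (Sub.cons R (tuple (n + 1) a))

/-- The extensionality axiom for `(n+1)`-ary concepts:
`∀ R S (R = S ↔ ∀ a (R(a) ↔ S(a)))`. -/
def extAx (n : ℕ) : Sentence (SO X) :=
  .all (n + 1) (.all (n + 1) (.iff
    (.eq (.var (.succ .zero)) (.var .zero))
    (.allBlock (objs (n + 1)) (.iff
      (pred (n := n) (.var (Ren.weakBlock (objs (n + 1)) _ (.succ .zero)))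
        (fun i => .var (objVar (n + 1) i)))
      (pred (n := n) (.var (Ren.weakBlock (objs (n + 1)) _ .zero))
        (fun i => .var (objVar (n + 1) i)))))))

/-- The comprehension axiom for `φ(x₁, …, xₙ₊₁)` with parameters from `Γ`:
the universal closure of `∃ R ∀ a (R(a) ↔ φ(a))`. -/
def compAx (n : ℕ) (Γ : List ℕ) (φ : Formula (SO X) (objs (n + 1) ++ Γ)) : Sentence (SO X) :=
  .close Γ (.ex (n + 1) (.allBlock (objs (n + 1)) (.iff
    (pred (n := n) (.var (Ren.weakBlock (objs (n + 1)) _ .zero))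
      (fun i => .var (objVar (n + 1) i)))
    (φ.rename (Ren.liftBlock (Ren.weak (n + 1)) (objs (n + 1)))))))

end

/-- Formulas without second-order quantifiers. -/
def IsFO {L : Signature ℕ} : {Γ : List ℕ} → Formula L Γ → Prop
  | _, .falsum => True
  | _, .eq _ _ => True
  | _, .rel _ _ => True
  | _, .imp φ ψ => IsFO φ ∧ IsFO ψ
  | _, .all s φ => s = 0 ∧ IsFO φ

/-- `Σ¹₁`-formulas: a block of existential quantifiers over concepts of various arities, followed
by a formula without second-order quantifiers. -/
inductive IsSigma11 {L : Signature ℕ} : {Γ : List ℕ} → Formula L Γ → Prop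
  | fo {Γ : List ℕ} {φ : Formula L Γ} : IsFO φ → IsSigma11 φ
  | ex {Γ : List ℕ} {n : ℕ} {φ : Formula L ((n + 1) :: Γ)} :
      IsSigma11 φ → IsSigma11 (.ex (n + 1) φ)

/-! ### Second-order logic with projection and abstraction symbols -/

/-- The function symbols: a projection symbol `(R, a₁, …, aₘ₊₁) ↦ R[a₁, …, aₘ₊₁]` from
`((m+1)+(n+1))`-ary concepts and `(m+1)`-tuples of objects to `(n+1)`-ary concepts, for all
`m n : ℕ`, and an abstraction symbol `∂_d` for every `d : D`. -/
inductive FregeFn (D : Type) : Type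
  | proj (m n : ℕ)
  | del (d : D)

/-- The projection symbols and the abstraction symbols; `∂_d` takes `(ar d + 1)`-ary concepts
to objects. -/
def fregeSig {D : Type} (ar : D → ℕ) : Signature ℕ where
  Fn := FregeFn D
  fdom
    | .proj m n => ((m + 1) + (n + 1)) :: objs (m + 1)
    | .del d => [ar d + 1]
  fcod
    | .proj _ n => n + 1
    | .del _ => 0
  Rl := Empty
  rdom := Empty.elim

/-- The expansion of the language of the background second-order logic by abstraction symbols. -/
abbrev LF {D : Type} (ar : D → ℕ) : Signature ℕ := SO (fregeSig ar)

section

variable {D : Type} {ar : D → ℕ}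

/-- `R[a₁, …, aₘ₊₁]`. -/
def projT {Γ : List ℕ} (m n : ℕ) (R : Term (LF ar) Γ ((m + 1) + (n + 1)))
    (a : Fin (m + 1) → Term (LF ar) Γ 0) : Term (LF ar) Γ (n + 1) :=
  .func (L := LF ar) (FregeFn.proj m n) (Sub.cons R (tuple (m + 1) a))

/-- `∂_d(R)`. -/
def delT {Γ : List ℕ} (d : D) (R : Term (LF ar) Γ (ar d + 1)) : Term (LF ar) Γ 0 :=
  .func (L := LF ar) (FregeFn.del d) (Sub.cons R Sub.nil)

/-- The projection axiom `∀ R ∀ a b ((R[a])(b) ↔ R(a, b))`. -/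
def projAx (ar : D → ℕ) (m n : ℕ) : Sentence (LF ar) :=
  .all ((m + 1) + (n + 1)) (.allBlock (objs (m + 1)) (.allBlock (objs (n + 1))
    (let R : Term (LF ar) (objs (n + 1) ++ (objs (m + 1) ++ [(m + 1) + (n + 1)]))
        ((m + 1) + (n + 1)) :=
      .var (Ren.weakBlock (objs (n + 1)) _ (Ren.weakBlock (objs (m + 1)) _ .zero))
    let a : Fin (m + 1) → Term (LF ar) (objs (n + 1) ++ (objs (m + 1) ++ [(m + 1) + (n + 1)])) 0 :=
      fun i => .var (Ren.weakBlock (objs (n + 1)) _ (objVar (m + 1) i))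
    let b : Fin (n + 1) → Term (LF ar) (objs (n + 1) ++ (objs (m + 1) ++ [(m + 1) + (n + 1)])) 0 :=
      fun i => .var (objVar (n + 1) i)
    let ab : Fin ((m + 1) + (n + 1)) →
        Term (LF ar) (objs (n + 1) ++ (objs (m + 1) ++ [(m + 1) + (n + 1)])) 0 := Fin.append a b
    .iff (pred (n := n) (projT m n R a) b) (pred (n := m + 1 + n) R ab))))

/-- The choice axiom for `φ(R', x₁, …, xₘ₊₁)` with parameters from `Γ`: the universal closure of
`∀ x ∃ R' φ(R', x) → ∃ R ∀ x φ(R[x], x)`, where `R'` is `(n+1)`-ary. -/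
def choiceAx (m n : ℕ) (Γ : List ℕ)
    (φ : Formula (LF ar) ((n + 1) :: (objs (m + 1) ++ Γ))) : Sentence (LF ar) :=
  .close Γ (.imp
    (.allBlock (objs (m + 1)) (.ex (n + 1) φ))
    (.ex ((m + 1) + (n + 1)) (.allBlock (objs (m + 1))
      (φ.subst (Sub.cons
        (projT m n (.var (Ren.weakBlock (objs (m + 1)) _ .zero))
          (fun i => .var (objVar (m + 1) i)))
        (Sub.ofRen (Ren.liftBlock (Ren.weak _) (objs (m + 1)))))))))

end

/-- Extensionality, projection, `Σ¹₁`-choice and first-order comprehension, the two schemas for all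
formulas of the language with the given abstraction symbols. -/
inductive OSAx {D : Type} (ar : D → ℕ) : Sentence (LF ar) → Prop
  | ext (n : ℕ) : OSAx ar (extAx n)
  | proj (m n : ℕ) : OSAx ar (projAx ar m n)
  | choice (m n : ℕ) (Γ : List ℕ) (φ : Formula (LF ar) ((n + 1) :: (objs (m + 1) ++ Γ))) :
      IsSigma11 φ → OSAx ar (choiceAx m n Γ φ)
  | comp (n : ℕ) (Γ : List ℕ) (φ : Formula (LF ar) (objs (n + 1) ++ Γ)) :
      IsFO φ → OSAx ar (compAx n Γ φ)

/-- The language `L₀` of the background second-order logic. -/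
abbrev L0 : Signature ℕ := LF Empty.elim

/-- The weak background theory `Σ¹₁-OS` of second-order logic. -/
def Sigma11OS : Theory L0 := {σ | OSAx Empty.elim σ}

/-- `E(t, u)`, for a formula `E(R, S)` in two free concept variables. -/
def app2 {L : Signature ℕ} {Γ : List ℕ} {n : ℕ} (E : Formula L [n, n]) (t u : Term L Γ n) :
    Formula L Γ :=
  E.subst (Sub.cons t (Sub.cons u Sub.nil))

/-- The sentence `Equiv(E)`, saying that `E` is an equivalence relation. -/
def equivSentence {L : Signature ℕ} {n : ℕ} (E : Formula L [n, n]) : Sentence L :=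
  .all n (.all n (.all n
    (let R : Term L [n, n, n] n := .var (.succ (.succ .zero))
    let S : Term L [n, n, n] n := .var (.succ .zero)
    let T : Term L [n, n, n] n := .var .zero
    .and (app2 E R R) (.and
      (.imp (app2 E R S) (app2 E S R))
      (.imp (.and (app2 E R S) (app2 E S T)) (app2 E R T))))))

/-- `ProvEquiv(L₀)`: the `L₀`-formulas `E(R, S)` in two free variables for `(arity + 1)`-ary
concepts that are provably equivalence relations in `Σ¹₁-OS`. -/
structure ProvEquiv : Type where
  arity : ℕ
  E : Formula L0 [arity + 1, arity + 1]
  prov : Proves Sigma11OS (equivSentence E)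

/-- The language `L₁`: the expansion of `L₀` by a symbol `∂_E` for each `E` in
`ProvEquiv(L₀)`. -/
abbrev L1 : Signature ℕ := LF ProvEquiv.arity

/-- `L₀`-terms as terms of an expansion of `L₀`. -/
def Term.expand {D : Type} (ar : D → ℕ) {Γ : List ℕ} :
    {s : ℕ} → Term L0 Γ s → Term (LF ar) Γ s
  | _, .var v => .var v
  | _, .func (FregeFn.proj m n) ts =>
      .func (L := LF ar) (FregeFn.proj m n) (fun s v => (ts s v).expand ar)

/-- `L₀`-formulas as formulas of an expansion of `L₀`. -/
def Formula.expand {D : Type} (ar : D → ℕ) : {Γ : List ℕ} → Formula L0 Γ → Formula (LF ar) Γ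
  | _, .falsum => .falsum
  | _, .eq t u => .eq (t.expand ar) (u.expand ar)
  | _, .rel (Sum.inl n) ts =>
      .rel (L := LF ar) (Sum.inl n) (fun s v => (ts s v).expand ar)
  | _, .imp φ ψ => .imp (φ.expand ar) (ψ.expand ar)
  | _, .all s φ => .all s (φ.expand ar)

/-- The abstraction principle `A[E]`: `∀ R S (∂_E(R) = ∂_E(S) ↔ E(R, S))`. -/
def abstractionAx (e : ProvEquiv) : Sentence L1 :=
  .all (e.arity + 1) (.all (e.arity + 1)
    (let R : Term L1 [e.arity + 1, e.arity + 1] (e.arity + 1) := .var (.succ .zero)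
    let S : Term L1 [e.arity + 1, e.arity + 1] (e.arity + 1) := .var .zero
    .iff (.eq (delT (ar := ProvEquiv.arity) e R) (delT (ar := ProvEquiv.arity) e S))
      (app2 (e.E.expand ProvEquiv.arity) R S)))

/-- The predicative Fregean theory. -/
def PFT : Theory L1 := {σ | OSAx ProvEquiv.arity σ} ∪ Set.range abstractionAx

/-! ### Second-order Peano arithmetic -/

inductive ArithFn : Type
  | zero
  | one
  | add
  | mul

/-- The signature `0, 1, +, ·, <` of arithmetic on the objects. -/
def arithSig : Signature ℕ where
  Fn := ArithFn
  fdom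
    | .zero => []
    | .one => []
    | .add => [0, 0]
    | .mul => [0, 0]
  fcod := fun _ => 0
  Rl := Unit
  rdom := fun _ => [0, 0]

/-- The language of second-order arithmetic: `0, 1, +, ·, <` on the objects (the numbers), and
`n`-ary concepts with predication for all `n ≥ 1`. -/
abbrev LPA : Signature ℕ := SO arithSig

namespace PA

variable {Γ : List ℕ}

def zero : Term LPA Γ 0 := .func (L := LPA) ArithFn.zero Sub.nil

def one : Term LPA Γ 0 := .func (L := LPA) ArithFn.one Sub.nil

def add (t u : Term LPA Γ 0) : Term LPA Γ 0 :=
  .func (L := LPA) ArithFn.add (Sub.cons t (Sub.cons u Sub.nil))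

def mul (t u : Term LPA Γ 0) : Term LPA Γ 0 :=
  .func (L := LPA) ArithFn.mul (Sub.cons t (Sub.cons u Sub.nil))

def lt (t u : Term LPA Γ 0) : Formula LPA Γ :=
  .rel (L := LPA) (Sum.inr ()) (Sub.cons t (Sub.cons u Sub.nil))

/-- The sentence `∀ m n φ(m, n)`. -/
def all2 (φ : Term LPA [0, 0] 0 → Term LPA [0, 0] 0 → Formula LPA [0, 0]) : Sentence LPA :=
  .all 0 (.all 0 (φ (.var (.succ .zero)) (.var .zero)))

/-- The induction axiom `∀ X (X0 ∧ ∀ n (Xn → X(n+1)) → ∀ n Xn)`. -/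
def indAx : Sentence LPA :=
  .all 1 (.imp
    (.and (pred (n := 0) (.var .zero) (fun _ => zero))
      (.all 0 (.imp
        (pred (n := 0) (.var (.succ .zero)) (fun _ => .var .zero))
        (pred (n := 0) (.var (.succ .zero)) (fun _ => add (.var .zero) one)))))
    (.all 0 (pred (n := 0) (.var (.succ .zero)) (fun _ => .var .zero))))

end PA

open PA in
/-- The axioms of full second-order Peano arithmetic. -/
inductive PA2Ax : Sentence LPA → Prop
  | succ_ne_zero : PA2Ax (all2 fun m _ => .neg (.eq (add m one) zero))
  | succ_inj : PA2Ax (all2 fun m n => .imp (.eq (add m one) (add n one)) (.eq m n))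
  | add_zero : PA2Ax (all2 fun m _ => .eq (add m zero) m)
  | add_succ : PA2Ax (all2 fun m n => .eq (add m (add n one)) (add (add m n) one))
  | mul_zero : PA2Ax (all2 fun m _ => .eq (mul m zero) zero)
  | mul_succ : PA2Ax (all2 fun m n => .eq (mul m (add n one)) (add (mul m n) m))
  | not_lt_zero : PA2Ax (all2 fun m _ => .neg (lt m zero))
  | lt_succ : PA2Ax (all2 fun m n => .iff (lt m (add n one)) (.or (lt m n) (.eq m n)))
  | ind : PA2Ax indAx
  | ext (n : ℕ) : PA2Ax (extAx n)
  | comp (n : ℕ) (Γ : List ℕ) (φ : Formula LPA (objs (n + 1) ++ Γ)) : PA2Ax (compAx n Γ φ)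

/-- Full second-order Peano arithmetic `PA²`. -/
def PA2 : Theory LPA := {σ | PA2Ax σ}

end Fregean

namespace Fregean

variable {S : Type}

/-! ### Renaming and substitution -/

section Substitution

variable {L : Signature S} {Γ Δ Θ : List S}

/-! The argument is semantic. Completeness for countable languages (`complete`), with soundness on
the side of arithmetic, reduces the claim to a single translation that defines a model of `PA2` in
every model of `PFT` (`interprets_of_defines`).

The heart of the matter is that models of `PFT` satisfy full comprehension for formulas of `L0`. For
every `L0`-formula χ(W) in one concept variable, having the same truth value for χ is an equivalence
relation on purely logical grounds, so there is an abstraction operator ∂ for it, and comparing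
values of ∂ decides χ. If some T[b] satisfies χ, then χ(T[a]) holds exactly when ∂(T[a]) = ∂(T[b]),
a condition without second-order quantifiers; if no T[b] does, the concept sought is empty. In both
cases first-order comprehension for `L1` supplies the concept (`Models.rich`). For a formula with
several object and concept parameters, `Rich.exists_code` packs all their values into one projection
T[a], from which an `L0`-formula recovers them, and `Rich.define` draws the conclusion. The Russell
concept is not an instance: its definition has a bound concept variable under ∂, whereas bound
concept variables are allowed here only in formulas without ∂.

Infinity comes from Basic Law V for unary concepts, which is the abstraction principle for identity.
The map sending x to the extension of {x} is injective and misses the extension of the empty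
concept, and its graph is a concept by first-order comprehension (`Models.exists_succ`). Once that
graph is a concept it can be passed as a parameter, so no ∂ is needed any longer: the numbers,
addition and multiplication are least closed concepts, defined by `L0`-formulas
(`Rich.exists_arith`), and Dedekind's development of arithmetic goes through (`Arith.rec_total`,
`Arith.models`). Concepts of numbers are the concepts all of whose instances are tuples of numbers;
comprehension for them is `Rich.define` applied to the translated formula (`Arith.comprehension`).

This interpretation has five parameters: the numbers, zero, successor, addition and multiplication.
They form the only tuple satisfying a certain `L1`-formula (`Models.exists_params`), so `wrap` can
quantify them away. -/

theorem Sub.lift_var (s : S) :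
    Sub.lift (fun _ v => Term.var v : Sub L Γ Γ) s = fun _ v => .var v := by
  funext t v; cases v <;> rfl

theorem Ren.lift_id (s : S) : Ren.lift (fun _ v => v : Ren Γ Γ) s = fun _ v => v := by
  funext t v; cases v <;> rfl

theorem Ren.nil_eq (σ τ : Ren [] Γ) : σ = τ := by
  funext s v; cases v

namespace Term

theorem rename_id {s : S} (t : Term L Γ s) : t.rename (fun _ v => v) = t := by
  induction t with
  | var v => rfl
  | func f ts ih => simp only [rename, ih]

theorem subst_var {s : S} (t : Term L Γ s) : t.subst (fun _ v => .var v) = t := by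
  induction t with
  | var v => rfl
  | func f ts ih => simp only [subst, ih]

theorem rename_rename (ρ : Ren Γ Δ) (ρ' : Ren Δ Θ) {s : S} (t : Term L Γ s) :
    (t.rename ρ).rename ρ' = t.rename (fun _ v => ρ' _ (ρ _ v)) := by
  induction t with
  | var v => rfl
  | func f ts ih => simp only [rename, ih]

theorem subst_rename (ρ : Ren Γ Δ) (σ : Sub L Δ Θ) {s : S} (t : Term L Γ s) :
    (t.rename ρ).subst σ = t.subst (fun _ v => σ _ (ρ _ v)) := by
  induction t with
  | var v => rfl
  | func f ts ih => simp only [rename, subst, ih]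

theorem rename_subst (σ : Sub L Γ Δ) (ρ : Ren Δ Θ) {s : S} (t : Term L Γ s) :
    (t.subst σ).rename ρ = t.subst (fun _ v => (σ _ v).rename ρ) := by
  induction t with
  | var v => rfl
  | func f ts ih => simp only [rename, subst, ih]

theorem subst_subst (σ : Sub L Γ Δ) (τ : Sub L Δ Θ) {s : S} (t : Term L Γ s) :
    (t.subst σ).subst τ = t.subst (fun _ v => (σ _ v).subst τ) := by
  induction t with
  | var v => rfl
  | func f ts ih => simp only [subst, ih]

theorem rename_eq_subst (ρ : Ren Γ Δ) {s : S} (t : Term L Γ s) :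
    t.rename ρ = t.subst (Sub.ofRen ρ) := by
  induction t with
  | var v => rfl
  | func f ts ih => simp only [rename, subst, ih]

end Term

theorem Sub.lift_ofRen (ρ : Ren Γ Δ) (s : S) :
    Sub.lift (Sub.ofRen ρ : Sub L Γ Δ) s = Sub.ofRen (ρ.lift s) := by
  funext t v; cases v <;> rfl

theorem Sub.lift_rename (σ : Sub L Γ Δ) (ρ : Ren Δ Θ) (s : S) :
    (fun _ v => (σ.lift s _ v).rename (ρ.lift s)) = Sub.lift (fun _ v => (σ _ v).rename ρ) s := by
  funext t v
  cases v with
  | zero => rfl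
  | succ v => simp only [Sub.lift, Sub.cons, Term.rename_rename]; rfl

theorem Sub.lift_subst (σ : Sub L Γ Δ) (τ : Sub L Δ Θ) (s : S) :
    (fun _ v => (σ.lift s _ v).subst (τ.lift s)) = Sub.lift (fun _ v => (σ _ v).subst τ) s := by
  funext t v
  cases v with
  | zero => rfl
  | succ v => simp only [Sub.lift, Sub.cons, Term.subst_rename, Term.rename_subst]; rfl

namespace Formula

theorem rename_id (φ : Formula L Γ) : φ.rename (fun _ v => v) = φ := by
  induction φ with
  | falsum => rfl
  | eq t u => simp only [rename, Term.rename_id]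
  | rel r ts => simp only [rename, Term.rename_id]
  | imp φ ψ ih₁ ih₂ => simp only [rename, ih₁, ih₂]
  | all s φ ih => simp only [rename, Ren.lift_id, ih]

theorem subst_var (φ : Formula L Γ) : φ.subst (fun _ v => .var v) = φ := by
  induction φ with
  | falsum => rfl
  | eq t u => simp only [subst, Term.subst_var]
  | rel r ts => simp only [subst, Term.subst_var]
  | imp φ ψ ih₁ ih₂ => simp only [subst, ih₁, ih₂]
  | all s φ ih => simp only [subst, Sub.lift_var, ih]

theorem rename_eq_subst (φ : Formula L Γ) {Δ : List S} (ρ : Ren Γ Δ) :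
    φ.rename ρ = φ.subst (Sub.ofRen ρ) := by
  induction φ generalizing Δ with
  | falsum => rfl
  | eq t u => simp only [rename, subst, Term.rename_eq_subst]
  | rel r ts => simp only [rename, subst, Term.rename_eq_subst]
  | imp φ ψ ih₁ ih₂ => simp only [rename, subst, ih₁, ih₂]
  | all s φ ih => simp only [rename, subst, ih, Sub.lift_ofRen]

theorem subst_subst (φ : Formula L Γ) {Δ Θ : List S} (σ : Sub L Γ Δ) (τ : Sub L Δ Θ) :
    (φ.subst σ).subst τ = φ.subst (fun _ v => (σ _ v).subst τ) := by
  induction φ generalizing Δ Θ with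
  | falsum => rfl
  | eq t u => simp only [subst, Term.subst_subst]
  | rel r ts => simp only [subst, Term.subst_subst]
  | imp φ ψ ih₁ ih₂ => simp only [subst, ih₁, ih₂]
  | all s φ ih => simp only [subst, ih, Sub.lift_subst]

theorem rename_rename (φ : Formula L Γ) (ρ : Ren Γ Δ) (ρ' : Ren Δ Θ) :
    (φ.rename ρ).rename ρ' = φ.rename (fun _ v => ρ' _ (ρ _ v)) := by
  simp only [rename_eq_subst, subst_subst]; rfl

theorem subst_rename (φ : Formula L Γ) (ρ : Ren Γ Δ) (σ : Sub L Δ Θ) :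
    (φ.rename ρ).subst σ = φ.subst (fun _ v => σ _ (ρ _ v)) := by
  simp only [rename_eq_subst, subst_subst]; rfl

theorem rename_subst (φ : Formula L Γ) (σ : Sub L Γ Δ) (ρ : Ren Δ Θ) :
    (φ.subst σ).rename ρ = φ.subst (fun _ v => (σ _ v).rename ρ) := by
  simp only [rename_eq_subst, subst_subst, Term.rename_eq_subst]

theorem inst_subst_lift {s : S} (φ : Formula L (s :: Γ)) (σ : Sub L Γ Δ) (t : Term L Δ s) :
    (φ.subst (σ.lift s)).inst t = φ.subst (Sub.cons t σ) := by
  rw [inst, subst_subst]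
  congr 1
  funext r v
  cases v with
  | zero => rfl
  | succ v => simp only [Sub.lift, Sub.cons, Term.subst_rename, Ren.weak, Term.subst_var]

theorem inst_rename_lift {s : S} (φ : Formula L (s :: Γ)) (ρ : Ren Γ Δ) (t : Term L Δ s) :
    (φ.rename (ρ.lift s)).inst t = φ.subst (Sub.cons t (Sub.ofRen ρ)) := by
  rw [rename_eq_subst, ← Sub.lift_ofRen, inst_subst_lift]

theorem rename_inst {s : S} (φ : Formula L (s :: Γ)) (t : Term L Γ s) (ρ : Ren Γ Δ) :
    (φ.inst t).rename ρ = (φ.rename (ρ.lift s)).inst (t.rename ρ) := by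
  rw [inst_rename_lift, inst, rename_subst]
  congr 1
  funext r v
  cases v <;> rfl

end Formula

end Substitution

/-! ### Semantics -/

/-- Assignments of elements of `C` to the variables of a context. -/
abbrev Asg (C : S → Type) (Γ : List S) : Type := ∀ s : S, Var Γ s → C s

namespace Asg

variable {C : S → Type} {Γ : List S}

def nil : Asg C [] := fun _ v => nomatch v

def cons {s : S} (a : C s) (e : Asg C Γ) : Asg C (s :: Γ)
  | _, .zero => a
  | _, .succ v => e _ v

@[simp] theorem cons_zero {s : S} (a : C s) (e : Asg C Γ) : cons a e s .zero = a := rfl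

@[simp] theorem cons_succ {s t : S} (a : C s) (e : Asg C Γ) (v : Var Γ t) :
    cons a e t v.succ = e t v := rfl

theorem cons_eta {s : S} (e : Asg C (s :: Γ)) : cons (e _ .zero) (fun _ v => e _ v.succ) = e := by
  funext t v; cases v <;> rfl

theorem nil_eq (e e' : Asg C []) : e = e' := by
  funext s v; cases v

/-- The assignment on `Δ ++ Γ` that consists of an assignment on `Δ` and one on `Γ`. -/
def append : {Δ : List S} → Asg C Δ → Asg C Γ → Asg C (Δ ++ Γ)
  | [], _, e => e
  | _ :: _, d, e => cons (d _ .zero) (append (fun _ v => d _ v.succ) e)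

@[simp] theorem append_inBlock {Δ : List S} (d : Asg C Δ) (e : Asg C Γ) {s : S} (v : Var Δ s) :
    append d e s (Ren.inBlock Δ s v) = d s v := by
  induction Δ with
  | nil => cases v
  | cons r Δ ih =>
    cases v with
    | zero => rfl
    | succ v => exact ih _ _

@[simp] theorem append_weakBlock {Δ : List S} (d : Asg C Δ) (e : Asg C Γ) {s : S} (v : Var Γ s) :
    append d e s (Ren.weakBlock Δ s v) = e s v := by
  induction Δ with
  | nil => rfl
  | cons r Δ ih => exact ih _

end Asg

/-- Structures with non-empty carriers. -/
structure Struc (L : Signature S) where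
  C : S → Type
  ne : ∀ s, Nonempty (C s)
  fn : ∀ f : L.Fn, Asg C (L.fdom f) → C (L.fcod f)
  rl : ∀ r : L.Rl, Asg C (L.rdom r) → Prop

section Semantics

variable {L : Signature S} (M : Struc L) {Γ Δ : List S}

def Term.eval : {s : S} → Term L Γ s → Asg M.C Γ → M.C s
  | _, .var v, e => e _ v
  | _, .func f ts, e => M.fn f (fun s v => (ts s v).eval e)

def Formula.Sat : {Γ : List S} → Formula L Γ → Asg M.C Γ → Prop
  | _, .falsum, _ => False
  | _, .eq t u, e => t.eval M e = u.eval M e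
  | _, .rel r ts, e => M.rl r (fun s v => (ts s v).eval M e)
  | _, .imp φ ψ, e => φ.Sat e → ψ.Sat e
  | _, .all s φ, e => ∀ a : M.C s, φ.Sat (Asg.cons a e)

/-- `M` is a model of `T`. -/
def Models (T : Theory L) : Prop := ∀ σ ∈ T, σ.Sat M Asg.nil

namespace Term

@[simp] theorem eval_var {s : S} (v : Var Γ s) (e : Asg M.C Γ) : (var v).eval M e = e _ v := rfl

theorem eval_func (f : L.Fn) (ts : ∀ s : S, Var (L.fdom f) s → Term L Γ s) (e : Asg M.C Γ) :
    (func f ts).eval M e = M.fn f (fun s v => (ts s v).eval M e) := rfl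

theorem eval_rename (ρ : Ren Γ Δ) {s : S} (t : Term L Γ s) (e : Asg M.C Δ) :
    (t.rename ρ).eval M e = t.eval M (fun _ v => e _ (ρ _ v)) := by
  induction t with
  | var v => rfl
  | func f ts ih => simp only [rename, eval, ih]

theorem eval_subst (σ : Sub L Γ Δ) {s : S} (t : Term L Γ s) (e : Asg M.C Δ) :
    (t.subst σ).eval M e = t.eval M (fun _ v => (σ _ v).eval M e) := by
  induction t with
  | var v => rfl
  | func f ts ih => simp only [subst, eval, ih]

@[simp] theorem eval_rename_weak {s r : S} (t : Term L Γ s) (a : M.C r) (e : Asg M.C Γ) :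
    (t.rename (Ren.weak r)).eval M (Asg.cons a e) = t.eval M e :=
  eval_rename ..

end Term

namespace Formula

@[simp] theorem sat_falsum (e : Asg M.C Γ) : (falsum : Formula L Γ).Sat M e ↔ False := Iff.rfl

@[simp] theorem sat_eq {s : S} (t u : Term L Γ s) (e : Asg M.C Γ) :
    (eq t u).Sat M e ↔ t.eval M e = u.eval M e := Iff.rfl

theorem sat_rel (r : L.Rl) (ts : ∀ s : S, Var (L.rdom r) s → Term L Γ s) (e : Asg M.C Γ) :
    (rel r ts).Sat M e ↔ M.rl r (fun s v => (ts s v).eval M e) := Iff.rfl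

@[simp] theorem sat_imp (φ ψ : Formula L Γ) (e : Asg M.C Γ) :
    (imp φ ψ).Sat M e ↔ (φ.Sat M e → ψ.Sat M e) := Iff.rfl

@[simp] theorem sat_all {s : S} (φ : Formula L (s :: Γ)) (e : Asg M.C Γ) :
    (all s φ).Sat M e ↔ ∀ a : M.C s, φ.Sat M (Asg.cons a e) := Iff.rfl

@[simp] theorem sat_neg (φ : Formula L Γ) (e : Asg M.C Γ) : φ.neg.Sat M e ↔ ¬ φ.Sat M e := Iff.rfl

@[simp] theorem sat_and (φ ψ : Formula L Γ) (e : Asg M.C Γ) :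
    (φ.and ψ).Sat M e ↔ φ.Sat M e ∧ ψ.Sat M e := by
  simp [and]

@[simp] theorem sat_or (φ ψ : Formula L Γ) (e : Asg M.C Γ) :
    (φ.or ψ).Sat M e ↔ φ.Sat M e ∨ ψ.Sat M e := by
  simp [or, or_iff_not_imp_left]

@[simp] theorem sat_iff (φ ψ : Formula L Γ) (e : Asg M.C Γ) :
    (φ.iff ψ).Sat M e ↔ (φ.Sat M e ↔ ψ.Sat M e) := by
  simp [Formula.iff, iff_iff_implies_and_implies]

@[simp] theorem sat_ex {s : S} (φ : Formula L (s :: Γ)) (e : Asg M.C Γ) :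
    (ex s φ).Sat M e ↔ ∃ a : M.C s, φ.Sat M (Asg.cons a e) := by
  simp [ex]

theorem sat_subst (φ : Formula L Γ) {Δ : List S} (σ : Sub L Γ Δ) (e : Asg M.C Δ) :
    (φ.subst σ).Sat M e ↔ φ.Sat M (fun _ v => (σ _ v).eval M e) := by
  induction φ generalizing Δ with
  | falsum => rfl
  | eq t u => simp only [subst, Sat, Term.eval_subst]
  | rel r ts => simp only [subst, Sat, Term.eval_subst]
  | imp φ ψ ih₁ ih₂ => simp only [subst, Sat, ih₁, ih₂]
  | all s φ ih =>
    simp only [subst, Sat, ih]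
    refine forall_congr' fun a => ?_
    have : (fun _ v => (σ.lift s _ v).eval M (Asg.cons a e)) =
        Asg.cons a (fun _ v => (σ _ v).eval M e) := by
      funext t v
      cases v with
      | zero => rfl
      | succ v => exact Term.eval_rename_weak ..
    rw [this]

theorem sat_rename (φ : Formula L Γ) (ρ : Ren Γ Δ) (e : Asg M.C Δ) :
    (φ.rename ρ).Sat M e ↔ φ.Sat M (fun _ v => e _ (ρ _ v)) := by
  rw [rename_eq_subst, sat_subst]; rfl

theorem sat_inst {s : S} (φ : Formula L (s :: Γ)) (t : Term L Γ s) (e : Asg M.C Γ) :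
    (φ.inst t).Sat M e ↔ φ.Sat M (Asg.cons (t.eval M e) e) := by
  rw [inst, sat_subst]
  have : (fun _ v => (Sub.cons t (fun _ v => .var v) _ v).eval M e) =
      Asg.cons (t.eval M e) e := by
    funext t v; cases v <;> rfl
  rw [this]

theorem sat_close (Γ : List S) (φ : Formula L Γ) :
    (close Γ φ).Sat M Asg.nil ↔ ∀ e, φ.Sat M e := by
  induction Γ with
  | nil => exact ⟨fun h e => Asg.nil_eq e _ ▸ h, fun h => h _⟩
  | cons s Γ ih =>
    rw [close, ih]
    exact ⟨fun h e => Asg.cons_eta e ▸ h _ _, fun h e a => h _⟩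

theorem sat_allBlock (Δ : List S) (φ : Formula L (Δ ++ Γ)) (e : Asg M.C Γ) :
    (allBlock Δ φ).Sat M e ↔ ∀ d : Asg M.C Δ, φ.Sat M (Asg.append d e) := by
  induction Δ with
  | nil => exact ⟨fun h _ => h, fun h => h Asg.nil⟩
  | cons s Δ ih =>
    rw [allBlock, ih]
    exact ⟨fun h d => h _ _, fun h d a => h (Asg.cons a d)⟩

end Formula

/-- Soundness of natural deduction. -/
theorem Prf.sound {T : Theory L} (hM : Models M T) {H : List (Formula L Γ)} {φ : Formula L Γ}
    (h : Prf T Γ H φ) (e : Asg M.C Γ) (hH : ∀ ψ ∈ H, ψ.Sat M e) : φ.Sat M e := by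
  induction h with
  | axm hσ =>
    rw [Formula.sat_rename, Asg.nil_eq (fun _ v => e _ (Ren.nil _ v)) Asg.nil]
    exact hM _ hσ
  | hyp h => exact hH _ h
  | impI _ ih => exact fun h => ih e (by simpa using ⟨h, hH⟩)
  | impE _ _ ih₁ ih₂ => exact ih₁ e hH (ih₂ e hH)
  | raa _ ih =>
    by_contra hn
    exact ih e (by simpa using ⟨hn, hH⟩)
  | allI _ ih =>
    intro a
    refine ih _ fun ψ hψ => ?_
    obtain ⟨χ, hχ, rfl⟩ := List.mem_map.1 hψ
    rw [Formula.sat_rename]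
    exact hH _ hχ
  | allE t _ ih => exact (Formula.sat_inst ..).2 (ih e hH _)
  | nonempty s =>
    obtain ⟨a⟩ := M.ne s
    exact (Formula.sat_ex ..).2 ⟨a, rfl⟩
  | eqRefl t => rfl
  | eqSubst φ _ _ ih₁ ih₂ =>
    have h₁ := ih₁ e hH
    have h₂ := ih₂ e hH
    rw [Formula.sat_inst] at h₂ ⊢
    rw [Formula.sat_eq] at h₁
    rwa [← h₁]

end Semantics

/-! ### Structural properties of derivability -/

namespace Prf

variable {L : Signature S} {T : Theory L} {Γ Δ : List S} {H H' : List (Formula L Γ)}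

theorem weaken {φ : Formula L Γ} (h : Prf T Γ H φ) (hH : H ⊆ H') : Prf T Γ H' φ := by
  induction h with
  | axm hσ => exact .axm hσ
  | hyp h => exact .hyp (hH h)
  | impI _ ih => exact .impI (ih (List.cons_subset_cons _ hH))
  | impE _ _ ih₁ ih₂ => exact .impE (ih₁ hH) (ih₂ hH)
  | raa _ ih => exact .raa (ih (List.cons_subset_cons _ hH))
  | allI _ ih => exact .allI (ih (List.map_subset _ hH))
  | allE t _ ih => exact .allE t (ih hH)
  | nonempty s => exact .nonempty s
  | eqRefl t => exact .eqRefl t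
  | eqSubst φ _ _ ih₁ ih₂ => exact .eqSubst φ (ih₁ hH) (ih₂ hH)

theorem rename {φ : Formula L Γ} (h : Prf T Γ H φ) {Δ : List S} (ρ : Ren Γ Δ) :
    Prf T Δ (H.map (Formula.rename ρ)) (φ.rename ρ) := by
  induction h generalizing Δ with
  | axm hσ =>
    rw [Formula.rename_rename, Ren.nil_eq (fun _ v => ρ _ (Ren.nil _ v)) Ren.nil]
    exact .axm hσ
  | hyp h => exact .hyp (List.mem_map_of_mem h)
  | impI _ ih => exact .impI (ih ρ)
  | impE _ _ ih₁ ih₂ => exact .impE (ih₁ ρ) (ih₂ ρ)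
  | raa _ ih => exact .raa (ih ρ)
  | @allI Γ H s φ _ ih =>
    refine .allI ?_
    have := ih (ρ.lift s)
    rw [List.map_map] at this ⊢
    convert this using 2
    funext ψ
    simp only [Function.comp, Formula.rename_rename]
    rfl
  | allE t _ ih =>
    rw [Formula.rename_inst]
    exact .allE _ (ih ρ)
  | nonempty s => exact .nonempty s
  | eqRefl t => exact .eqRefl _
  | eqSubst φ _ _ ih₁ ih₂ =>
    have h := ih₂ ρ
    rw [Formula.rename_inst] at h ⊢
    exact .eqSubst _ (ih₁ ρ) h

theorem exfalso {φ : Formula L Γ} (h : Prf T Γ H .falsum) : Prf T Γ H φ :=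
  .raa (h.weaken (List.subset_cons_self _ _))

theorem eqSymm {s : S} {t u : Term L Γ s} (h : Prf T Γ H (.eq t u)) : Prf T Γ H (.eq u t) := by
  have := Prf.eqSubst (.eq (.var .zero) (t.rename (Ren.weak s))) h (by
    simpa only [Formula.inst, Formula.subst, Term.subst_rename, Term.subst, Sub.cons, Ren.weak,
      Term.subst_var] using Prf.eqRefl t)
  simpa only [Formula.inst, Formula.subst, Term.subst_rename, Term.subst, Sub.cons, Ren.weak,
      Term.subst_var] using this

theorem eqTrans {s : S} {t u w : Term L Γ s} (h : Prf T Γ H (.eq t u))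
    (h' : Prf T Γ H (.eq u w)) : Prf T Γ H (.eq t w) := by
  have := Prf.eqSubst (.eq (t.rename (Ren.weak s)) (.var .zero)) h' (by
    simpa only [Formula.inst, Formula.subst, Term.subst_rename, Term.subst, Sub.cons, Ren.weak,
      Term.subst_var] using h)
  simpa only [Formula.inst, Formula.subst, Term.subst_rename, Term.subst, Sub.cons, Ren.weak,
      Term.subst_var] using this

/-- Replacing equals by equals for a block of variables. -/
theorem eqSubstBlock (φ : Formula L (Δ ++ Γ)) (σ τ : Sub L Δ Γ)
    (h : ∀ s v, Prf T Γ H (.eq (σ s v) (τ s v)))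
    (hφ : Prf T Γ H (φ.subst (Asg.append σ fun _ v => .var v))) :
    Prf T Γ H (φ.subst (Asg.append τ fun _ v => .var v)) := by
  induction Δ with
  | nil => exact hφ
  | cons s Δ ih =>
    -- Leibniz's law exchanges the first entry while the others keep their old values. The induction
    -- hypothesis then exchanges the others, with the new first entry already substituted into φ.
    have h₁ : Prf T Γ H (φ.subst (Asg.append
        (Asg.cons (C := Term L Γ) (τ _ .zero) (fun _ v => σ _ v.succ)) fun _ v => .var v)) := by
      have := Prf.eqSubst (φ.subst (Sub.lift (Asg.append (fun _ v => σ _ v.succ)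
        fun _ v => .var v) s)) (h s .zero)
      rw [Formula.inst_subst_lift, Formula.inst_subst_lift] at this
      exact this hφ
    have e : ∀ υ : Sub L Δ Γ, Sub.cons (τ s .zero) (Asg.append υ fun _ v => .var v) =
        fun r v => (Asg.cons (C := Term L ((Δ ++ Γ))) ((τ s .zero).rename (Ren.weakBlock Δ))
          (fun _ v => .var v) r v).subst (Asg.append υ fun _ v => .var v) := by
      intro υ
      funext r v
      cases v with
      | zero =>
        simp only [Sub.cons, Asg.cons, Term.subst_rename, Asg.append_weakBlock, Term.subst_var]
      | succ v => rfl
    have := ih (φ.subst (Asg.cons (C := Term L ((Δ ++ Γ))) ((τ s .zero).rename (Ren.weakBlock Δ))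
      (fun _ v => .var v))) (fun _ v => σ _ v.succ) (fun _ v => τ _ v.succ) (fun _ _ => h _ _)
    rw [Formula.subst_subst, Formula.subst_subst, ← e, ← e] at this
    exact this h₁

/-- Replacing equals by equals for all free variables simultaneously. -/
theorem eqSubstAll (φ : Formula L Δ) (σ τ : Sub L Δ Γ)
    (h : ∀ s v, Prf T Γ H (.eq (σ s v) (τ s v))) (hφ : Prf T Γ H (φ.subst σ)) :
    Prf T Γ H (φ.subst τ) := by
  have := eqSubstBlock (φ.rename (Ren.inBlock Δ)) σ τ h
  simp only [Formula.subst_rename, Asg.append_inBlock] at this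
  exact this hφ

/-- Replacement is applied to the equation f(σ) = f(y) with y a block of variables: at σ it is
reflexivity, at τ it is the claim. -/
theorem funcCongr (f : L.Fn) (σ τ : Sub L (L.fdom f) Γ)
    (h : ∀ s v, Prf T Γ H (.eq (σ s v) (τ s v))) :
    Prf T Γ H (.eq (.func f σ) (.func f τ)) := by
  have := eqSubstBlock (.eq ((Term.func f σ).rename (Ren.weakBlock (L.fdom f)))
    (.func f fun _ v => .var (Ren.inBlock (L.fdom f) _ v))) σ τ h
  simp only [Formula.subst, Term.subst, Term.rename, Term.subst_rename, Asg.append_inBlock,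
    Asg.append_weakBlock, Term.subst_var] at this
  exact this (.eqRefl _)

end Prf

/-! ### Completeness -/

namespace Henkin

variable {L : Signature S} (T : Theory L)

/-- `H` is consistent with `T`. -/
def Con {Γ : List S} (H : List (Formula L Γ)) : Prop := ¬ Prf T Γ H .falsum

variable {T}

/-- This is where non-emptiness of the sorts enters: a contradiction derived with a spare variable
of sort s refutes ∃ x, x = x. -/
theorem Con.weak {Γ : List S} {H : List (Formula L Γ)} (h : Con T H) (s : S) :
    Con T (H.map (Formula.rename (Ren.weak s))) := by
  intro h'
  refine h (.impE (.nonempty s) (.allI ?_))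
  exact .impI (h'.weaken (List.subset_cons_self _ _))

theorem Con.neg {Γ : List S} {H : List (Formula L Γ)} {φ : Formula L Γ} (h : Con T H)
    (hφ : ¬ Con T (φ :: H)) : Con T (φ.neg :: H) := fun h' =>
  h (.impE (.impI h') (.impI (not_not.1 hφ)))

/-- If a fresh variable could not be a counterexample, φ would be derivable for it, and
generalization would contradict the assumption ¬∀φ. -/
theorem Con.witness {Γ : List S} {H : List (Formula L Γ)} {s : S} {φ : Formula L (s :: Γ)}
    (h : Con T ((Formula.all s φ).neg :: H)) :
    Con T (φ.neg :: ((Formula.all s φ).neg :: H).map (Formula.rename (Ren.weak s))) := by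
  intro h'
  exact h (.impE (.hyp List.mem_cons_self) (.allI (.raa h')))

variable (T)

/-- Decide `θ` and, if it is a negated universal formula, let the new variable be a witness. -/
noncomputable def step {Γ : List S} (s : S) (θ : Formula L Γ) (H : List (Formula L Γ)) :
    List (Formula L (s :: Γ)) :=
  open Classical in
  if Con T (θ :: H) then
    if h : ∃ φ : Formula L (s :: Γ), θ = (Formula.all s φ).neg then
      h.choose.neg :: (θ :: H).map (Formula.rename (Ren.weak s))
    else (θ :: H).map (Formula.rename (Ren.weak s))
  else (θ.neg :: H).map (Formula.rename (Ren.weak s))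

variable {T}

theorem Con.step {Γ : List S} (s : S) (θ : Formula L Γ) {H : List (Formula L Γ)} (h : Con T H) :
    Con T (step T s θ H) := by
  unfold Henkin.step
  split_ifs with h₁ h₂
  · obtain ⟨e⟩ : Nonempty (θ = (Formula.all s h₂.choose).neg) := ⟨h₂.choose_spec⟩
    generalize h₂.choose = φ at e
    subst e
    exact h₁.witness
  · exact h₁.weak s
  · exact (h.neg h₁).weak s

theorem step_mem {Γ : List S} (s : S) (θ : Formula L Γ) {H : List (Formula L Γ)}
    {φ : Formula L Γ} (h : φ ∈ H) : φ.rename (Ren.weak s) ∈ step T s θ H := by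
  unfold step
  split_ifs <;> simp only [List.map_cons, List.mem_cons, List.mem_map_of_mem h, or_true]

theorem step_decides {Γ : List S} (s : S) (θ : Formula L Γ) (H : List (Formula L Γ)) :
    θ.rename (Ren.weak s) ∈ step T s θ H ∨ θ.neg.rename (Ren.weak s) ∈ step T s θ H := by
  unfold step
  split_ifs <;> simp

theorem step_witness {Γ : List S} (s : S) (φ : Formula L (s :: Γ)) (H : List (Formula L Γ)) :
    (Formula.all s φ).neg.neg.rename (Ren.weak s) ∈ step T s (Formula.all s φ).neg H ∨
      φ.neg ∈ step T s (Formula.all s φ).neg H := by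
  unfold step
  split_ifs with h₁ h₂
  · have := h₂.choose_spec
    generalize h₂.choose = ψ at this ⊢
    simp only [Formula.neg, Formula.imp.injEq, Formula.all.injEq, heq_eq_eq, true_and,
      and_true] at this
    right
    subst this
    exact List.mem_cons_self
  · exact absurd ⟨φ, rfl⟩ h₂
  · left; exact List.mem_cons_self

/-! ### The chain of consistent finite sets and the theory in the limit -/

section Chain

variable (srt : ℕ → S)

/-- The variables introduced at the first `n` stages. -/
def ctx : ℕ → List S
  | 0 => []
  | n + 1 => srt n :: ctx n

/-- The inclusion of the variables of an earlier stage. -/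
def up {n m : ℕ} (h : n ≤ m) : Ren (ctx srt n) (ctx srt m) :=
  Nat.leRec (motive := fun m _ => Ren (ctx srt n) (ctx srt m)) (fun _ v => v)
    (fun _ _ ρ _ v => (ρ _ v).succ) h

variable {srt}

theorem up_refl (n : ℕ) : up srt (le_refl n) = fun _ v => v := Nat.leRec_self ..

theorem up_succ {n m : ℕ} (h : n ≤ m) :
    up srt (Nat.le_succ_of_le h) = fun _ v => (up srt h _ v).succ := Nat.leRec_succ ..

theorem up_up {n m k : ℕ} (h : n ≤ m) (h' : m ≤ k) :
    (fun _ v => up srt h' _ (up srt h _ v)) = up srt (h.trans h') := by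
  induction k, h' using Nat.le_induction with
  | base => rw [up_refl]
  | succ k h' ih => rw [up_succ, up_succ (h.trans h'), ← ih]

theorem up_weak (n : ℕ) : up srt (Nat.le_succ n) = Ren.weak (srt n) := by
  rw [up_succ (le_refl n), up_refl]; rfl

theorem rename_up {n m k : ℕ} (h : n ≤ m) (h' : m ≤ k) (φ : Formula L (ctx srt n)) :
    (φ.rename (up srt h)).rename (up srt h') = φ.rename (up srt (h.trans h')) := by
  rw [Formula.rename_rename, up_up]

theorem Term.rename_up {n m k : ℕ} (h : n ≤ m) (h' : m ≤ k) {s : S} (t : Term L (ctx srt n) s) :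
    (t.rename (up srt h)).rename (up srt h') = t.rename (up srt (h.trans h')) := by
  rw [Term.rename_rename, up_up]

variable (T) (en : ∀ n, ℕ → Formula L (ctx srt n)) (σ : Sentence L)

/-- The formula that is decided at stage `n`. -/
noncomputable def task (n : ℕ) : Formula L (ctx srt n) :=
  -- The first component of n codes a stage and the number of a formula of that stage; the second
  -- component is left free for the sort of the new variable. Unpairing never increases a number, so
  -- the `falsum` branch is never taken.
  if h : n.unpair.1.unpair.1 ≤ n then (en _ n.unpair.1.unpair.2).rename (up srt h) else .falsum

/-- A growing sequence of finite sets of formulas, the first one being `{σ}`. -/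
noncomputable def chain : ∀ n, List (Formula L (ctx srt n))
  | 0 => [σ]
  | n + 1 => step T (srt n) (task en n) (chain n)

/-- `φ` is derivable from some member of the sequence. -/
def Thm (n : ℕ) (φ : Formula L (ctx srt n)) : Prop :=
  ∃ m, ∃ h : n ≤ m, Prf T (ctx srt m) (chain T en σ m) (φ.rename (up srt h))

variable {T en σ}

theorem chain_con (hσ : Con T [σ]) (n : ℕ) : Con T (chain T en σ n) := by
  induction n with
  | zero => exact hσ
  | succ n ih => exact ih.step _ _

theorem chain_mono {n m : ℕ} (h : n ≤ m) {φ : Formula L (ctx srt n)} (hφ : φ ∈ chain T en σ n) :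
    φ.rename (up srt h) ∈ chain T en σ m := by
  induction m, h using Nat.le_induction with
  | base => rwa [up_refl, Formula.rename_id]
  | succ m h ih =>
    rw [← rename_up h (Nat.le_succ m), up_weak]
    exact step_mem _ _ ih

theorem prf_up {n m : ℕ} (h : n ≤ m) {φ : Formula L (ctx srt n)}
    (hφ : Prf T _ (chain T en σ n) φ) : Prf T _ (chain T en σ m) (φ.rename (up srt h)) := by
  refine (hφ.rename (up srt h)).weaken fun ψ hψ => ?_
  obtain ⟨χ, hχ, rfl⟩ := List.mem_map.1 hψ
  exact chain_mono h hχ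

theorem Thm.of_prf {n : ℕ} {φ : Formula L (ctx srt n)} (h : Prf T _ [] φ) : Thm T en σ n φ :=
  ⟨n, le_rfl, by rw [up_refl, Formula.rename_id]; exact h.weaken (List.nil_subset _)⟩

theorem Thm.of_mem {n : ℕ} {φ : Formula L (ctx srt n)} (h : φ ∈ chain T en σ n) :
    Thm T en σ n φ :=
  ⟨n, le_rfl, by rw [up_refl, Formula.rename_id]; exact .hyp h⟩

theorem Thm.of_mem_succ {n : ℕ} {φ : Formula L (ctx srt n)}
    (h : φ.rename (Ren.weak (srt n)) ∈ chain T en σ (n + 1)) : Thm T en σ n φ :=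
  ⟨n + 1, Nat.le_succ n, .hyp (by rwa [up_weak])⟩

/-- Derivability persists along the chain, which lets several theorems be brought to a common stage.
-/
theorem Thm.at {n : ℕ} {φ : Formula L (ctx srt n)} (h : Thm T en σ n φ) :
    ∃ m, ∃ _ : n ≤ m, ∀ k, ∀ hk : n ≤ k, m ≤ k →
      Prf T _ (chain T en σ k) (φ.rename (up srt hk)) := by
  obtain ⟨m, hm, h⟩ := h
  refine ⟨m, hm, fun k hk hmk => ?_⟩
  rw [← rename_up hm hmk]
  exact prf_up hmk h

theorem thm_up {n m : ℕ} (h : n ≤ m) {φ : Formula L (ctx srt n)} :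
    Thm T en σ m (φ.rename (up srt h)) ↔ Thm T en σ n φ := by
  constructor
  · rintro ⟨k, hk, h'⟩
    rw [rename_up] at h'
    exact ⟨k, _, h'⟩
  · intro h'
    obtain ⟨k, hk, h'⟩ := h'.at
    refine ⟨max m k, le_max_left _ _, ?_⟩
    rw [rename_up]
    exact h' _ _ (le_max_right _ _)

theorem Thm.mp {n : ℕ} {φ ψ : Formula L (ctx srt n)} (h : Thm T en σ n (.imp φ ψ))
    (h' : Thm T en σ n φ) : Thm T en σ n ψ := by
  obtain ⟨k, hk, h⟩ := h.at
  obtain ⟨l, hl, h'⟩ := h'.at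
  have hn : n ≤ max k l := hk.trans (le_max_left _ _)
  exact ⟨max k l, hn, .impE (h _ hn (le_max_left _ _)) (h' _ hn (le_max_right _ _))⟩

theorem Thm.derive {n : ℕ} {G : List (Formula L (ctx srt n))} {ψ : Formula L (ctx srt n)}
    (h : Prf T _ G ψ) (hG : ∀ φ ∈ G, Thm T en σ n φ) : Thm T en σ n ψ := by
  induction G generalizing ψ with
  | nil => exact .of_prf h
  | cons φ G ih =>
    simp only [List.mem_cons, forall_eq_or_imp] at hG
    exact (ih (.impI h) hG.2).mp hG.1

theorem thm_falsum (hσ : Con T [σ]) (n : ℕ) : ¬ Thm T en σ n .falsum := by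
  rintro ⟨m, _, h⟩
  exact chain_con hσ m h

/-- Every formula gets its turn, together with a new variable of any prescribed sort. The stage
found is not earlier than n because pairing dominates its components. -/
theorem exists_task (hen : ∀ n, (en n).Surjective)
    (hsrt : ∀ p s, ∃ m, (Nat.unpair m).1 = p ∧ srt m = s) (n : ℕ) (θ : Formula L (ctx srt n))
    (s : S) : ∃ m, ∃ h : n ≤ m, srt m = s ∧ task en m = θ.rename (up srt h) := by
  obtain ⟨j, rfl⟩ := hen n θ
  obtain ⟨m, hm, hs⟩ := hsrt (Nat.pair n j) s
  have h : n ≤ m := by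
    have h₁ := Nat.unpair_left_le m
    have h₂ := Nat.left_le_pair n j
    omega
  refine ⟨m, h, hs, ?_⟩
  -- The type of the enumerated formula depends on the decoded stage, so the decoded numbers are
  -- generalized before being identified with n and j.
  have key : ∀ a b, a = n → b = j →
      (if h : a ≤ m then (en a b).rename (up srt h) else .falsum) =
        (en n j).rename (up srt h) := by
    rintro a b rfl rfl
    rw [dif_pos h]
  exact key _ _ (by rw [hm, Nat.unpair_pair]) (by rw [hm, Nat.unpair_pair])

/-! ### Truth conditions for the connectives and quantifiers in the limit -/

section Complete

variable (hσ : Con T [σ]) (hen : ∀ n, (en n).Surjective)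
  (hsrt : ∀ p s, ∃ m, (Nat.unpair m).1 = p ∧ srt m = s)

include hσ hen hsrt

/-- Consistency of all stages gives one direction. For the other, φ or its negation is put into the
chain when φ is the task; the sort of the variable added there is immaterial. -/
theorem thm_neg {n : ℕ} {φ : Formula L (ctx srt n)} :
    Thm T en σ n φ.neg ↔ ¬ Thm T en σ n φ := by
  constructor
  · intro h h'
    exact thm_falsum hσ n (h.mp h')
  · intro h
    obtain ⟨m, hm, -, he⟩ := exists_task hen hsrt n φ (srt 0)
    rcases step_decides (T := T) (srt m) (task en m) (chain T en σ m) with h' | h'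
    · refine absurd ?_ h
      have := Thm.of_mem_succ h'
      rwa [he, thm_up] at this
    · have := Thm.of_mem_succ h'
      rw [he] at this
      exact (thm_up hm).1 this

theorem thm_imp {n : ℕ} {φ ψ : Formula L (ctx srt n)} :
    Thm T en σ n (.imp φ ψ) ↔ (Thm T en σ n φ → Thm T en σ n ψ) := by
  refine ⟨fun h h' => h.mp h', fun h => ?_⟩
  by_cases hφ : Thm T en σ n φ
  · exact Thm.derive (G := [ψ]) (.impI (.hyp (by simp))) (by simpa using h hφ)
  · rw [← thm_neg hσ hen hsrt] at hφ
    refine Thm.derive (G := [φ.neg]) (.impI (Prf.exfalso ?_)) (by simpa using hφ)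
    exact .impE (.hyp (φ := φ.neg) (by simp)) (.hyp (by simp))

/-- If the universal formula fails, its negation is decided at a stage whose new variable has sort
s, and that variable is a counterexample. Terms of later stages must be admitted on the right
because this variable appears only there. -/
theorem thm_all {n : ℕ} {s : S} {φ : Formula L (s :: ctx srt n)} :
    Thm T en σ n (.all s φ) ↔ ∀ m, ∀ h : n ≤ m, ∀ t : Term L (ctx srt m) s,
      Thm T en σ m (φ.subst (Sub.cons t (Sub.ofRen (up srt h)))) := by
  constructor
  · intro hφ m h t
    rw [← thm_up h] at hφ
    rw [← Formula.inst_rename_lift]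
    exact Thm.derive (G := [_]) (.allE t (.hyp List.mem_cons_self)) (fun _ h =>
      List.mem_singleton.1 h ▸ hφ)
  · intro hφ
    by_contra hn
    rw [← thm_neg hσ hen hsrt] at hn
    obtain ⟨m, hm, hs, he⟩ := exists_task hen hsrt n (Formula.all s φ).neg s
    subst hs
    have h' := hφ (m + 1) (Nat.le_succ_of_le hm) (.var .zero)
    have hmem := step_witness (T := T) (srt m) (φ.rename (Ren.lift (up srt hm) (srt m)))
      (chain T en σ m)
    have he' : task en m = (Formula.all _ (φ.rename (Ren.lift (up srt hm) (srt m)))).neg := he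
    rw [← he'] at hmem
    rcases hmem with hmem | hmem
    · have := Thm.of_mem_succ hmem
      rw [he'] at this
      exact (thm_neg hσ hen hsrt).1 this ((thm_up hm).2 hn)
    · have := Thm.of_mem (n := m + 1) hmem
      refine (thm_neg hσ hen hsrt).1 this ?_
      rw [Formula.rename_eq_subst]
      have e : Sub.cons (L := L) (.var .zero) (Sub.ofRen (up srt (Nat.le_succ_of_le hm))) =
          Sub.ofRen ((up srt hm).lift (srt m)) := by
        funext r v
        cases v with
        | zero => rfl
        | succ v =>
          have := congrFun₂ (up_succ hm) r v
          exact congrArg Term.var this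
      exact e ▸ h'

end Complete

/-! ### The term model -/

variable (T en σ)

/-- Equality of terms of various stages. -/
def termSetoid (s : S) : Setoid (Σ n, Term L (ctx srt n) s) where
  r a b := ∃ m, ∃ h : a.1 ≤ m, ∃ h' : b.1 ≤ m,
    Thm T en σ m (.eq (a.2.rename (up srt h)) (b.2.rename (up srt h')))
  iseqv := by
    refine ⟨fun a => ⟨a.1, le_rfl, le_rfl, .of_prf (.eqRefl _)⟩, ?_, ?_⟩
    · rintro a b ⟨m, h, h', hm⟩
      exact ⟨m, h', h, Thm.derive (G := [_]) (Prf.eqSymm (.hyp List.mem_cons_self)) (by simpa using hm)⟩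
    · rintro a b c ⟨m, h, h', hm⟩ ⟨k, g, g', hk⟩
      refine ⟨max m k, h.trans (le_max_left _ _), g'.trans (le_max_right _ _), ?_⟩
      rw [← thm_up (le_max_left m k)] at hm
      rw [← thm_up (le_max_right m k)] at hk
      simp only [Formula.rename, Term.rename_up] at hm hk
      exact Thm.derive (G := [_, _]) (Prf.eqTrans (.hyp List.mem_cons_self)
        (.hyp (List.mem_cons_of_mem _ List.mem_cons_self))) (by simpa using ⟨hm, hk⟩)

/-- The carriers of the term model. -/
abbrev Car (s : S) : Type := Quotient (termSetoid T en σ s)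

variable {T en σ}

/-- The element denoted by a term. -/
def val (n : ℕ) {s : S} (t : Term L (ctx srt n) s) : Car T en σ s := Quotient.mk _ ⟨n, t⟩

theorem val_eq {n : ℕ} {s : S} {t u : Term L (ctx srt n) s} :
    (val n t : Car T en σ s) = val n u ↔ Thm T en σ n (.eq t u) := by
  refine ⟨fun h => ?_, fun h => Quotient.sound ⟨n, le_rfl, le_rfl, ?_⟩⟩
  · obtain ⟨m, h, h', hm⟩ := Quotient.exact h
    exact (thm_up h).1 hm
  · exact (thm_up le_rfl).2 h

theorem val_up {n m : ℕ} (h : n ≤ m) {s : S} (t : Term L (ctx srt n) s) :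
    (val m (t.rename (up srt h)) : Car T en σ s) = val n t := by
  refine Quotient.sound ⟨m, le_rfl, h, ?_⟩
  simp only [up_refl, Term.rename_id]
  exact .of_prf (.eqRefl _)

/-- The assignment given by a substitution. -/
def asg (n : ℕ) {Δ : List S} (τ : Sub L Δ (ctx srt n)) : Asg (Car T en σ) Δ :=
  fun _ v => val n (τ _ v)

theorem asg_up {n m : ℕ} (h : n ≤ m) {Δ : List S} (τ : Sub L Δ (ctx srt n)) :
    (asg m (fun _ v => (τ _ v).rename (up srt h)) : Asg (Car T en σ) Δ) = asg n τ := by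
  funext s v
  exact val_up h _

/-- A context is finite, so representatives of all the entries can be moved to one stage. -/
theorem exists_asg {Δ : List S} (e : Asg (Car T en σ) Δ) :
    ∃ n, ∃ τ : Sub L Δ (ctx srt n), e = asg n τ := by
  induction Δ with
  | nil => exact ⟨0, Sub.nil, Asg.nil_eq _ _⟩
  | cons s Δ ih =>
    obtain ⟨n, τ, hτ⟩ := ih (fun _ v => e _ v.succ)
    obtain ⟨⟨m, t⟩, ht⟩ := Quotient.exists_rep (e _ .zero)
    refine ⟨max n m, Sub.cons (t.rename (up srt (le_max_right n m)))
      (fun _ v => (τ _ v).rename (up srt (le_max_left n m))), ?_⟩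
    funext r v
    cases v with
    | zero => exact ht.symm.trans (val_up _ _).symm
    | succ v => exact (congrFun₂ hτ _ v).trans (val_up _ _).symm

/-- Equality of two assignments amounts to finitely many provable equations, which can be collected
in a list of open assumptions as `Thm.derive` requires. -/
theorem exists_derive_eq {k : ℕ} {Δ : List S} {τ υ : Sub L Δ (ctx srt k)}
    (h : (asg k τ : Asg (Car T en σ) Δ) = asg k υ) :
    ∃ G : List (Formula L (ctx srt k)), (∀ φ ∈ G, Thm T en σ k φ) ∧
      ∀ s v, Prf T _ G (.eq (τ s v) (υ s v)) := by
  have h₁ : ∀ s v, Thm T en σ k (.eq (τ s v) (υ s v)) := fun s v => val_eq.1 (congrFun₂ h s v)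
  clear h
  induction Δ with
  | nil => exact ⟨[], by simp, fun s v => nomatch v⟩
  | cons r Δ ih =>
    obtain ⟨G, hG, h⟩ := ih (τ := fun _ v => τ _ v.succ) (υ := fun _ v => υ _ v.succ)
      (fun _ _ => h₁ _ _)
    refine ⟨.eq (τ _ .zero) (υ _ .zero) :: G, by simpa using ⟨h₁ _ _, hG⟩, fun s v => ?_⟩
    cases v with
    | zero => exact .hyp List.mem_cons_self
    | succ v => exact (h _ v).weaken (List.subset_cons_self _ _)

theorem asg_thm {n m : ℕ} {Δ : List S} {τ : Sub L Δ (ctx srt n)} {υ : Sub L Δ (ctx srt m)}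
    (h : (asg n τ : Asg (Car T en σ) Δ) = asg m υ) (φ : Formula L Δ)
    (hφ : Thm T en σ n (φ.subst τ)) : Thm T en σ m (φ.subst υ) := by
  have hn : n ≤ max n m := le_max_left _ _
  have hm : m ≤ max n m := le_max_right _ _
  rw [← asg_up hn, ← asg_up hm] at h
  rw [← thm_up hn, Formula.rename_subst] at hφ
  rw [← thm_up hm, Formula.rename_subst]
  obtain ⟨G, hG, h₂⟩ := exists_derive_eq h
  refine Thm.derive (G := φ.subst _ :: G) ?_ (by simpa using ⟨hφ, hG⟩)
  exact Prf.eqSubstAll φ _ _ (fun s v => (h₂ s v).weaken (List.subset_cons_self _ _))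
    (.hyp List.mem_cons_self)

/-- Shows that the representatives chosen in `model` do not affect the values of the functions. -/
theorem val_func {n m : ℕ} (f : L.Fn) {τ : Sub L (L.fdom f) (ctx srt n)}
    {υ : Sub L (L.fdom f) (ctx srt m)} (h : (asg n τ : Asg (Car T en σ) _) = asg m υ) :
    (val n (.func f τ) : Car T en σ _) = val m (.func f υ) := by
  have hn : n ≤ max n m := le_max_left _ _
  have hm : m ≤ max n m := le_max_right _ _
  rw [← asg_up hn, ← asg_up hm] at h
  rw [← val_up hm, ← val_up hn (Term.func f τ), val_eq]
  obtain ⟨G, hG, h₂⟩ := exists_derive_eq h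
  exact Thm.derive (Prf.funcCongr f _ _ h₂) hG

variable (T en σ)

/-- The term model. -/
noncomputable abbrev model (hne : ∀ s, ∃ n, srt n = s) : Struc L where
  C := Car T en σ
  ne s := by
    obtain ⟨n, rfl⟩ := hne s
    exact ⟨val (n + 1) (.var .zero)⟩
  fn f e := val (exists_asg e).choose (.func f (exists_asg e).choose_spec.choose)
  rl r e := ∃ n, ∃ τ : Sub L (L.rdom r) (ctx srt n), e = asg n τ ∧ Thm T en σ n (.rel r τ)

variable {T en σ}

theorem model_fn (hne : ∀ s, ∃ n, srt n = s) (f : L.Fn) {n : ℕ}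
    (τ : Sub L (L.fdom f) (ctx srt n)) :
    (model T en σ hne).fn f (asg n τ) = val n (.func f τ) :=
  val_func f (exists_asg (asg n τ : Asg (Car T en σ) _)).choose_spec.choose_spec.symm

theorem model_rl (hne : ∀ s, ∃ n, srt n = s) (r : L.Rl) {n : ℕ}
    (τ : Sub L (L.rdom r) (ctx srt n)) :
    (model T en σ hne).rl r (asg n τ) ↔ Thm T en σ n (.rel r τ) := by
  refine ⟨?_, fun h => ⟨n, τ, rfl, h⟩⟩
  rintro ⟨m, υ, h, hr⟩
  exact asg_thm h.symm (.rel r fun _ v => .var v) hr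

theorem model_eval (hne : ∀ s, ∃ n, srt n = s) {Δ : List S} {s : S} (t : Term L Δ s) {n : ℕ}
    (τ : Sub L Δ (ctx srt n)) :
    t.eval (model T en σ hne) (asg n τ) = val n (t.subst τ) := by
  induction t with
  | var v => rfl
  | func f ts ih =>
    exact (congrArg ((model T en σ hne).fn f) (funext₂ fun s v => ih s v)).trans
      (model_fn hne f fun s v => (ts s v).subst τ)

/-- The truth lemma. The induction is over all stages at once, since the quantifier case passes to a
stage where the element instantiated has a name. -/
theorem model_sat (hσ : Con T [σ]) (hen : ∀ n, (en n).Surjective)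
    (hsrt : ∀ p s, ∃ m, (Nat.unpair m).1 = p ∧ srt m = s) (hne : ∀ s, ∃ n, srt n = s)
    {Δ : List S} (φ : Formula L Δ) {n : ℕ} (τ : Sub L Δ (ctx srt n)) :
    φ.Sat (model T en σ hne) (asg n τ) ↔ Thm T en σ n (φ.subst τ) := by
  induction φ generalizing n with
  | falsum => exact iff_of_false id (thm_falsum hσ n)
  | eq t u =>
    rw [Formula.sat_eq, model_eval, model_eval]
    exact val_eq
  | rel r ts =>
    simp only [Formula.sat_rel, model_eval]
    exact model_rl hne r fun s v => (ts s v).subst τ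
  | imp φ ψ ih₁ ih₂ =>
    rw [Formula.sat_imp, ih₁, ih₂, Formula.subst, thm_imp hσ hen hsrt]
  | all s φ ih =>
    have e : ∀ (m) (h : n ≤ m) (t : Term L (ctx srt m) s),
        (Asg.cons (C := Car T en σ) (val m t) (asg n τ)) =
          asg m (Sub.cons t fun _ v => (τ _ v).rename (up srt h)) := by
      intro m h t
      funext r v
      cases v with
      | zero => rfl
      | succ v => exact (val_up h _).symm
    have e' : ∀ (m) (h : n ≤ m) (t : Term L (ctx srt m) s),
        (φ.subst (τ.lift s)).subst (Sub.cons t (Sub.ofRen (up srt h))) =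
          φ.subst (Sub.cons t fun _ v => (τ _ v).rename (up srt h)) := by
      intro m h t
      rw [← Formula.inst_rename_lift, Formula.rename_subst, Sub.lift_rename,
        Formula.inst_subst_lift]
    rw [Formula.sat_all, Formula.subst, thm_all hσ hen hsrt]
    constructor
    · intro h m hm t
      rw [e', ← ih, ← e]
      exact h _
    · intro h a
      obtain ⟨⟨m, t⟩, rfl⟩ := Quotient.exists_rep a
      have := h (max n m) (le_max_left _ _) (t.rename (up srt (le_max_right n m)))
      rw [e', ← ih, ← e, val_up] at this
      exact this

end Chain

end Henkin

/-- Completeness of natural deduction for countable languages. -/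
theorem complete [Nonempty S] [Countable S] {L : Signature S}
    [∀ Γ, Countable (Formula L Γ)] {T : Theory L} {σ : Sentence L}
    (h : ∀ M : Struc L, Models M T → σ.Sat M Asg.nil) : Proves T σ := by
  by_contra hσ
  have hcon : Henkin.Con T [σ.neg] := fun h => hσ (.raa h)
  obtain ⟨sq, hsq⟩ := exists_surjective_nat S
  -- The sort depends on the second component of the stage only, so each task, coded in the first
  -- component, occurs with every sort.
  let srt : ℕ → S := fun n => sq n.unpair.2
  have hsrt : ∀ p s, ∃ m, (Nat.unpair m).1 = p ∧ srt m = s := by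
    intro p s
    obtain ⟨i, rfl⟩ := hsq s
    exact ⟨Nat.pair p i, by simp, by simp [srt]⟩
  have hne : ∀ s, ∃ n, srt n = s := fun s => (hsrt 0 s).imp fun _ h => h.2
  have hen : ∀ n, ∃ f : ℕ → Formula L (Henkin.ctx srt n), f.Surjective := fun n =>
    have : Nonempty (Formula L (Henkin.ctx srt n)) := ⟨.falsum⟩
    exists_surjective_nat _
  choose en hen using hen
  have key : ∀ τ : Sentence L, τ.Sat (Henkin.model T en σ.neg hne) Asg.nil ↔
      Henkin.Thm T en σ.neg 0 τ := by
    intro τ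
    have := Henkin.model_sat hcon hen hsrt hne τ (n := 0) (fun _ v => .var v)
    change _ ↔ Henkin.Thm T en σ.neg 0 (Formula.subst (Γ := []) (Δ := []) (fun _ v => .var v) τ)
      at this
    rwa [Formula.subst_var, Asg.nil_eq (Henkin.asg _ _) Asg.nil] at this
  have hm := h (Henkin.model T en σ.neg hne) fun τ hτ => by
    rw [key]
    have := Prf.axm (Γ := []) (H := []) hτ
    rw [Ren.nil_eq Ren.nil (fun _ v => v), Formula.rename_id] at this
    exact .of_prf this
  rw [key] at hm
  refine (Henkin.thm_neg hcon hen hsrt).1 (Henkin.Thm.of_mem (n := 0) ?_) hm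
  exact List.mem_cons_self

/-! ### Countability of languages -/

/-- The position of a variable in its context. -/
def Var.idx : {Γ : List S} → {s : S} → Var Γ s → ℕ
  | _, _, .zero => 0
  | _, _, .succ v => v.idx + 1

theorem Var.idx_lt {Γ : List S} {s : S} (v : Var Γ s) : v.idx < Γ.length := by
  induction v with
  | zero => exact Nat.succ_pos _
  | succ v ih => exact Nat.succ_lt_succ ih

theorem Var.idx_inj {Γ : List S} {s t : S} (v : Var Γ s) (w : Var Γ t) (h : v.idx = w.idx) :
    (⟨s, v⟩ : Σ s, Var Γ s) = ⟨t, w⟩ := by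
  induction v with
  | zero =>
    cases w with
    | zero => rfl
    | succ w => cases h
  | succ v ih =>
    cases w with
    | zero => cases h
    | succ w =>
      have := ih w (Nat.succ.inj h)
      cases this
      rfl

instance (Γ : List S) : Finite (Σ s, Var Γ s) :=
  Finite.of_injective (fun p => (⟨p.2.idx, p.2.idx_lt⟩ : Fin Γ.length)) fun p q h =>
    Var.idx_inj p.2 q.2 (Fin.mk.inj h)

theorem countable_wtype {α : Type} {β : α → Type} [Countable α] [∀ a, Finite (β a)] :
    Countable (WType β) := by
  have (a : α) : Fintype (β a) := Fintype.ofFinite _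
  have (a : α) : Encodable (β a) := Encodable.ofCountable _
  have : Encodable α := Encodable.ofCountable _
  infer_instance

theorem WType.mk_inj {α : Type} {β : α → Type} {a b : α} {f : β a → WType β} {g : β b → WType β}
    (h : WType.mk a f = WType.mk b g) : a = b ∧ f ≍ g := by
  cases h
  exact ⟨rfl, HEq.rfl⟩

section

variable (L : Signature S) (Γ : List S)

/-- The subterms of a term with a given head. -/
def TermArity : (Σ s, Var Γ s) ⊕ L.Fn → Type
  | .inl _ => Empty
  | .inr f => Σ s, Var (L.fdom f) s

instance (a : (Σ s, Var Γ s) ⊕ L.Fn) : Finite (TermArity L Γ a) := by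
  cases a <;> unfold TermArity <;> infer_instance

variable {L Γ}

/-- The tree of a term. -/
def Term.tree : {s : S} → Term L Γ s → WType (TermArity L Γ)
  | s, .var v => ⟨.inl ⟨s, v⟩, Empty.elim⟩
  | _, .func f ts => ⟨.inr f, fun p : (Σ s, Var (L.fdom f) s) => (ts p.1 p.2).tree⟩

/-- The sorts are part of the conclusion because a compound term has the value sort of its head
symbol, so heads must be compared before the sorts are known to agree. -/
theorem Term.tree_inj {s : S} (t : Term L Γ s) {s' : S} (t' : Term L Γ s')
    (h : t.tree = t'.tree) : (⟨s, t⟩ : Σ s, Term L Γ s) = ⟨s', t'⟩ := by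
  induction t generalizing s' with
  | var v =>
    cases t' with
    | var w =>
      cases (WType.mk_inj h).1
      rfl
    | func f ts => cases (WType.mk_inj h).1
  | func f ts ih =>
    cases t' with
    | var w => cases (WType.mk_inj h).1
    | func g us =>
      obtain ⟨e, h⟩ := WType.mk_inj h
      cases e
      have : ts = us := by
        funext s v
        have := ih s v (us s v) (congrFun (eq_of_heq h) ⟨s, v⟩)
        simpa using this
      rw [this]

instance [Countable L.Fn] (s : S) : Countable (Term L Γ s) := by
  have : Countable (WType (TermArity L Γ)) := countable_wtype
  refine Function.Injective.countable (f := Term.tree) fun t t' h => ?_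
  simpa using Term.tree_inj t t' h

instance [Countable L.Fn] (Δ : List S) : Countable (Sub L Δ Γ) :=
  Function.Injective.countable (β := ∀ p : (Σ s, Var Δ s), Term L Γ p.1)
    (f := fun σ p => σ p.1 p.2) fun _ _ h => funext₂ fun s v => congrFun h ⟨s, v⟩

/-- The nodes of the tree of a formula. -/
abbrev FormulaNode (L : Signature S) : Type :=
  Unit ⊕ (Σ p : List S × S, Term L p.1 p.2 × Term L p.1 p.2) ⊕
    (Σ p : List S × L.Rl, Sub L (L.rdom p.2) p.1) ⊕ Unit ⊕ S

/-- The number of immediate subformulas. -/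
def FormulaArity : FormulaNode L → Type
  | .inr (.inr (.inr (.inl _))) => Bool
  | .inr (.inr (.inr (.inr _))) => Unit
  | _ => Empty

instance (a : FormulaNode L) : Finite (FormulaArity a) := by
  unfold FormulaArity
  split <;> infer_instance

/-- The tree of a formula. -/
def Formula.tree : {Γ : List S} → Formula L Γ → WType (FormulaArity (L := L))
  | _, .falsum => ⟨.inl (), Empty.elim⟩
  | Γ, .eq (s := s) t u => ⟨.inr (.inl ⟨(Γ, s), (t, u)⟩), Empty.elim⟩
  | Γ, .rel r ts => ⟨.inr (.inr (.inl ⟨(Γ, r), ts⟩)), Empty.elim⟩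
  | _, .imp φ ψ => ⟨.inr (.inr (.inr (.inl ()))), fun b : Bool => cond b φ.tree ψ.tree⟩
  | _, .all s φ => ⟨.inr (.inr (.inr (.inr s))), fun _ : Unit => φ.tree⟩

theorem Formula.tree_inj (φ ψ : Formula L Γ) (h : φ.tree = ψ.tree) : φ = ψ := by
  induction φ with
  | falsum =>
    cases ψ with
    | falsum => rfl
    | _ => cases (WType.mk_inj h).1
  | eq t u =>
    cases ψ with
    | eq t' u' =>
      cases (WType.mk_inj h).1
      rfl
    | _ => cases (WType.mk_inj h).1
  | rel r ts =>
    cases ψ with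
    | rel r' ts' =>
      cases (WType.mk_inj h).1
      rfl
    | _ => cases (WType.mk_inj h).1
  | imp φ φ' ih ih' =>
    cases ψ with
    | imp ψ ψ' =>
      have := eq_of_heq (WType.mk_inj h).2
      rw [ih _ (congrFun this true), ih' _ (congrFun this false)]
    | _ => cases (WType.mk_inj h).1
  | all s φ ih =>
    cases ψ with
    | all s' ψ =>
      obtain ⟨e, h⟩ := WType.mk_inj h
      cases e
      rw [ih _ (congrFun (eq_of_heq h) ())]
    | _ => cases (WType.mk_inj h).1

instance [Countable S] [Countable L.Fn] [Countable L.Rl] (Γ : List S) :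
    Countable (Formula L Γ) := by
  have : Countable (WType (FormulaArity (L := L))) := countable_wtype
  exact Function.Injective.countable (f := Formula.tree) Formula.tree_inj

end

instance {D : Type} [Countable D] : Countable (FregeFn D) := by
  refine Function.Injective.countable (β := (ℕ × ℕ) ⊕ D) (f := fun
    | .proj m n => .inl (m, n)
    | .del d => .inr d) ?_
  rintro (_ | _) (_ | _) <;> simp

instance {D : Type} [Countable D] (ar : D → ℕ) : Countable (LF ar).Fn :=
  inferInstanceAs (Countable (FregeFn D))

instance {D : Type} (ar : D → ℕ) : Countable (LF ar).Rl :=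
  inferInstanceAs (Countable (ℕ ⊕ Empty))

instance : Countable ProvEquiv :=
  Function.Injective.countable (β := Σ n, Formula L0 [n + 1, n + 1])
    (f := fun e => ⟨e.arity, e.E⟩) fun e e' h => by
      cases e; cases e'; cases h; rfl

/-! ### Translations and models -/

namespace Translation

variable {S' : Type} {L : Signature S} {K : Signature S'} (τ : Translation L K)

section

variable {τ} {C : S → Type} {C' : S' → Type} (emb : ∀ s, C s → C' (τ.srt s))

/-- The assignment in the target structure that corresponds to an assignment. -/
def mapAsg : {Γ : List S} → Asg C Γ → Asg C' (Γ.map τ.srt)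
  | [], _ => Asg.nil
  | _ :: _, e => Asg.cons (emb _ (e _ .zero)) (mapAsg fun _ v => e _ v.succ)

@[simp] theorem mapAsg_var {Γ : List S} (e : Asg C Γ) {s : S} (v : Var Γ s) :
    mapAsg emb e _ (τ.var v) = emb s (e _ v) := by
  induction v with
  | zero => rfl
  | succ v ih => exact ih _

end

/-- `N` is (via `emb`) the structure that the translation `τ` defines in `M`. -/
structure Defines (M : Struc K) (N : Struc L) (emb : ∀ s, N.C s → M.C (τ.srt s)) : Prop where
  inj : ∀ s, Function.Injective (emb s)
  dom : ∀ s a, (τ.dom s).Sat M (Asg.cons a Asg.nil) ↔ ∃ x, emb s x = a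
  rel : ∀ r e, (τ.rel r).Sat M (mapAsg emb e) ↔ N.rl r e
  fn : ∀ f e y, (τ.fn f).Sat M (Asg.cons (emb _ y) (mapAsg emb e)) ↔ y = N.fn f e

namespace Defines

variable {τ} {M : Struc K} {N : Struc L} {emb : ∀ s, N.C s → M.C (τ.srt s)}
  (h : τ.Defines M N emb)

include h

theorem sat_domAt {s : S} {Γ : List S'} (a : M.C (τ.srt s)) (e : Asg M.C Γ) :
    (τ.domAt s Γ).Sat M (Asg.cons a e) ↔ ∃ x, emb s x = a := by
  rw [← h.dom, domAt, Formula.sat_rename]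
  have : (fun _ v => Asg.cons a e _ (Ren.lift Ren.nil (τ.srt s) _ v)) = Asg.cons a Asg.nil := by
    funext t v
    cases v with
    | zero => rfl
    | succ v => cases v
  rw [this]

/-- The domain clauses force each quantified value to come from `N`, so the block of quantifiers
ranges over assignments in `N`. -/
theorem sat_exArgs {Γ : List S'} (Δ : List S)
    (P : ∀ s : S, Var Δ s → Formula K (τ.srt s :: Γ)) (body : Formula K (Δ.map τ.srt ++ Γ))
    (e : Asg M.C Γ) :
    (τ.exArgs Δ P body).Sat M e ↔ ∃ d : Asg N.C Δ,
      (∀ s v, (P s v).Sat M (Asg.cons (emb _ (d s v)) e)) ∧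
        body.Sat M (Asg.append (mapAsg emb d) e) := by
  induction Δ with
  | nil => exact ⟨fun h => ⟨Asg.nil, nofun, h⟩, fun ⟨_, _, h⟩ => h⟩
  | cons s Δ ih =>
    have e' : ∀ (a : M.C (τ.srt s)) (d : Asg M.C (Δ.map τ.srt)), (fun r v =>
        Asg.cons a (Asg.append d e) r (Ren.lift (Ren.weakBlock (Δ.map τ.srt)) _ _ v)) =
        Asg.cons a e := by
      intro a d
      funext r v
      cases v with
      | zero => rfl
      | succ v => exact Asg.append_weakBlock ..
    rw [exArgs, ih]
    simp only [Formula.sat_ex, Formula.sat_and, h.sat_domAt, Formula.sat_rename, e']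
    constructor
    · rintro ⟨d, hd, _, ⟨⟨x, rfl⟩, hx⟩, hb⟩
      refine ⟨Asg.cons x d, fun r v => ?_, hb⟩
      cases v with
      | zero => exact hx
      | succ v => exact hd _ v
    · rintro ⟨d, hd, hb⟩
      exact ⟨fun _ v => d _ v.succ, fun _ _ => hd _ _, _, ⟨⟨_, rfl⟩, hd _ _⟩, hb⟩

theorem sat_term {Γ : List S} {s : S} (t : Term L Γ s) (e : Asg N.C Γ) (y : N.C s) :
    (τ.term t).Sat M (Asg.cons (emb _ y) (mapAsg emb e)) ↔ y = t.eval N e := by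
  induction t with
  | var v =>
    simp only [term, Formula.sat_eq, Term.eval_var, Asg.cons_zero, Asg.cons_succ, mapAsg_var]
    exact (h.inj _).eq_iff
  | func f ts ih =>
    rw [term, h.sat_exArgs]
    have e₁ : ∀ (s : S) (z : N.C s), (fun r v => Asg.cons (emb _ z)
        (Asg.cons (emb _ y) (mapAsg emb e)) r (Ren.lift (Ren.weak _) (τ.srt s) _ v)) =
        Asg.cons (emb _ z) (mapAsg emb e) := by
      intro s z
      funext r v
      cases v <;> rfl
    simp only [Formula.sat_rename, e₁, ih]
    constructor
    · rintro ⟨d, hd, hb⟩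
      rw [Formula.sat_subst] at hb
      rw [Term.eval_func, ← (funext₂ hd : d = _), ← h.fn]
      convert hb using 1
      funext r v
      cases v with
      | zero => simp [Sub.cons]
      | succ v => simp [Sub.cons, Sub.ofRen]
    · intro hy
      refine ⟨fun s v => (ts s v).eval N e, fun _ _ => rfl, ?_⟩
      rw [Formula.sat_subst]
      rw [Term.eval_func, ← h.fn] at hy
      convert hy using 1
      funext r v
      cases v with
      | zero => simp [Sub.cons]
      | succ v => simp [Sub.cons, Sub.ofRen]

theorem sat_formula {Γ : List S} (φ : Formula L Γ) (e : Asg N.C Γ) :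
    (τ.formula φ).Sat M (mapAsg emb e) ↔ φ.Sat N e := by
  induction φ with
  | falsum => rfl
  | eq t u =>
    simp only [formula, Formula.sat_ex, Formula.sat_and, h.sat_domAt]
    constructor
    · rintro ⟨_, ⟨x, rfl⟩, h₁, h₂⟩
      exact ((h.sat_term ..).1 h₁).symm.trans ((h.sat_term ..).1 h₂)
    · intro h'
      exact ⟨_, ⟨_, rfl⟩, (h.sat_term ..).2 rfl, (h.sat_term ..).2 h'⟩
  | rel r ts =>
    rw [formula, h.sat_exArgs]
    simp only [h.sat_term, Formula.sat_rename, Asg.append_inBlock, h.rel]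
    constructor
    · rintro ⟨d, hd, hb⟩
      rwa [(funext₂ hd : d = _)] at hb
    · exact fun h' => ⟨_, fun _ _ => rfl, h'⟩
  | imp φ ψ ih₁ ih₂ => simp only [formula, Formula.sat_imp, ih₁, ih₂]
  | all s φ ih =>
    simp only [formula, Formula.sat_all, Formula.sat_imp, h.sat_domAt]
    constructor
    · intro h' x
      exact (ih _).1 (h' _ ⟨x, rfl⟩)
    · rintro h' _ ⟨x, rfl⟩
      exact (ih (Asg.cons x e)).2 (h' x)

end Defines

end Translation

/-- A translation that defines in every model of `T` a model of `U` is an interpretation. -/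
theorem interprets_of_defines {S' : Type} [Nonempty S'] [Countable S'] {K : Signature S'}
    [∀ Γ, Countable (Formula K Γ)] {L : Signature S} {T : Theory K} {U : Theory L}
    (τ : Translation L K) (h : ∀ M : Struc K, Models M T →
      ∃ (N : Struc L) (emb : _), Models N U ∧ τ.Defines M N emb) : Interprets T U := by
  refine ⟨τ, fun σ hσ => complete fun M hM => ?_⟩
  obtain ⟨N, emb, hN, hτ⟩ := h M hM
  exact (hτ.sat_formula σ Asg.nil).2 (hσ.sound N hN _ (by simp))

end Fregean

namespace Fregean

/-! ### Second-order structures -/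

/-- The assignment on a block of object variables that is given by a tuple. -/
def Asg.tuple {C : ℕ → Type} : (n : ℕ) → (Fin n → C 0) → Asg C (objs n)
  | 0, _ => Asg.nil
  | n + 1, a => Asg.cons (a 0) (Asg.tuple n fun i => a i.succ)

theorem Asg.tuple_objIdx {C : ℕ → Type} (n : ℕ) (a : Fin n → C 0) (i : Fin n) :
    Asg.tuple n a 0 (objIdx n i) = a i := by
  induction n with
  | zero => exact i.elim0
  | succ n ih =>
    cases i using Fin.cases with
    | zero => rfl
    | succ i => exact ih (fun i => a i.succ) i

theorem Asg.exists_tuple {C : ℕ → Type} (n : ℕ) (e : Asg C (objs n)) :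
    ∃ a, e = Asg.tuple n a := by
  induction n with
  | zero => exact ⟨Fin.elim0, Asg.nil_eq _ _⟩
  | succ n ih =>
    obtain ⟨a, ha⟩ := ih fun _ v => e _ v.succ
    refine ⟨Fin.cons (e _ .zero) a, ?_⟩
    rw [← Asg.cons_eta e, ha]
    rfl

@[simp] theorem Asg.append_objVar {C : ℕ → Type} {Γ : List ℕ} (n : ℕ) (a : Fin n → C 0)
    (e : Asg C Γ) (i : Fin n) : Asg.append (Asg.tuple n a) e 0 (objVar n i) = a i := by
  rw [objVar, Asg.append_inBlock, Asg.tuple_objIdx]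

theorem Sub.eval_tuple {L : Signature ℕ} (M : Struc L) {Γ : List ℕ} (n : ℕ)
    (a : Fin n → Term L Γ 0) (e : Asg M.C Γ) :
    (fun s v => (Fregean.tuple n a s v).eval M e) = Asg.tuple n fun i => (a i).eval M e := by
  induction n with
  | zero => exact Asg.nil_eq _ _
  | succ n ih =>
    rw [Asg.tuple, ← ih fun i => a i.succ]
    funext s v
    cases v <;> rfl

theorem Formula.sat_allObjs {L : Signature ℕ} (M : Struc L) {Γ : List ℕ} (n : ℕ)
    (φ : Formula L (objs n ++ Γ)) (e : Asg M.C Γ) :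
    (allBlock (objs n) φ).Sat M e ↔ ∀ a, φ.Sat M (Asg.append (Asg.tuple n a) e) := by
  rw [sat_allBlock]
  refine ⟨fun h a => h _, fun h d => ?_⟩
  obtain ⟨a, rfl⟩ := Asg.exists_tuple n d
  exact h a

/-- Concatenation of tuples. -/
def glue {α : Type} {m n : ℕ} (a : Fin (m + 1) → α) (b : Fin (n + 1) → α) :
    Fin (m + 1 + n + 1) → α := Fin.append (m := m + 1) (n := n + 1) a b

@[simp] theorem glue_left {α : Type} {m n : ℕ} (a : Fin (m + 1) → α) (b : Fin (n + 1) → α)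
    (i : Fin (m + 1)) : glue a b (Fin.castAdd (n + 1) i) = a i := Fin.append_left a b i

@[simp] theorem glue_right {α : Type} {m n : ℕ} (a : Fin (m + 1) → α) (b : Fin (n + 1) → α)
    (i : Fin (n + 1)) : glue a b (Fin.natAdd (m + 1) i) = b i := Fin.append_right a b i

/-- Predication. -/
def Struc.pr {X : Signature ℕ} (M : Struc (SO X)) {n : ℕ} (R : M.C (n + 1))
    (a : Fin (n + 1) → M.C 0) : Prop :=
  M.rl (Sum.inl n) (Asg.cons (Γ := objs (n + 1)) R (Asg.tuple (n + 1) a))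

/-- Projection. -/
def Struc.prj {D : Type} {ar : D → ℕ} (M : Struc (LF ar)) {m n : ℕ}
    (R : M.C ((m + 1) + (n + 1))) (a : Fin (m + 1) → M.C 0) : M.C (n + 1) :=
  M.fn (FregeFn.proj m n) (Asg.cons (Γ := objs (m + 1)) R (Asg.tuple (m + 1) a))

/-- Abstraction. -/
def Struc.del {D : Type} {ar : D → ℕ} (M : Struc (LF ar)) (d : D) (R : M.C (ar d + 1)) : M.C 0 :=
  M.fn (FregeFn.del d) (Asg.cons (Γ := []) R Asg.nil)

@[simp] theorem sat_pred {X : Signature ℕ} (M : Struc (SO X)) {Γ : List ℕ} {n : ℕ}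
    (R : Term (SO X) Γ (n + 1)) (a : Fin (n + 1) → Term (SO X) Γ 0) (e : Asg M.C Γ) :
    (pred R a).Sat M e ↔ M.pr (R.eval M e) fun i => (a i).eval M e := by
  change M.rl (Sum.inl n) _ ↔ _
  rw [Struc.pr, ← Sub.eval_tuple]
  refine iff_of_eq (congrArg (M.rl (Sum.inl n)) ?_)
  funext s v
  cases v <;> rfl

@[simp] theorem eval_projT {D : Type} {ar : D → ℕ} (M : Struc (LF ar)) {Γ : List ℕ} {m n : ℕ}
    (R : Term (LF ar) Γ ((m + 1) + (n + 1))) (a : Fin (m + 1) → Term (LF ar) Γ 0)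
    (e : Asg M.C Γ) :
    (projT m n R a).eval M e = M.prj (R.eval M e) fun i => (a i).eval M e := by
  rw [projT, Struc.prj, ← Sub.eval_tuple]
  refine congrArg (M.fn (FregeFn.proj m n)) ?_
  funext s v
  cases v <;> rfl

@[simp] theorem eval_delT {D : Type} {ar : D → ℕ} (M : Struc (LF ar)) {Γ : List ℕ} (d : D)
    (R : Term (LF ar) Γ (ar d + 1)) (e : Asg M.C Γ) :
    (delT d R).eval M e = M.del d (R.eval M e) := by
  rw [delT, Struc.del]
  refine congrArg (M.fn (FregeFn.del d)) ?_
  funext s v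
  cases v with
  | zero => rfl
  | succ v => cases v

theorem sat_extAx {X : Signature ℕ} (M : Struc (SO X)) (n : ℕ) :
    (extAx n).Sat M Asg.nil ↔
      ∀ R S : M.C (n + 1), R = S ↔ ∀ a, (M.pr R a ↔ M.pr S a) := by
  simp [extAx, Formula.sat_allObjs]

theorem sat_compAx {X : Signature ℕ} (M : Struc (SO X)) (n : ℕ) (Γ : List ℕ)
    (φ : Formula (SO X) (objs (n + 1) ++ Γ)) :
    (compAx n Γ φ).Sat M Asg.nil ↔ ∀ e, ∃ R : M.C (n + 1), ∀ a,
      (M.pr R a ↔ φ.Sat M (Asg.append (Asg.tuple (n + 1) a) e)) := by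
  have key : ∀ (Δ : List ℕ) (R : M.C (n + 1)) (d : Asg M.C Δ) (e : Asg M.C Γ),
      (fun r v => Asg.append d (Asg.cons R e) r (Ren.liftBlock (Ren.weak (n + 1)) Δ _ v)) =
        Asg.append d e := by
    intro Δ R d e
    induction Δ with
    | nil => rfl
    | cons s Δ ih =>
      funext r v
      cases v with
      | zero => rfl
      | succ v => exact congrFun₂ (ih _) _ v
  simp only [compAx, Formula.sat_close, Formula.sat_ex, Formula.sat_allObjs, Formula.sat_iff,
    sat_pred, Formula.sat_rename, key, Term.eval_var, Asg.append_weakBlock, Asg.append_objVar,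
    Asg.cons_zero]

theorem sat_projAx {D : Type} {ar : D → ℕ} (M : Struc (LF ar)) (m n : ℕ) :
    (projAx ar m n).Sat M Asg.nil ↔ ∀ (R : M.C ((m + 1) + (n + 1))) a b,
      M.pr (M.prj R a) b ↔ M.pr (n := m + 1 + n) R (glue a b) := by
  have key : ∀ (Γ : List ℕ) (t : Fin (m + 1) → Term (LF ar) Γ 0)
      (u : Fin (n + 1) → Term (LF ar) Γ 0) (e : Asg M.C Γ),
      (fun i => Term.eval M (Fin.append t u i) e) =
        Fin.append (fun i => (t i).eval M e) (fun i => (u i).eval M e) := by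
    intro Γ t u e
    funext i
    induction i using Fin.addCases with
    | left i => simp
    | right i => simp
  simp only [projAx, Formula.sat_all, Formula.sat_allObjs, Formula.sat_iff, sat_pred,
    eval_projT]
  refine forall_congr' fun R => forall_congr' fun a => forall_congr' fun b => ?_
  -- The arities `(m + 1) + (n + 1)` and `m + 1 + n + 1` agree only by unfolding, so a syntactic
  -- rewrite does not apply.
  erw [key]
  have h : Asg.append (Asg.tuple (n + 1) b) (Asg.append (Asg.tuple (m + 1) a)
      (Asg.cons R Asg.nil)) _ (Ren.weakBlock (objs (n + 1)) _ (Ren.weakBlock (objs (m + 1)) _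
        .zero)) = R := by simp
  simp only [Term.eval_var, Asg.append_weakBlock, Asg.append_objVar, Asg.cons_zero]
  exact iff_of_eq (congrArg (fun R' => (_ ↔ M.pr (n := m + 1 + n) R' (glue a b))) h)

/-! ### Definability with projected parameters -/

/-- The existential quantification over a block of variables. -/
def Formula.exBlock {S : Type} {L : Signature S} {Γ : List S} (Δ : List S)
    (φ : Formula L (Δ ++ Γ)) : Formula L Γ := (allBlock Δ φ.neg).neg

theorem Formula.sat_exBlock {S : Type} {L : Signature S} (M : Struc L) {Γ : List S} (Δ : List S)
    (φ : Formula L (Δ ++ Γ)) (e : Asg M.C Γ) :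
    (exBlock Δ φ).Sat M e ↔ ∃ d, φ.Sat M (Asg.append d e) := by
  simp [exBlock, sat_allBlock]

/-- The structures for `L₀` in which every formula `χ(W)` defines a concept of those tuples whose
projection satisfies `χ`. -/
structure Rich (M : Struc L0) : Prop where
  ext {n : ℕ} {R S : M.C (n + 1)} : (∀ a, M.pr R a ↔ M.pr S a) → R = S
  proj {m n : ℕ} (R : M.C ((m + 1) + (n + 1))) (a b) :
    M.pr (M.prj R a) b ↔ M.pr (n := m + 1 + n) R (glue a b)
  comp {n : ℕ} {Γ : List ℕ} (φ : Formula L0 (objs (n + 1) ++ Γ)) (e : Asg M.C Γ) : IsFO φ →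
    ∃ R : M.C (n + 1), ∀ a, M.pr R a ↔ φ.Sat M (Asg.append (Asg.tuple (n + 1) a) e)
  image {m n : ℕ} (χ : Formula L0 [m + 1]) (T : M.C ((n + 1) + (m + 1))) :
    ∃ R : M.C (n + 1), ∀ a, M.pr R a ↔ χ.Sat M (Asg.cons (M.prj T a) Asg.nil)
  two : ∃ x y : M.C 0, x ≠ y

namespace Rich

/-- The extent of an element of a sort, objects being identified with their singletons. -/
def mem (M : Struc L0) : {s : ℕ} → M.C s → (Fin (s.pred + 1) → M.C 0) → Prop
  | 0, x, z => z 0 = x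
  | _ + 1, R, z => M.pr R z

/-- The formula that expresses `mem`. -/
def memF {Γ : List ℕ} : {s : ℕ} → Var Γ s → (Fin (s.pred + 1) → Var Γ 0) → Formula L0 Γ
  | 0, x, z => .eq (.var (z 0)) (.var x)
  | _ + 1, R, z => pred (.var R) fun i => .var (z i)

theorem sat_memF (M : Struc L0) {Γ : List ℕ} {s : ℕ} (x : Var Γ s)
    (z : Fin (s.pred + 1) → Var Γ 0) (e : Asg M.C Γ) :
    (memF x z).Sat M e ↔ mem M (e _ x) fun i => e _ (z i) := by
  cases s with
  | zero => rfl
  | succ s => simp [memF, mem]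

/-- The families of assignments, indexed by tuples of objects, each entry of which is constant or
one of the coordinates of the tuple. -/
def Simple {C : ℕ → Type} {n : ℕ} {Δ : List ℕ} (v : (Fin (n + 1) → C 0) → Asg C Δ) : Prop :=
  ∀ s (x : Var Δ s), (∃ c, ∀ a, v a s x = c) ∨
    ∃ h : s = 0, ∃ i, ∀ a, v a s x = h ▸ a i

variable {M : Struc L0} (hM : Rich M)

include hM

theorem mem_ext {s : ℕ} {x y : M.C s} (h : ∀ z, mem M x z ↔ mem M y z) : x = y := by
  cases s with
  | zero => exact (h fun _ => x).1 rfl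
  | succ s => exact hM.ext h

/-- A constant entry becomes a parameter of first-order comprehension, the tuple a being ignored; a
coordinate of a is represented by its singleton. -/
theorem exists_entry {n s : ℕ} (x : (Fin (n + 1) → M.C 0) → M.C s)
    (hx : (∃ c, ∀ a, x a = c) ∨ ∃ h : s = 0, ∃ i, ∀ a, x a = h ▸ a i) :
    ∃ U : M.C ((n + 1) + (s.pred + 1)), ∀ a z, M.pr (M.prj U a) z ↔ mem M (x a) z := by
  rcases hx with ⟨c, hc⟩ | ⟨rfl, i, hi⟩
  · obtain ⟨U, hU⟩ := hM.comp (n := n + 1 + s.pred) (Γ := [s])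
      (memF (Ren.weakBlock _ _ .zero) fun i => objVar _ (Fin.natAdd (n + 1) i))
      (Asg.cons c Asg.nil) (by cases s <;> simp [memF, IsFO, pred])
    refine ⟨U, fun a z => ?_⟩
    rw [hM.proj, hU, sat_memF]
    simp only [Asg.append_weakBlock, Asg.append_objVar, Asg.cons_zero, hc]
    exact iff_of_eq (congrArg _ (funext fun i => glue_right a z i))
  · obtain ⟨U, hU⟩ := hM.comp (n := n + 1 + 0) (Γ := [])
      (.eq (.var (objVar (n + 1 + 1) (Fin.natAdd (n + 1) 0)))
        (.var (objVar (n + 1 + 1) (Fin.castAdd 1 i)))) Asg.nil trivial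
    refine ⟨U, fun a z => ?_⟩
    rw [hM.proj, hU]
    simp only [Formula.sat_eq, Term.eval_var, Asg.append_objVar, hi]
    exact iff_of_eq (congrArg₂ _ (glue_right (m := n) (n := 0) a z 0) (glue_left a z i))

omit hM in
/-- `W` consists of `x` on the diagonal of its first two places, and of `W'` off it. -/
def mergeF {Γ : List ℕ} {s c : ℕ} (W : Var Γ ((s.pred + 1) + (c + 1) + 1 + 1)) (x : Var Γ s)
    (W' : Var Γ (c + 1)) : Formula L0 Γ :=
  .allBlock (objs ((s.pred + 1) + (c + 1) + 1 + 1)) (.iff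
    (pred (.var (Ren.weakBlock _ _ W)) fun i => .var (objVar _ i))
    (.or
      (.and (.eq (.var (objVar _ 0)) (.var (objVar _ 1)))
        (memF (Ren.weakBlock _ _ x) fun i => objVar _ (Fin.castAdd (c + 1) i).succ.succ))
      (.and (.neg (.eq (.var (objVar _ 0)) (.var (objVar _ 1))))
        (pred (.var (Ren.weakBlock _ _ W'))
          fun i => .var (objVar _ (Fin.natAdd (s.pred + 1) i).succ.succ)))))

omit hM in
theorem sat_mergeF {Γ : List ℕ} {s c : ℕ} (W : Var Γ ((s.pred + 1) + (c + 1) + 1 + 1))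
    (x : Var Γ s) (W' : Var Γ (c + 1)) (e : Asg M.C Γ) :
    (mergeF W x W').Sat M e ↔ ∀ z, (M.pr (e _ W) z ↔
      (z 0 = z 1 ∧ mem M (e _ x) fun i => z (Fin.castAdd (c + 1) i).succ.succ) ∨
      (z 0 ≠ z 1 ∧ M.pr (e _ W') fun i => z (Fin.natAdd (s.pred + 1) i).succ.succ)) := by
  simp [mergeF, Formula.sat_allObjs, sat_memF]

/-- Projections are terms, so with V[a] representing the entry x(a), the merging of V[a] with T[a]
is described without concept quantifiers and first-order comprehension applies. -/
theorem exists_merge {n s c : ℕ} (x : (Fin (n + 1) → M.C 0) → M.C s)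
    (hx : (∃ c, ∀ a, x a = c) ∨ ∃ h : s = 0, ∃ i, ∀ a, x a = h ▸ a i)
    (T : M.C ((n + 1) + (c + 1))) :
    ∃ U : M.C ((n + 1) + ((s.pred + 1) + (c + 1) + 1 + 1)), ∀ a z, (M.pr (M.prj U a) z ↔
      (z 0 = z 1 ∧ mem M (x a) fun i => z (Fin.castAdd (c + 1) i).succ.succ) ∨
      (z 0 ≠ z 1 ∧ M.pr (M.prj T a) fun i => z (Fin.natAdd (s.pred + 1) i).succ.succ)) := by
  obtain ⟨V, hV⟩ := hM.exists_entry x hx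
  let o {Γ : List ℕ} (i : Fin ((s.pred + 1) + (c + 1) + 1 + 1)) : Term L0 (objs (n + 1 +
    ((s.pred + 1) + (c + 1) + 1) + 1) ++ Γ) 0 := .var (objVar _ (Fin.natAdd (n + 1) i))
  let p {Γ : List ℕ} (i : Fin (n + 1)) : Term L0 (objs (n + 1 +
    ((s.pred + 1) + (c + 1) + 1) + 1) ++ Γ) 0 :=
      .var (objVar _ (Fin.castAdd ((s.pred + 1) + (c + 1) + 1 + 1) i))
  obtain ⟨U, hU⟩ := hM.comp (n := n + 1 + ((s.pred + 1) + (c + 1) + 1))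
    (Γ := [(n + 1) + (s.pred + 1), (n + 1) + (c + 1)])
    (.or (.and (.eq (o 0) (o 1))
        (pred (projT n s.pred (.var (Ren.weakBlock _ _ .zero)) p)
          fun i => o (Fin.castAdd (c + 1) i).succ.succ))
      (.and (.neg (.eq (o 0) (o 1)))
        (pred (projT n c (.var (Ren.weakBlock _ _ (.succ .zero))) p)
          fun i => o (Fin.natAdd (s.pred + 1) i).succ.succ)))
    (Asg.cons V (Asg.cons T Asg.nil))
    (by simp [Formula.or, Formula.and, Formula.neg, IsFO, pred])
  refine ⟨U, fun a z => ?_⟩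
  rw [hM.proj, hU]
  simp only [o, p, Formula.sat_or, Formula.sat_and, Formula.sat_eq, Formula.sat_neg, sat_pred,
    eval_projT, Term.eval_var, Asg.append_objVar, Asg.append_weakBlock, Asg.cons_zero,
    Asg.cons_succ]
  simp only [glue_left, glue_right, hV, ne_eq]

omit hM in
-- Decoding of the first component: a repeated object in the first two places selects it, and the
-- places belonging to the other component are filled arbitrarily.
theorem mem_of_diagonal {s c : ℕ} {W : M.C ((s.pred + 1) + (c + 1) + 1 + 1)} {x : M.C s}
    {W' : M.C (c + 1)} (h : ∀ z, (M.pr W z ↔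
      (z 0 = z 1 ∧ mem M x fun i => z (Fin.castAdd (c + 1) i).succ.succ) ∨
      (z 0 ≠ z 1 ∧ M.pr W' fun i => z (Fin.natAdd (s.pred + 1) i).succ.succ)))
    (u : M.C 0) (z : Fin (s.pred + 1) → M.C 0) :
    mem M x z ↔ M.pr W (Fin.cons u (Fin.cons u (glue z fun _ => u))) := by
  rw [h]
  simp only [Fin.cons_zero, Fin.cons_one, Fin.cons_succ, glue_left, true_and, ne_eq,
    not_true_eq_false, false_and, or_false]

omit hM in
-- Decoding of the second component. Two distinct objects are needed to leave the diagonal, which is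
-- the purpose of the field `two` of `Rich`.
theorem pr_of_off_diagonal {s c : ℕ} {W : M.C ((s.pred + 1) + (c + 1) + 1 + 1)} {x : M.C s}
    {W' : M.C (c + 1)} (h : ∀ z, (M.pr W z ↔
      (z 0 = z 1 ∧ mem M x fun i => z (Fin.castAdd (c + 1) i).succ.succ) ∨
      (z 0 ≠ z 1 ∧ M.pr W' fun i => z (Fin.natAdd (s.pred + 1) i).succ.succ)))
    {u w : M.C 0} (huw : u ≠ w) (z : Fin (c + 1) → M.C 0) :
    M.pr W' z ↔ M.pr W (Fin.cons u (Fin.cons w (glue (fun _ => u) z))) := by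
  rw [h]
  simp only [Fin.cons_zero, Fin.cons_one, Fin.cons_succ, glue_right, huw, ne_eq,
    not_false_eq_true, true_and, false_and, false_or]

/-- The values of a simple family are coded by projections of a single concept, in such a way
that the decoding is definable. -/
theorem exists_code {n : ℕ} {Δ : List ℕ} (v : (Fin (n + 1) → M.C 0) → Asg M.C Δ)
    (hv : Simple v) : ∃ (c : ℕ) (κ : Formula L0 ((c + 1) :: Δ)) (T : M.C ((n + 1) + (c + 1))),
      (∀ a, κ.Sat M (Asg.cons (M.prj T a) (v a))) ∧
      ∀ W d d', κ.Sat M (Asg.cons W d) → κ.Sat M (Asg.cons W d') → d = d' := by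
  induction Δ with
  | nil =>
    -- With no variables to code, any concept is a code, and κ can be the true formula.
    obtain ⟨T⟩ := M.ne ((n + 1) + (0 + 1))
    exact ⟨0, Formula.falsum.neg, T, fun _ => id, fun _ _ _ _ _ => Asg.nil_eq _ _⟩
  | cons s Δ ih =>
    obtain ⟨c, κ, T, hT, hκ⟩ := ih (fun a _ x => v a _ x.succ) fun _ x => hv _ x.succ
    obtain ⟨U, hU⟩ := hM.exists_merge _ (hv s .zero) T
    -- The renaming skips the merged concept W and the new entry x, which stand between the old code
    -- W' and the remaining variables.
    let ρ : Ren ((c + 1) :: Δ) ((c + 1) :: ((s.pred + 1) + (c + 1) + 1 + 1) :: s :: Δ) :=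
      Ren.lift (fun _ x => x.succ.succ) _
    let κ' : Formula L0 (((s.pred + 1) + (c + 1) + 1 + 1) :: s :: Δ) :=
      .ex (c + 1) (.and (κ.rename ρ) (mergeF (.succ .zero) (.succ (.succ .zero)) .zero))
    have hκ' : ∀ W x d, κ'.Sat M (Asg.cons W (Asg.cons x d)) ↔ ∃ W' : M.C (c + 1),
        κ.Sat M (Asg.cons W' d) ∧ ∀ z, (M.pr W z ↔
      (z 0 = z 1 ∧ mem M x fun i => z (Fin.castAdd (c + 1) i).succ.succ) ∨
      (z 0 ≠ z 1 ∧ M.pr W' fun i => z (Fin.natAdd (s.pred + 1) i).succ.succ)) := by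
      intro W x d
      have e : ∀ W', (fun r y => Asg.cons W' (Asg.cons W (Asg.cons x d)) r (ρ _ y)) =
          Asg.cons W' d := by
        intro W'
        funext r y
        cases y <;> rfl
      simp only [κ', Formula.sat_ex, Formula.sat_and, Formula.sat_rename, e, sat_mergeF,
        Asg.cons_zero, Asg.cons_succ]
    refine ⟨(s.pred + 1) + (c + 1) + 1, κ', U, fun a => ?_, fun W d d' h h' => ?_⟩
    · rw [← Asg.cons_eta (v a), hκ']
      exact ⟨M.prj T a, hT a, hU a⟩
    · rw [← Asg.cons_eta d, hκ'] at h
      rw [← Asg.cons_eta d', hκ'] at h'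
      obtain ⟨W₁, h₁, h₂⟩ := h
      obtain ⟨W₂, h₃, h₄⟩ := h'
      obtain ⟨u, w, huw⟩ := hM.two
      have e₁ : d _ .zero = d' _ .zero := hM.mem_ext fun z => by
        rw [mem_of_diagonal h₂ u, mem_of_diagonal h₄ u]
      have e₂ : W₁ = W₂ := hM.ext fun z => by
        rw [pr_of_off_diagonal h₂ huw, pr_of_off_diagonal h₄ huw]
      subst e₂
      rw [← Asg.cons_eta d, ← Asg.cons_eta d', e₁, hκ _ _ _ h₁ h₃]

/-- Full comprehension for formulas of `L₀`. -/
theorem define {n : ℕ} {Δ : List ℕ} (ψ : Formula L0 Δ) (v : (Fin (n + 1) → M.C 0) → Asg M.C Δ)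
    (hv : Simple v) : ∃ R : M.C (n + 1), ∀ a, M.pr R a ↔ ψ.Sat M (v a) := by
  obtain ⟨c, κ, T, hT, hκ⟩ := hM.exists_code v hv
  let ρ : Ren ((c + 1) :: Δ) (Δ ++ [c + 1]) := fun
    | _, .zero => Ren.weakBlock Δ _ .zero
    | _, .succ x => Ren.inBlock Δ _ x
  -- The class used is that of the concepts W coding some d with ψ(d). It has the single free
  -- variable W, and as codes determine what they code, the d belonging to T[a] is v(a).
  obtain ⟨R, hR⟩ := hM.image
    (.exBlock Δ (.and (κ.rename ρ) (ψ.rename (Ren.inBlock Δ)))) T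
  refine ⟨R, fun a => ?_⟩
  have e : ∀ (W : M.C (c + 1)) (d : Asg M.C Δ),
      (fun r x => Asg.append d (Asg.cons W Asg.nil) r (ρ _ x)) = Asg.cons W d := by
    intro W d
    funext r x
    cases x with
    | zero => exact Asg.append_weakBlock ..
    | succ x => exact Asg.append_inBlock ..
  simp only [hR, Formula.sat_exBlock, Formula.sat_and, Formula.sat_rename, e,
    Asg.append_inBlock]
  exact ⟨fun ⟨d, h, h'⟩ => hκ _ _ _ h (hT a) ▸ h', fun h => ⟨v a, hT a, h⟩⟩

end Rich

section Simple

variable {C : ℕ → Type} {n : ℕ}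

theorem Rich.Simple.const {Δ : List ℕ} (d : Asg C Δ) :
    Rich.Simple (n := n) fun _ => d := fun _ _ => .inl ⟨_, fun _ => rfl⟩

theorem Rich.Simple.append {Δ Γ : List ℕ} {v : (Fin (n + 1) → C 0) → Asg C Δ}
    {w : (Fin (n + 1) → C 0) → Asg C Γ} (hv : Rich.Simple v) (hw : Rich.Simple w) :
    Rich.Simple fun a => Asg.append (v a) (w a) := by
  induction Δ with
  | nil => exact hw
  | cons s Δ ih =>
    intro r x
    cases x with
    | zero => exact hv _ .zero
    | succ x => exact ih (v := fun a _ y => v a _ y.succ) (fun _ y => hv _ y.succ) _ x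

theorem Rich.Simple.tuple_comp {k : ℕ} (f : Fin k → Fin (n + 1)) :
    Rich.Simple (C := C) (n := n) fun a => Asg.tuple k fun i => a (f i) := by
  induction k with
  | zero => intro _ x; cases x
  | succ k ih =>
    intro r x
    cases x with
    | zero => exact .inr ⟨rfl, f 0, fun a => rfl⟩
    | succ x => exact ih (fun i => f i.succ) _ x

theorem Rich.Simple.tuple : Rich.Simple (C := C) (n := n) (Asg.tuple (n + 1)) :=
  Rich.Simple.tuple_comp id

end Simple

/-! ### Models of the predicative Fregean theory -/

section

variable {D : Type} {ar : D → ℕ} (M : Struc (LF ar))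

/-- The reduct to the language `L₀`. -/
abbrev Struc.red : Struc L0 where
  C := M.C
  ne := M.ne
  fn
    | .proj m n, e => M.fn (FregeFn.proj m n) e
    | .del d, _ => d.elim
  rl
    | .inl n, e => M.rl (.inl n) e
    | .inr r, _ => r.elim

theorem eval_expand {Γ : List ℕ} {s : ℕ} (t : Term L0 Γ s) (e : Asg M.C Γ) :
    (t.expand ar).eval M e = t.eval M.red e := by
  induction t with
  | var v => rfl
  | func f ts ih =>
    cases f with
    | proj m n =>
      exact congrArg (M.fn (FregeFn.proj m n)) (funext₂ fun s v => ih s v)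
    | del d => exact d.elim

theorem sat_expand {Γ : List ℕ} (φ : Formula L0 Γ) (e : Asg M.C Γ) :
    (φ.expand ar).Sat M e ↔ φ.Sat M.red e := by
  induction φ with
  | falsum => rfl
  | eq t u => simp only [Formula.expand, Formula.sat_eq, eval_expand]
  | rel r ts =>
    cases r with
    | inl n =>
      exact iff_of_eq (congrArg (M.rl (.inl n)) (funext₂ fun s v => eval_expand M _ e))
    | inr r => exact r.elim
  | imp φ ψ ih₁ ih₂ => simp only [Formula.expand, Formula.sat_imp, ih₁, ih₂]
  | all s φ ih => simp only [Formula.expand, Formula.sat_all, ih]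

end

theorem IsFO.expand {D : Type} (ar : D → ℕ) {Γ : List ℕ} {φ : Formula L0 Γ} (h : IsFO φ) :
    IsFO (φ.expand ar) := by
  induction φ with
  | falsum => trivial
  | eq t u => trivial
  | rel r ts =>
    cases r with
    | inl n => trivial
    | inr r => exact r.elim
  | imp φ ψ ih₁ ih₂ => exact ⟨ih₁ h.1, ih₂ h.2⟩
  | all s φ ih => exact ⟨h.1, ih h.2⟩

theorem sat_app2 {L : Signature ℕ} (M : Struc L) {Γ : List ℕ} {n : ℕ} (E : Formula L [n, n])
    (t u : Term L Γ n) (e : Asg M.C Γ) :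
    (app2 E t u).Sat M e ↔ E.Sat M (Asg.cons (t.eval M e) (Asg.cons (u.eval M e) Asg.nil)) := by
  rw [app2, Formula.sat_subst]
  refine iff_of_eq (congrArg _ ?_)
  funext s v
  rcases v with _ | _ | _ | _ <;> rfl

theorem sat_equivSentence {L : Signature ℕ} (M : Struc L) {n : ℕ} (E : Formula L [n, n])
    (h : Equivalence fun R S => E.Sat M (Asg.cons R (Asg.cons S Asg.nil))) :
    (equivSentence E).Sat M Asg.nil := by
  simp only [equivSentence, Formula.sat_all, Formula.sat_and, Formula.sat_imp, sat_app2,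
    Term.eval_var, Asg.cons_zero, Asg.cons_succ]
  exact fun R S T => ⟨h.refl R, h.symm, fun h' => h.trans h'.1 h'.2⟩

/-- Equivalence relations that are such in all structures. -/
abbrev ProvEquiv.ofEquivalence {n : ℕ} (E : Formula L0 [n + 1, n + 1])
    (h : ∀ M : Struc L0, Equivalence fun R S => E.Sat M (Asg.cons R (Asg.cons S Asg.nil))) :
    ProvEquiv :=
  -- Completeness turns truth in all structures into the derivability that `ProvEquiv` demands.
  ⟨n, E, complete fun M _ => sat_equivSentence M E (h M)⟩

/-- Having the same truth value for `χ`. -/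
def sameF {n : ℕ} (χ : Formula L0 [n]) : Formula L0 [n, n] :=
  .iff (χ.rename (Ren.lift Ren.nil n)) (χ.rename (Ren.weak n))

theorem sat_sameF (M : Struc L0) {n : ℕ} (χ : Formula L0 [n]) (R S : M.C n) :
    (sameF χ).Sat M (Asg.cons R (Asg.cons S Asg.nil)) ↔
      (χ.Sat M (Asg.cons R Asg.nil) ↔ χ.Sat M (Asg.cons S Asg.nil)) := by
  have e : (fun r v => Asg.cons R (Asg.cons S Asg.nil) r (Ren.lift Ren.nil n _ v)) =
      Asg.cons R Asg.nil := by
    funext r v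
    rcases v with _ | _ | _; rfl
  simp only [sameF, Formula.sat_iff, Formula.sat_rename, e]
  rfl

/-- The equivalence relation with the (at most) two classes given by `χ`. -/
abbrev ProvEquiv.ofClass {n : ℕ} (χ : Formula L0 [n + 1]) : ProvEquiv :=
  .ofEquivalence (sameF χ) fun M => by
    simp only [sat_sameF]
    exact ⟨fun _ => Iff.rfl, Iff.symm, Iff.trans⟩

/-- Identity of unary concepts. -/
abbrev ProvEquiv.identity : ProvEquiv :=
  .ofEquivalence (n := 0) (.eq (.var .zero) (.var (.succ .zero))) fun _ =>
    ⟨fun _ => rfl, Eq.symm, Eq.trans⟩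

/-! ### What the axioms provide in a model -/

section

variable {M : Struc L1} (hM : Models M PFT)

include hM

theorem Models.ext {n : ℕ} {R S : M.C (n + 1)} (h : ∀ a, M.pr R a ↔ M.pr S a) : R = S :=
  ((sat_extAx M n).1 (hM _ (.inl (.ext n))) R S).2 h

theorem Models.proj {m n : ℕ} (R : M.C ((m + 1) + (n + 1))) (a b) :
    M.pr (M.prj R a) b ↔ M.pr (n := m + 1 + n) R (glue a b) :=
  (sat_projAx M m n).1 (hM _ (.inl (.proj m n))) R a b

theorem Models.comp {n : ℕ} {Γ : List ℕ} (φ : Formula L1 (objs (n + 1) ++ Γ)) (e : Asg M.C Γ)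
    (h : IsFO φ) :
    ∃ R : M.C (n + 1), ∀ a, M.pr R a ↔ φ.Sat M (Asg.append (Asg.tuple (n + 1) a) e) :=
  (sat_compAx M n Γ φ).1 (hM _ (.inl (.comp n Γ φ h))) e

theorem Models.del_eq (d : ProvEquiv) (R S : M.C (d.arity + 1)) :
    M.del d R = M.del d S ↔ d.E.Sat M.red (Asg.cons R (Asg.cons S Asg.nil)) := by
  have := hM _ (.inr ⟨d, rfl⟩)
  simp only [abstractionAx, Formula.sat_all, Formula.sat_iff, Formula.sat_eq, sat_app2,
    sat_expand, eval_delT, Term.eval_var, Asg.cons_zero, Asg.cons_succ] at this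
  exact this R S

/-- Basic Law V. -/
theorem Models.del_identity (R S : M.C 1) :
    M.del .identity R = M.del .identity S ↔ R = S := hM.del_eq .identity R S

theorem Models.del_ofClass {n : ℕ} (χ : Formula L0 [n + 1]) (R S : M.C (n + 1)) :
    M.del (.ofClass χ) R = M.del (.ofClass χ) S ↔
      (χ.Sat M.red (Asg.cons R Asg.nil) ↔ χ.Sat M.red (Asg.cons S Asg.nil)) := by
  rw [← sat_sameF]
  exact hM.del_eq (.ofClass χ) R S

/-- The field `image` is where impredicative power arises: an abstraction operator compresses the
truth value of χ, however complex χ is, into an identity between objects, to which first-order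
comprehension for `L1` applies. -/
theorem Models.rich : Rich M.red where
  ext := hM.ext
  proj := hM.proj
  comp φ e h := by
    obtain ⟨R, hR⟩ := hM.comp (φ.expand _) e (h.expand _)
    exact ⟨R, fun a => (hR a).trans (sat_expand M φ _)⟩
  image {m n} χ T := by
    by_cases h : ∃ b, χ.Sat M.red (Asg.cons (M.prj T b) Asg.nil)
    · obtain ⟨b, hb⟩ := h
      -- Since T[b] satisfies χ, having the same abstract as T[b] is the same as satisfying χ.
      obtain ⟨R, hR⟩ := hM.comp (n := n) (Γ := [(n + 1) + (m + 1), m + 1])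
        (.eq (delT (ar := ProvEquiv.arity) (.ofClass χ)
          (projT n m (.var (Ren.weakBlock _ _ .zero)) fun i => .var (objVar _ i)))
          (delT (ar := ProvEquiv.arity) (.ofClass χ) (.var (Ren.weakBlock _ _ (.succ .zero)))))
        (Asg.cons T (Asg.cons (M.prj T b) Asg.nil)) trivial
      refine ⟨R, fun a => (hR a).trans ?_⟩
      rw [Formula.sat_eq, eval_delT, eval_delT]
      refine (hM.del_ofClass ..).trans ?_
      simp only [eval_projT, Term.eval_var, Asg.append_weakBlock, Asg.append_objVar,
        Asg.cons_zero, Asg.cons_succ, hb, iff_true]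
      rfl
    · push Not at h
      obtain ⟨R, hR⟩ := hM.comp (n := n) (Γ := []) .falsum Asg.nil trivial
      exact ⟨R, fun a => iff_of_false (fun h' => (hR a).1 h') (h a)⟩
  two := by
    -- The two objects are the extensions of the empty and of the universal concept, which differ
    -- because there is an object.
    obtain ⟨R, hR⟩ := hM.comp (n := 0) (Γ := []) .falsum Asg.nil trivial
    obtain ⟨S, hS⟩ := hM.comp (n := 0) (Γ := []) Formula.falsum.neg Asg.nil ⟨trivial, trivial⟩
    refine ⟨M.del .identity R, M.del .identity S, fun h => ?_⟩
    rw [hM.del_identity] at h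
    subst h
    obtain ⟨x⟩ := M.ne 0
    exact (hR fun _ => x).1 ((hS fun _ => x).2 id)

end

/-! ### Explicit variables and predications -/

section

variable {Γ : List ℕ} {a b c d e f g h i j k l m s : ℕ}

abbrev w0 : Var (s :: Γ) s := .zero
abbrev w1 : Var (a :: s :: Γ) s := .succ w0
abbrev w2 : Var (a :: b :: s :: Γ) s := .succ w1
abbrev w3 : Var (a :: b :: c :: s :: Γ) s := .succ w2
abbrev w4 : Var (a :: b :: c :: d :: s :: Γ) s := .succ w3
abbrev w5 : Var (a :: b :: c :: d :: e :: s :: Γ) s := .succ w4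
abbrev w6 : Var (a :: b :: c :: d :: e :: f :: s :: Γ) s := .succ w5
abbrev w7 : Var (a :: b :: c :: d :: e :: f :: g :: s :: Γ) s := .succ w6
abbrev w8 : Var (a :: b :: c :: d :: e :: f :: g :: h :: s :: Γ) s := .succ w7
abbrev w9 : Var (a :: b :: c :: d :: e :: f :: g :: h :: i :: s :: Γ) s := .succ w8
abbrev w10 : Var (a :: b :: c :: d :: e :: f :: g :: h :: i :: j :: s :: Γ) s := .succ w9
abbrev w11 : Var (a :: b :: c :: d :: e :: f :: g :: h :: i :: j :: k :: s :: Γ) s := .succ w10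
abbrev w12 : Var (a :: b :: c :: d :: e :: f :: g :: h :: i :: j :: k :: l :: s :: Γ) s :=
  .succ w11

variable {X : Signature ℕ}

/-- `R(x)` -/
def pred1 (R : Var Γ 1) (x : Var Γ 0) : Formula (SO X) Γ :=
  pred (n := 0) (.var R) ![.var x]

/-- `R(x, y)` -/
def pred2 (R : Var Γ 2) (x y : Var Γ 0) : Formula (SO X) Γ :=
  pred (n := 1) (.var R) ![.var x, .var y]

/-- `R(x, y, z)` -/
def pred3 (R : Var Γ 3) (x y z : Var Γ 0) : Formula (SO X) Γ :=
  pred (n := 2) (.var R) ![.var x, .var y, .var z]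

def eqv (x y : Var Γ s) : Formula (SO X) Γ := .eq (.var x) (.var y)

variable (M : Struc (SO X)) (u : Asg M.C Γ)

def Struc.pr1 (R : M.C 1) (x : M.C 0) : Prop := M.pr (n := 0) R ![x]

def Struc.pr2 (R : M.C 2) (x y : M.C 0) : Prop := M.pr (n := 1) R ![x, y]

def Struc.pr3 (R : M.C 3) (x y z : M.C 0) : Prop := M.pr (n := 2) R ![x, y, z]

theorem sat_pred1 (R : Var Γ 1) (x : Var Γ 0) :
    (pred1 R x).Sat M u ↔ M.pr1 (u _ R) (u _ x) := by
  rw [pred1, sat_pred, Struc.pr1]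
  refine iff_of_eq (congrArg (M.pr _) (funext fun i => ?_))
  fin_cases i; rfl

theorem sat_pred2 (R : Var Γ 2) (x y : Var Γ 0) :
    (pred2 R x y).Sat M u ↔ M.pr2 (u _ R) (u _ x) (u _ y) := by
  rw [pred2, sat_pred, Struc.pr2]
  refine iff_of_eq (congrArg (M.pr _) (funext fun i => ?_))
  fin_cases i <;> rfl

theorem sat_pred3 (R : Var Γ 3) (x y z : Var Γ 0) :
    (pred3 R x y z).Sat M u ↔ M.pr3 (u _ R) (u _ x) (u _ y) (u _ z) := by
  rw [pred3, sat_pred, Struc.pr3]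
  refine iff_of_eq (congrArg (M.pr _) (funext fun i => ?_))
  fin_cases i <;> rfl

theorem sat_eqv (x y : Var Γ s) : (eqv x y : Formula (SO X) Γ).Sat M u ↔ u _ x = u _ y := Iff.rfl

end

/-! ### Full comprehension for unary, binary and ternary concepts -/

namespace Rich

variable {M : Struc L0} (hM : Rich M) {Δ : List ℕ}

include hM

theorem define1 (ψ : Formula L0 (0 :: Δ)) (d : Asg M.C Δ) :
    ∃ R : M.C 1, ∀ x, M.pr1 R x ↔ ψ.Sat M (Asg.cons x d) := by
  obtain ⟨R, hR⟩ := hM.define (n := 0) (Δ := objs 1 ++ Δ) ψ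
    (fun a => Asg.append (Asg.tuple 1 a) d) (Simple.tuple.append (.const d))
  exact ⟨R, fun x => hR ![x]⟩

theorem define2 (ψ : Formula L0 (0 :: 0 :: Δ)) (d : Asg M.C Δ) :
    ∃ R : M.C 2, ∀ x y, M.pr2 R x y ↔ ψ.Sat M (Asg.cons x (Asg.cons y d)) := by
  obtain ⟨R, hR⟩ := hM.define (n := 1) (Δ := objs 2 ++ Δ) ψ
    (fun a => Asg.append (Asg.tuple 2 a) d) (Simple.tuple.append (.const d))
  exact ⟨R, fun x y => hR ![x, y]⟩

theorem define3 (ψ : Formula L0 (0 :: 0 :: 0 :: Δ)) (d : Asg M.C Δ) :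
    ∃ R : M.C 3, ∀ x y z, M.pr3 R x y z ↔ ψ.Sat M (Asg.cons x (Asg.cons y (Asg.cons z d))) := by
  obtain ⟨R, hR⟩ := hM.define (n := 2) (Δ := objs 3 ++ Δ) ψ
    (fun a => Asg.append (Asg.tuple 3 a) d) (Simple.tuple.append (.const d))
  exact ⟨R, fun x y z => hR ![x, y, z]⟩

end Rich

/-! ### Arithmetic on a Dedekind infinite domain -/

/-- `A` is the least relation with `A(x, 0, z)` whenever `B(x, z)` and that is closed under passing
from `A(x, y, z)` to `A(x, y + 1, z')` if `H(x, z, z')`. -/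
def IsRec (M : Struc L0) (zero : M.C 0) (succ : M.C 0 → M.C 0) (B : M.C 0 → M.C 0 → Prop)
    (H : M.C 0 → M.C 0 → M.C 0 → Prop) (A : M.C 3) : Prop :=
  ∀ x y z, M.pr3 A x y z ↔ ∀ X : M.C 3, (∀ x z, B x z → M.pr3 X x zero z) →
    (∀ x y z z', M.pr3 X x y z → H x z z' → M.pr3 X x (succ y) z') → M.pr3 X x y z

/-- Numbers, addition and multiplication, with respect to an injective and not surjective
function on the objects. -/
structure Arith (M : Struc L0) where
  zero : M.C 0
  succ : M.C 0 → M.C 0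
  succ_inj : Function.Injective succ
  succ_ne : ∀ x, succ x ≠ zero
  S : M.C 2
  hS : ∀ x y, M.pr2 S x y ↔ y = succ x
  N : M.C 1
  hN : ∀ x, M.pr1 N x ↔ ∀ X, M.pr1 X zero → (∀ y, M.pr1 X y → M.pr1 X (succ y)) → M.pr1 X x
  A : M.C 3
  hA : IsRec M zero succ (fun x z => z = x) (fun _ z z' => z' = succ z) A
  P : M.C 3
  hP : IsRec M zero succ (fun _ z => z = zero) (fun x z z' => M.pr3 A z x z') P

namespace Arith

variable {M : Struc L0} (hM : Rich M) (K : Arith M)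

theorem num_zero : M.pr1 K.N K.zero := (K.hN _).2 fun _ h _ => h

theorem num_succ {x : M.C 0} (h : M.pr1 K.N x) : M.pr1 K.N (K.succ x) :=
  (K.hN _).2 fun X h₀ h₁ => h₁ _ ((K.hN _).1 h X h₀ h₁)

include hM

/-- The definition of the numbers gives induction for concepts closed under successor on all
objects. Intersecting X with the numbers weakens this to closure on the numbers. -/
theorem induction (X : M.C 1) (h₀ : M.pr1 X K.zero)
    (h₁ : ∀ y, M.pr1 K.N y → M.pr1 X y → M.pr1 X (K.succ y)) {x : M.C 0} (hx : M.pr1 K.N x) :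
    M.pr1 X x := by
  obtain ⟨Y, hY⟩ := hM.define1 (Δ := [1, 1]) (.and (pred1 w1 w0) (pred1 w2 w0))
    (Asg.cons X (Asg.cons K.N Asg.nil))
  simp only [Formula.sat_and, sat_pred1, Asg.cons_zero, Asg.cons_succ] at hY
  refine ((hY x).1 ((K.hN x).1 hx Y ((hY _).2 ⟨h₀, K.num_zero⟩) fun y hy => ?_)).1
  rw [hY] at hy ⊢
  exact ⟨h₁ y hy.2 hy.1, K.num_succ hy.2⟩

/-- The disjunction itself defines a concept, and the induction step for it does not use the
induction hypothesis. -/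
theorem cases {x : M.C 0} (hx : M.pr1 K.N x) :
    x = K.zero ∨ ∃ y, M.pr1 K.N y ∧ x = K.succ y := by
  obtain ⟨X, hX⟩ := hM.define1 (Δ := [0, 1, 2])
    (.or (eqv w0 w1) (.ex 0 (.and (pred1 w3 w0) (pred2 w4 w0 w1))))
    (Asg.cons K.zero (Asg.cons K.N (Asg.cons K.S Asg.nil)))
  simp only [Formula.sat_and, Formula.sat_or, Formula.sat_ex, sat_eqv, sat_pred1, sat_pred2,
    Asg.cons_zero, Asg.cons_succ, K.hS] at hX
  rw [← hX]
  refine K.induction hM X ((hX _).2 (.inl rfl)) (fun y hy _ => (hX _).2 (.inr ⟨y, hy, rfl⟩)) hx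

/-! ### Relations defined by recursion -/

section Rec

variable {B : M.C 0 → M.C 0 → Prop} {H : M.C 0 → M.C 0 → M.C 0 → Prop} {A : M.C 3}
  (hA : IsRec M K.zero K.succ B H A)

include hA

omit hM in
theorem rec_base {x z : M.C 0} (h : B x z) : M.pr3 A x K.zero z :=
  (hA _ _ _).2 fun _ h₀ _ => h₀ _ _ h

omit hM in
theorem rec_step {x y z z' : M.C 0} (h : M.pr3 A x y z) (h' : H x z z') :
    M.pr3 A x (K.succ y) z' :=
  (hA _ _ _).2 fun X h₀ h₁ => h₁ _ _ _ _ ((hA _ _ _).1 h X h₀ h₁) h'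

variable (hB : ∃ b : M.C 2, ∀ x z, M.pr2 b x z ↔ B x z)
  (hH : ∃ h : M.C 3, ∀ x z z', M.pr3 h x z z' ↔ H x z z')

include hB hH

/-- By minimality of A: the triples of one of the two forms make up a concept, and it has the
closure properties that define A. The hypotheses that B and H are given by concepts make this
concept available. -/
theorem rec_inv {x y z : M.C 0} (h : M.pr3 A x y z) : (y = K.zero ∧ B x z) ∨
    ∃ y' z', y = K.succ y' ∧ M.pr3 A x y' z' ∧ H x z' z := by
  obtain ⟨b, hb⟩ := hB
  obtain ⟨g, hg⟩ := hH
  -- in the scope of the two quantifiers the context is `z', y', x, y, z, zero, b, S, A, g`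
  obtain ⟨X, hX⟩ := hM.define3 (Δ := [0, 2, 2, 3, 3])
    (.or (.and (eqv w1 w3) (pred2 w4 w0 w2))
      (.ex 0 (.ex 0 (.and (pred2 w7 w1 w3) (.and (pred3 w8 w2 w1 w0) (pred3 w9 w2 w0 w4))))))
    (Asg.cons K.zero (Asg.cons b (Asg.cons K.S (Asg.cons A (Asg.cons g Asg.nil)))))
  simp only [Formula.sat_and, Formula.sat_or, Formula.sat_ex, sat_eqv, sat_pred2, sat_pred3,
    Asg.cons_zero, Asg.cons_succ, K.hS, hb, hg] at hX
  rw [← hX]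
  refine (hA _ _ _).1 h X (fun x z h => (hX _ _ _).2 (.inl ⟨rfl, h⟩)) fun x y z z' h h' => ?_
  refine (hX _ _ _).2 (.inr ⟨y, z, rfl, ?_, h'⟩)
  rcases (hX _ _ _).1 h with ⟨rfl, h₀⟩ | ⟨y', z'', rfl, h₁, h₂⟩
  · exact K.rec_base hA h₀
  · exact K.rec_step hA h₁ h₂

theorem rec_zero {x z : M.C 0} : M.pr3 A x K.zero z ↔ B x z := by
  refine ⟨fun h => ?_, K.rec_base hA⟩
  rcases K.rec_inv hM hA hB hH h with ⟨-, h⟩ | ⟨y, _, h, -⟩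
  · exact h
  · exact absurd h.symm (K.succ_ne y)

/-- Inversion leaves only the successor case, as zero is not a successor, and injectivity of
successor identifies the predecessor. -/
theorem rec_succ {x y z : M.C 0} :
    M.pr3 A x (K.succ y) z ↔ ∃ z', M.pr3 A x y z' ∧ H x z' z := by
  refine ⟨fun h => ?_, fun ⟨z', h, h'⟩ => K.rec_step hA h h'⟩
  rcases K.rec_inv hM hA hB hH h with ⟨h, -⟩ | ⟨y', z', h, h'⟩
  · exact absurd h (K.succ_ne y)
  · rw [← K.succ_inj h] at h'
    exact ⟨z', h'⟩

/-- Induction on y, with x as a parameter, for the concept of having exactly one value, which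
moreover is a number. -/
theorem rec_total (hB' : ∀ x, M.pr1 K.N x → ∃ z, M.pr1 K.N z ∧ ∀ z', B x z' ↔ z' = z)
    (hH' : ∀ x z, M.pr1 K.N x → M.pr1 K.N z → ∃ z', M.pr1 K.N z' ∧ ∀ z'', H x z z'' ↔ z'' = z')
    {x y : M.C 0} (hx : M.pr1 K.N x) (hy : M.pr1 K.N y) :
    ∃ z, M.pr1 K.N z ∧ ∀ z', M.pr3 A x y z' ↔ z' = z := by
  obtain ⟨X, hX⟩ := hM.define1 (Δ := [0, 1, 3])
    (.ex 0 (.and (pred1 w3 w0) (.all 0 (.iff (pred3 w5 w3 w2 w0) (eqv w0 w1)))))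
    (Asg.cons x (Asg.cons K.N (Asg.cons A Asg.nil)))
  simp only [Formula.sat_and, Formula.sat_iff, Formula.sat_ex, Formula.sat_all, sat_eqv,
    sat_pred1, sat_pred3, Asg.cons_zero, Asg.cons_succ] at hX
  rw [← hX]
  refine K.induction hM X ?_ (fun y hy h => ?_) hy
  · simp only [hX, K.rec_zero hM hA hB hH]
    exact hB' x hx
  · rw [hX] at h ⊢
    obtain ⟨z, hz, h⟩ := h
    simp only [K.rec_succ hM hA hB hH, h, exists_eq_left]
    exact hH' x z hx hz

end Rec

theorem exists_add_base : ∃ b : M.C 2, ∀ x z, M.pr2 b x z ↔ z = x := by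
  obtain ⟨b, hb⟩ := hM.define2 (Δ := []) (eqv w1 w0) Asg.nil
  exact ⟨b, hb⟩

theorem exists_add_step : ∃ h : M.C 3, ∀ x z z', M.pr3 h x z z' ↔ z' = K.succ z := by
  obtain ⟨h, hh⟩ := hM.define3 (Δ := [2]) (pred2 w3 w1 w2) (Asg.cons K.S Asg.nil)
  simp only [sat_pred2, Asg.cons_zero, Asg.cons_succ, K.hS] at hh
  exact ⟨h, hh⟩

theorem exists_mul_base : ∃ b : M.C 2, ∀ x z, M.pr2 b x z ↔ z = K.zero := by
  obtain ⟨b, hb⟩ := hM.define2 (Δ := [0]) (eqv w1 w2) (Asg.cons K.zero Asg.nil)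
  exact ⟨b, hb⟩

theorem exists_mul_step : ∃ h : M.C 3, ∀ x z z', M.pr3 h x z z' ↔ M.pr3 K.A z x z' := by
  obtain ⟨h, hh⟩ := hM.define3 (Δ := [3]) (pred3 w3 w1 w0 w2) (Asg.cons K.A Asg.nil)
  simp only [sat_pred3, Asg.cons_zero, Asg.cons_succ] at hh
  exact ⟨h, hh⟩

theorem add_zero {x z : M.C 0} : M.pr3 K.A x K.zero z ↔ z = x :=
  K.rec_zero hM K.hA (exists_add_base hM) (K.exists_add_step hM)

theorem add_succ {x y z : M.C 0} :
    M.pr3 K.A x (K.succ y) z ↔ ∃ z', M.pr3 K.A x y z' ∧ z = K.succ z' :=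
  K.rec_succ hM K.hA (exists_add_base hM) (K.exists_add_step hM)

theorem add_total {x y : M.C 0} (hx : M.pr1 K.N x) (hy : M.pr1 K.N y) :
    ∃ z, M.pr1 K.N z ∧ ∀ z', M.pr3 K.A x y z' ↔ z' = z :=
  K.rec_total hM K.hA (exists_add_base hM) (K.exists_add_step hM)
    (fun x hx => ⟨x, hx, fun _ => Iff.rfl⟩)
    (fun _ _ _ hz => ⟨_, K.num_succ hz, fun _ => Iff.rfl⟩) hx hy

theorem mul_zero {x z : M.C 0} : M.pr3 K.P x K.zero z ↔ z = K.zero :=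
  K.rec_zero hM K.hP (K.exists_mul_base hM) (K.exists_mul_step hM)

theorem mul_succ {x y z : M.C 0} :
    M.pr3 K.P x (K.succ y) z ↔ ∃ z', M.pr3 K.P x y z' ∧ M.pr3 K.A z' x z :=
  K.rec_succ hM K.hP (K.exists_mul_base hM) (K.exists_mul_step hM)

theorem mul_total {x y : M.C 0} (hx : M.pr1 K.N x) (hy : M.pr1 K.N y) :
    ∃ z, M.pr1 K.N z ∧ ∀ z', M.pr3 K.P x y z' ↔ z' = z :=
  K.rec_total hM K.hP (K.exists_mul_base hM) (K.exists_mul_step hM)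
    (fun _ _ => ⟨_, K.num_zero, fun _ => Iff.rfl⟩)
    (fun _ _ hx hz => K.add_total hM hz hx) hx hy

end Arith

/-! ### Constants for the elements of a structure -/

/-- The second-order language with constants for the variables of `Θ`. -/
abbrev LC (Θ : List ℕ) : Signature ℕ := SO
  { Fn := Σ s, Var Θ s
    fdom := fun _ => []
    fcod := Sigma.fst
    Rl := Empty
    rdom := Empty.elim }

section

variable {Θ Γ Δ : List ℕ}

/-- The constant for a variable. -/
def cst {s : ℕ} (v : Var Θ s) : Term (LC Θ) Γ s := .func (L := LC Θ) ⟨s, v⟩ Sub.nil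

/-- The expansion of a structure by constants. -/
abbrev Struc.const (M : Struc L0) (d : Asg M.C Θ) : Struc (LC Θ) where
  C := M.C
  ne := M.ne
  fn f _ := d f.1 f.2
  rl
    | .inl n, e => M.rl (.inl n) e
    | .inr r, _ => r.elim

@[simp] theorem eval_cst (M : Struc L0) (d : Asg M.C Θ) {s : ℕ} (v : Var Θ s)
    (e : Asg M.C Γ) : (cst v).eval (M.const d) e = d s v := rfl

theorem pr_const (M : Struc L0) (d : Asg M.C Θ) {n : ℕ} (R : M.C (n + 1))
    (a : Fin (n + 1) → M.C 0) : (M.const d).pr R a ↔ M.pr R a := Iff.rfl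

theorem pr2_const (M : Struc L0) (d : Asg M.C Θ) (R : M.C 2) (x y : M.C 0) :
    (M.const d).pr2 R x y ↔ M.pr2 R x y := Iff.rfl

theorem pr3_const (M : Struc L0) (d : Asg M.C Θ) (R : M.C 3) (x y z : M.C 0) :
    (M.const d).pr3 R x y z ↔ M.pr3 R x y z := Iff.rfl

/-- Replacing constants by variables. -/
def Term.elim (κ : Ren Θ Δ) (ρ : Ren Γ Δ) : {s : ℕ} → Term (LC Θ) Γ s → Term L0 Δ s
  | _, .var v => .var (ρ _ v)
  | _, .func f _ => .var (κ f.1 f.2)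

/-- Replacing constants by variables. -/
def Formula.elim : {Γ Δ : List ℕ} → Ren Θ Δ → Ren Γ Δ → Formula (LC Θ) Γ → Formula L0 Δ
  | _, _, _, _, .falsum => .falsum
  | _, _, κ, ρ, .eq t u => .eq (t.elim κ ρ) (u.elim κ ρ)
  | _, _, κ, ρ, .rel (Sum.inl n) ts => .rel (L := L0) (Sum.inl n) fun s v => (ts s v).elim κ ρ
  | _, _, κ, ρ, .imp φ ψ => .imp (φ.elim κ ρ) (ψ.elim κ ρ)
  | _, _, κ, ρ, .all s φ => .all s (φ.elim (fun _ v => (κ _ v).succ) (ρ.lift s))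

theorem Term.eval_elim (M : Struc L0) (κ : Ren Θ Δ) (ρ : Ren Γ Δ) {s : ℕ} (t : Term (LC Θ) Γ s)
    (e : Asg M.C Δ) : (t.elim κ ρ).eval M e =
      t.eval (M.const fun _ v => e _ (κ _ v)) fun _ v => e _ (ρ _ v) := by
  cases t <;> rfl

theorem Formula.sat_elim (M : Struc L0) (κ : Ren Θ Δ) (ρ : Ren Γ Δ) (φ : Formula (LC Θ) Γ)
    (e : Asg M.C Δ) : (φ.elim κ ρ).Sat M e ↔
      φ.Sat (M.const fun _ v => e _ (κ _ v)) fun _ v => e _ (ρ _ v) := by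
  induction φ generalizing Δ with
  | falsum => rfl
  | eq t u => simp only [elim, sat_eq, Term.eval_elim]
  | rel r ts =>
    cases r with
    | inl n =>
      exact iff_of_eq (congrArg (M.rl (.inl n)) (funext₂ fun s v => Term.eval_elim M κ ρ _ e))
    | inr r => exact r.elim
  | imp φ ψ ih₁ ih₂ => simp only [elim, sat_imp, ih₁, ih₂]
  | all s φ ih =>
    simp only [elim, sat_all, ih]
    refine forall_congr' fun a => iff_of_eq (congrArg _ ?_)
    funext r v
    cases v <;> rfl

theorem Formula.sat_elim_block (M : Struc L0) (φ : Formula (LC Θ) Γ) (d : Asg M.C Θ)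
    (e : Asg M.C Γ) : (φ.elim (Ren.inBlock Θ) (Ren.weakBlock Θ)).Sat M (Asg.append d e) ↔
      φ.Sat (M.const d) e := by
  have h₁ : (fun s v => Asg.append d e s (Ren.inBlock Θ s v)) = d := by
    simp only [Asg.append_inBlock]
  have h₂ : (fun s v => Asg.append d e s (Ren.weakBlock Θ s v)) = e := by
    simp only [Asg.append_weakBlock]
  have := φ.sat_elim M (Ren.inBlock Θ) (Ren.weakBlock Θ) (Asg.append d e)
  simp only [h₂] at this
  rw [this, h₁]

end

section

variable {L : Signature ℕ} {Γ : List ℕ}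

/-- Finite conjunctions. -/
def Formula.conj : (n : ℕ) → (Fin n → Formula L Γ) → Formula L Γ
  | 0, _ => falsum.neg
  | n + 1, φ => .and (φ 0) (conj n fun i => φ i.succ)

@[simp] theorem Formula.sat_conj (M : Struc L) (n : ℕ) (φ : Fin n → Formula L Γ) (e : Asg M.C Γ) :
    (conj n φ).Sat M e ↔ ∀ i, (φ i).Sat M e := by
  induction n with
  | zero => exact ⟨fun _ i => i.elim0, fun _ => id⟩
  | succ n ih => rw [conj, sat_and, ih, Fin.forall_fin_succ]

variable {X : Signature ℕ}

theorem sat_pred_one (M : Struc (SO X)) (e : Asg M.C Γ) (R : Term (SO X) Γ 1)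
    (t : Term (SO X) Γ 0) :
    (pred (n := 0) R ![t]).Sat M e ↔ M.pr1 (R.eval M e) (t.eval M e) := by
  rw [sat_pred, Struc.pr1]
  refine iff_of_eq (congrArg (M.pr _) (funext fun i => ?_))
  fin_cases i; rfl

theorem sat_pred_two (M : Struc (SO X)) (e : Asg M.C Γ) (R : Term (SO X) Γ 2)
    (t u : Term (SO X) Γ 0) :
    (pred (n := 1) R ![t, u]).Sat M e ↔ M.pr2 (R.eval M e) (t.eval M e) (u.eval M e) := by
  rw [sat_pred, Struc.pr2]
  refine iff_of_eq (congrArg (M.pr _) (funext fun i => ?_))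
  fin_cases i <;> rfl

theorem sat_pred_three (M : Struc (SO X)) (e : Asg M.C Γ) (R : Term (SO X) Γ 3)
    (t u w : Term (SO X) Γ 0) : (pred (n := 2) R ![t, u, w]).Sat M e ↔
      M.pr3 (R.eval M e) (t.eval M e) (u.eval M e) (w.eval M e) := by
  rw [sat_pred, Struc.pr3]
  refine iff_of_eq (congrArg (M.pr _) (funext fun i => ?_))
  fin_cases i <;> rfl

end

/-! ### The standard interpretation of arithmetic -/

/-- The parameters: the numbers, zero, the successor relation, addition and multiplication. -/
abbrev arithCtx : List ℕ := [1, 0, 2, 3, 3]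

/-- The variable of the relabelled context. -/
def Var.relabel {S S' : Type} (f : S → S') : {Γ : List S} → {s : S} → Var Γ s →
    Var (Γ.map f) (f s)
  | _, _, .zero => .zero
  | _, _, .succ v => .succ (v.relabel f)

theorem Translation.var_eq_relabel {S S' : Type} {L : Signature S} {K : Signature S'}
    (τ : Translation L K) {Γ : List S} {s : S} (v : Var Γ s) : τ.var v = v.relabel τ.srt := by
  induction v with
  | zero => rfl
  | succ v ih => exact congrArg Var.succ ih

/-- `x` is a number. -/
def numC {Γ : List ℕ} (x : Term (LC arithCtx) Γ 0) : Formula (LC arithCtx) Γ :=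
  pred (n := 0) (cst w0) ![x]

/-- The numbers as the objects, and the sets of tuples of numbers as the concepts. -/
abbrev arithTr : Translation LPA (LC arithCtx) where
  srt := fun s => s
  dom
    -- Throughout, the constants `cst w0`, ..., `cst w4` denote the parameters in the order of
    -- `arithCtx`, while `.var` refers to the arguments, in graphs preceded by the value.
    | 0 => numC (.var w0)
    | n + 1 => .allBlock (objs (n + 1)) (.imp
        (pred (n := n) (.var (Ren.weakBlock _ _ .zero)) fun i => .var (objVar (n + 1) i))
        (.conj (n + 1) fun i => numC (.var (objVar (n + 1) i))))
  rel
    | .inl n => pred (n := n)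
        (.var (Var.relabel (Γ := (n + 1) :: objs (n + 1)) (fun s => s) .zero))
        fun i => .var (Var.relabel (Γ := (n + 1) :: objs (n + 1)) (fun s => s)
          (.succ (objIdx (n + 1) i)))
    | .inr _ => .ex 0 (.and (numC (.var w0)) (.ex 0 (.and
        (pred (n := 1) (cst w2) ![.var w1, .var w0])
        (pred (n := 2) (cst w3) ![.var w2, .var w0, .var w3]))))
  fn
    | .zero => .eq (.var w0) (cst w1)
    | .one => pred (n := 1) (cst w2) ![cst w1, .var w0]
    | .add => pred (n := 2) (cst w3) ![.var w1, .var w2, .var w0]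
    | .mul => pred (n := 2) (cst w4) ![.var w1, .var w2, .var w0]

namespace Arith

variable {M : Struc L0} (hM : Rich M) (K : Arith M)

/-- The parameters of the interpretation. -/
def params : Asg M.C arithCtx :=
  Asg.cons K.N (Asg.cons K.zero (Asg.cons K.S (Asg.cons K.A (Asg.cons K.P Asg.nil))))

/-- The numbers, and the concepts of numbers. -/
def Car : ℕ → Type
  | 0 => {x : M.C 0 // M.pr1 K.N x}
  | n + 1 => {R : M.C (n + 1) // ∀ a, M.pr R a → ∀ i, M.pr1 K.N (a i)}

/-- The inclusion of the sorts. -/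
def emb : ∀ s, K.Car s → M.C s
  | 0, x => x.1
  | _ + 1, R => R.1

theorem sat_numC {Γ : List ℕ} (x : Term (LC arithCtx) Γ 0) (e : Asg M.C Γ) :
    (numC x).Sat (M.const K.params) e ↔ M.pr1 K.N (x.eval (M.const K.params) e) :=
  sat_pred_one (M.const K.params) e _ x

theorem emb_inj (s : ℕ) : Function.Injective (K.emb s) := by
  cases s <;> exact Subtype.val_injective

def zero' : K.Car 0 := ⟨K.zero, K.num_zero⟩

def succ' (x : K.Car 0) : K.Car 0 := ⟨K.succ x.1, K.num_succ x.2⟩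

noncomputable def add' (x y : K.Car 0) : K.Car 0 :=
  ⟨(K.add_total hM x.2 y.2).choose, (K.add_total hM x.2 y.2).choose_spec.1⟩

noncomputable def mul' (x y : K.Car 0) : K.Car 0 :=
  ⟨(K.mul_total hM x.2 y.2).choose, (K.mul_total hM x.2 y.2).choose_spec.1⟩

def lt' (x y : K.Car 0) : Prop := ∃ k : K.Car 0, add' hM K x (K.succ' k) = y

theorem add'_iff (x y : K.Car 0) (z : M.C 0) :
    M.pr3 K.A x.1 y.1 z ↔ z = (add' hM K x y).1 :=
  (K.add_total hM x.2 y.2).choose_spec.2 z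

theorem mul'_iff (x y : K.Car 0) (z : M.C 0) :
    M.pr3 K.P x.1 y.1 z ↔ z = (mul' hM K x y).1 :=
  (K.mul_total hM x.2 y.2).choose_spec.2 z

theorem add'_zero (x : K.Car 0) : add' hM K x K.zero' = x :=
  Subtype.ext ((K.add_zero hM).1 ((K.add'_iff hM x K.zero' _).2 rfl))

theorem add'_succ (x y : K.Car 0) : add' hM K x (K.succ' y) = K.succ' (add' hM K x y) := by
  obtain ⟨z, hz, h⟩ := (K.add_succ hM).1 ((K.add'_iff hM x (K.succ' y) _).2 rfl)
  rw [K.add'_iff hM] at hz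
  exact Subtype.ext (h.trans (congrArg K.succ hz))

theorem mul'_zero (x : K.Car 0) : mul' hM K x K.zero' = K.zero' :=
  Subtype.ext ((K.mul_zero hM).1 ((K.mul'_iff hM x K.zero' _).2 rfl))

theorem mul'_succ (x y : K.Car 0) :
    mul' hM K x (K.succ' y) = add' hM K (mul' hM K x y) x := by
  obtain ⟨z, hz, h⟩ := (K.mul_succ hM).1 ((K.mul'_iff hM x (K.succ' y) _).2 rfl)
  rw [K.mul'_iff hM] at hz
  subst hz
  rw [K.add'_iff hM] at h
  exact Subtype.ext h

theorem succ'_inj {x y : K.Car 0} (h : K.succ' x = K.succ' y) : x = y :=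
  Subtype.ext (K.succ_inj (congrArg Subtype.val h))

theorem succ'_ne (x : K.Car 0) : K.succ' x ≠ K.zero' := fun h =>
  K.succ_ne _ (congrArg Subtype.val h)

include hM in
theorem cases' (x : K.Car 0) : x = K.zero' ∨ ∃ y, x = K.succ' y := by
  rcases K.cases hM x.2 with h | ⟨y, hy, h⟩
  · exact .inl (Subtype.ext h)
  · exact .inr ⟨⟨y, hy⟩, Subtype.ext h⟩

theorem not_lt_zero (x : K.Car 0) : ¬ lt' hM K x K.zero' := by
  rintro ⟨k, hk⟩
  rw [add'_succ] at hk
  exact K.succ'_ne _ hk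

/-- Order is witnessed by x + (k + 1). Cancelling a successor in x + (k + 1) = y + 1 leaves x + k =
y, and the alternatives k = 0 and k = j + 1 give the two disjuncts. -/
theorem lt_succ (x y : K.Car 0) :
    lt' hM K x (K.succ' y) ↔ lt' hM K x y ∨ x = y := by
  constructor
  · rintro ⟨k, hk⟩
    rw [add'_succ] at hk
    have hk := K.succ'_inj hk
    rcases K.cases' hM k with rfl | ⟨k, rfl⟩
    · right
      rwa [add'_zero] at hk
    · exact .inl ⟨k, hk⟩
  · rintro (⟨k, rfl⟩ | rfl)
    · exact ⟨K.succ' k, by rw [add'_succ]⟩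
    · exact ⟨K.zero', by rw [add'_succ, add'_zero]⟩

/-- The structure of the numbers. -/
noncomputable abbrev struc : Struc LPA where
  C := K.Car
  ne
    | 0 => ⟨K.zero'⟩
    | n + 1 => by
      obtain ⟨R, hR⟩ := hM.define (n := n) (Δ := []) .falsum (fun _ => Asg.nil)
        (Rich.Simple.const _)
      exact ⟨⟨R, fun a h => ((hR a).1 h).elim⟩⟩
  fn
    | .zero, _ => K.zero'
    | .one, _ => K.succ' K.zero'
    | .add, e => add' hM K (e 0 w0) (e 0 w1)
    | .mul, e => mul' hM K (e 0 w0) (e 0 w1)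
  rl
    | .inl n, e => M.pr (K.emb (n + 1) (e (n + 1) .zero))
        fun i => K.emb 0 (e 0 (.succ (objIdx (n + 1) i)))
    | .inr _, e => lt' hM K (e 0 w0) (e 0 w1)

theorem pr_struc {n : ℕ} (R : K.Car (n + 1)) (a : Fin (n + 1) → K.Car 0) :
    (K.struc hM).pr R a ↔ M.pr R.1 fun i => (a i).1 := by
  have : ∀ i, Asg.cons (C := K.Car) (Γ := objs (n + 1)) R (Asg.tuple (n + 1) a) 0
      (.succ (objIdx (n + 1) i)) = a i := fun i => Asg.tuple_objIdx ..
  change M.pr R.1 (fun i => K.emb 0 _) ↔ _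
  simp only [this]
  rfl

theorem mapAsg_arith {Γ : List ℕ} (e : Asg K.Car Γ) {s : ℕ} (v : Var Γ s) :
    Translation.mapAsg (τ := arithTr) (C' := M.C) K.emb e _ (v.relabel fun s => s) =
      K.emb s (e _ v) := by
  rw [← Translation.mapAsg_var (τ := arithTr) (C' := M.C) K.emb, Translation.var_eq_relabel]

theorem defines : arithTr.Defines (M.const K.params) (K.struc hM) K.emb where
  inj := K.emb_inj
  dom s a := by
    cases s with
    | zero =>
      exact (K.sat_numC _ _).trans ⟨fun h => ⟨⟨a, h⟩, rfl⟩, fun ⟨x, h⟩ => h ▸ x.2⟩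
    | succ n =>
      simp only [arithTr, Formula.sat_allObjs, Formula.sat_imp, Formula.sat_conj, K.sat_numC,
        sat_pred, Term.eval_var, Asg.append_weakBlock, Asg.append_objVar,
        Asg.cons_zero, pr_const]
      exact ⟨fun h => ⟨⟨a, h⟩, rfl⟩, fun ⟨x, h⟩ => h ▸ x.2⟩
  rel r e := by
    cases r with
    | inl n =>
      refine (sat_pred ..).trans ?_
      refine iff_of_eq (congrArg₂ (M.pr (n := n)) (K.mapAsg_arith e (s := n + 1) .zero)
        (funext fun i => K.mapAsg_arith e (s := 0) (.succ (objIdx (n + 1) i))))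
    | inr r =>
      simp only [arithTr, Formula.sat_ex, Formula.sat_and, K.sat_numC, sat_pred_two,
        sat_pred_three, Term.eval_var, eval_cst, pr2_const, pr3_const, Asg.cons_zero,
        Asg.cons_succ]
      change (∃ k, M.pr1 K.N k ∧ ∃ k', M.pr2 K.S k k' ∧
        M.pr3 K.A (K.emb 0 (e 0 w0)) k' (K.emb 0 (e 0 w1))) ↔ lt' hM K (e 0 w0) (e 0 w1)
      simp only [K.hS, exists_eq_left]
      constructor
      · rintro ⟨k, hk, h⟩
        exact ⟨⟨k, hk⟩, Subtype.ext ((K.add'_iff hM _ (K.succ' ⟨k, hk⟩) _).1 h).symm⟩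
      · rintro ⟨k, h⟩
        refine ⟨k.1, k.2, (K.add'_iff hM _ (K.succ' k) _).2 ?_⟩
        rw [h]
        rfl
  fn f e y := by
    cases f with
    | zero => exact (K.emb_inj 0).eq_iff (b := K.zero')
    | one =>
      refine (sat_pred_two ..).trans ((K.hS _ _).trans ?_)
      exact (K.emb_inj 0).eq_iff (b := K.succ' K.zero')
    | add =>
      refine (sat_pred_three ..).trans ((K.add'_iff hM _ _ _).trans ?_)
      exact (K.emb_inj 0).eq_iff (b := K.add' hM (e 0 w0) (e 0 w1))
    | mul =>
      refine (sat_pred_three ..).trans ((K.mul'_iff hM _ _ _).trans ?_)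
      exact (K.emb_inj 0).eq_iff (b := K.mul' hM (e 0 w0) (e 0 w1))

include hM in
-- Cuts a concept down to an element of the carrier of concepts of numbers, without changing it on
-- tuples of numbers.
theorem exists_restrict {n : ℕ} (R : M.C (n + 1)) :
    ∃ S : M.C (n + 1), ∀ a, M.pr S a ↔ M.pr R a ∧ ∀ i, M.pr1 K.N (a i) := by
  obtain ⟨S, hS⟩ := hM.define (n := n) (Δ := objs (n + 1) ++ [n + 1, 1])
    (.and (pred (.var (Ren.weakBlock _ _ w0)) fun i => .var (objVar _ i))
      (.conj (n + 1) fun i => pred1 (Ren.weakBlock _ _ w1) (objVar _ i)))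
    (fun a => Asg.append (Asg.tuple (n + 1) a) (Asg.cons R (Asg.cons K.N Asg.nil)))
    (Rich.Simple.tuple.append (.const _))
  refine ⟨S, fun a => ?_⟩
  simp only [hS, Formula.sat_and, sat_pred, Formula.sat_conj, sat_pred1, Term.eval_var,
    Asg.append_weakBlock, Asg.append_objVar, Asg.cons_zero, Asg.cons_succ]

omit K in
theorem simple_mapAsg {n : ℕ} {Δ : List ℕ} (v : (Fin (n + 1) → M.C 0) → Asg M.C Δ)
    (hv : Rich.Simple v) : Rich.Simple fun a =>
      Translation.mapAsg (τ := arithTr) (C := M.C) (C' := M.C) (fun _ x => x) (v a) := by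
  induction Δ with
  | nil => intro _ x; cases x
  | cons s Δ ih =>
    intro r x
    cases x with
    | zero => exact hv s .zero
    | succ x => exact ih (fun a _ y => v a _ y.succ) (fun _ y => hv _ y.succ) _ x

/-- Separates the inclusion of the carriers from the relabelling of the context, so that simplicity
can be checked on assignments in `M`. -/
theorem mapAsg_emb {Γ : List ℕ} (e : Asg K.Car Γ) :
    Translation.mapAsg (τ := arithTr) (C' := M.C) K.emb e =
      Translation.mapAsg (τ := arithTr) (C := M.C) (C' := M.C) (fun _ x => x)
        fun s v => K.emb s (e s v) := by
  induction Γ with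
  | nil => rfl
  | cons s Γ ih => exact congrArg (Asg.cons _) (ih _)

theorem emb_append {n : ℕ} {Γ : List ℕ} (a : Fin n → K.Car 0) (e : Asg K.Car Γ) :
    (fun s v => K.emb s (Asg.append (Asg.tuple n a) e s v)) =
      Asg.append (Asg.tuple n fun i => (a i).1) fun s v => K.emb s (e s v) := by
  induction n with
  | zero => rfl
  | succ n ih =>
    funext s v
    cases v with
    | zero => rfl
    | succ v => exact congrFun₂ (ih fun i => a i.succ) s v

/-- Truth of φ among the numbers is truth in `M` of its translation, which becomes an `L0`-formula
once the constants are replaced by variables. Its concept quantifiers are harmless because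
`Rich.define` is impredicative; the result is then restricted to the numbers. -/
theorem comprehension {n : ℕ} {Γ : List ℕ} (φ : Formula LPA (objs (n + 1) ++ Γ))
    (e : Asg K.Car Γ) : ∃ R : K.Car (n + 1), ∀ a, (K.struc hM).pr R a ↔
      φ.Sat (K.struc hM) (Asg.append (Asg.tuple (n + 1) a) e) := by
  let raw (a : Fin (n + 1) → M.C 0) : Asg M.C (objs (n + 1) ++ Γ) :=
    Asg.append (Asg.tuple (n + 1) a) fun s v => K.emb s (e s v)
  let v (a : Fin (n + 1) → M.C 0) : Asg M.C ((objs (n + 1) ++ Γ).map arithTr.srt) :=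
    Translation.mapAsg (τ := arithTr) (C := M.C) (C' := M.C) (fun _ x => x) (raw a)
  have hv : Rich.Simple v := simple_mapAsg raw (Rich.Simple.tuple.append (.const _))
  obtain ⟨R, hR⟩ := hM.define (n := n) (Δ := arithCtx ++ (objs (n + 1) ++ Γ).map arithTr.srt)
    ((arithTr.formula φ).elim (Ren.inBlock arithCtx) (Ren.weakBlock arithCtx))
    (fun a => Asg.append K.params (v a)) (Rich.Simple.append (.const _) hv)
  obtain ⟨S, hS⟩ := K.exists_restrict hM R
  refine ⟨⟨S, fun a h => ((hS a).1 h).2⟩, fun a => ?_⟩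
  refine (K.pr_struc hM _ a).trans ((hS _).trans ?_)
  rw [hR, Formula.sat_elim_block, ← (K.defines hM).sat_formula]
  rw [K.mapAsg_emb, K.emb_append]
  exact and_iff_left fun i => (a i).2

theorem sat_lt {Γ : List ℕ} (t u : Term LPA Γ 0) (e : Asg K.Car Γ) :
    (PA.lt t u).Sat (K.struc hM) e ↔
      lt' hM K (t.eval (K.struc hM) e) (u.eval (K.struc hM) e) := Iff.rfl

theorem eval_zero {Γ : List ℕ} (e : Asg K.Car Γ) :
    (PA.zero : Term LPA Γ 0).eval (K.struc hM) e = K.zero' := rfl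

theorem eval_one {Γ : List ℕ} (e : Asg K.Car Γ) :
    (PA.one : Term LPA Γ 0).eval (K.struc hM) e = K.succ' K.zero' := rfl

theorem eval_add {Γ : List ℕ} (t u : Term LPA Γ 0) (e : Asg K.Car Γ) :
    (PA.add t u).eval (K.struc hM) e =
      add' hM K (t.eval (K.struc hM) e) (u.eval (K.struc hM) e) := rfl

theorem eval_mul {Γ : List ℕ} (t u : Term LPA Γ 0) (e : Asg K.Car Γ) :
    (PA.mul t u).eval (K.struc hM) e =
      mul' hM K (t.eval (K.struc hM) e) (u.eval (K.struc hM) e) := rfl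

theorem models : Models (K.struc hM) PA2 := by
  intro σ hσ
  have add_one : ∀ x, add' hM K x (K.succ' K.zero') = K.succ' x := fun x => by
    rw [add'_succ, add'_zero]
  cases hσ with
  | ext n =>
    rw [sat_extAx]
    -- Both concepts hold only of tuples of numbers, so agreement on these is agreement on all
    -- tuples of objects.
    refine fun R S => ⟨fun h _ => h ▸ Iff.rfl, fun h => Subtype.ext (hM.ext fun a => ?_)⟩
    simp only [K.pr_struc hM] at h
    exact ⟨fun ha => (h fun i => ⟨a i, R.2 a ha i⟩).1 ha,
      fun ha => (h fun i => ⟨a i, S.2 a ha i⟩).2 ha⟩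
  | comp n Γ φ => exact (sat_compAx _ n Γ φ).2 fun e => K.comprehension hM φ e
  | ind =>
    simp only [PA.indAx, Formula.sat_all, Formula.sat_imp, Formula.sat_and, sat_pred,
      eval_zero, eval_add, eval_one, Term.eval_var, Asg.cons_zero, Asg.cons_succ, add_one,
      K.pr_struc hM]
    rintro X ⟨h₀, h₁⟩ x
    have e : ∀ x : M.C 0, (fun _ => x : Fin 1 → M.C 0) = ![x] := fun x => by
      funext i
      fin_cases i; rfl
    simp only [e] at h₀ h₁ ⊢
    exact K.induction hM X.1 h₀ (fun y hy h => h₁ ⟨y, hy⟩ h) x.2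
  | _ =>
    simp only [PA.all2, Formula.sat_all, Formula.sat_imp, Formula.sat_neg, Formula.sat_iff,
      Formula.sat_or, Formula.sat_eq, sat_lt, eval_zero, eval_add, eval_mul, eval_one,
      Term.eval_var, Asg.cons_zero, Asg.cons_succ, add_one]
    first
    | exact fun m _ => K.succ'_ne m
    | exact fun m n => K.succ'_inj
    | exact fun m _ => K.add'_zero hM m
    | exact fun m n => K.add'_succ hM m n
    | exact fun m _ => K.mul'_zero hM m
    | exact fun m n => K.mul'_succ hM m n
    | exact fun m _ => K.not_lt_zero hM m
    | exact fun m n => K.lt_succ hM m n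

end Arith

/-! ### The parameters of the interpretation are definable -/

/-- `x` belongs to every concept that contains zero and is closed under successor. -/
def numF : Formula L0 (0 :: arithCtx) :=
  .all 1 (.imp (pred1 w0 w3) (.imp
    (.all 0 (.all 0 (.imp (pred1 w2 w1) (.imp (pred2 w6 w1 w0) (pred1 w2 w0)))))
    (pred1 w0 w1)))

/-- The definition by recursion with initial values `B` and step `H`. -/
def recF (B : Formula L0 (0 :: 0 :: 3 :: 0 :: 0 :: 0 :: arithCtx))
    (H : Formula L0 (0 :: 0 :: 0 :: 0 :: 0 :: 3 :: 0 :: 0 :: 0 :: arithCtx)) :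
    Formula L0 (0 :: 0 :: 0 :: arithCtx) :=
  .all 3 (.imp (.all 0 (.all 0 (.imp B (pred3 w2 w1 w7 w0))))
    (.imp (.all 0 (.all 0 (.all 0 (.all 0 (.all 0 (.imp (pred3 w5 w4 w3 w2) (.imp H
      (.imp (pred2 w11 w3 w0) (pred3 w5 w4 w0 w1)))))))))
      (pred3 w0 w1 w2 w3)))

def addF : Formula L0 (0 :: 0 :: 0 :: arithCtx) := recF (eqv w0 w1) (pred2 w11 w2 w1)

def mulF : Formula L0 (0 :: 0 :: 0 :: arithCtx) := recF (eqv w0 w7) (pred3 w12 w2 w4 w1)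

/-- The definition of the numbers, addition and multiplication from zero and successor. -/
def arithF : Formula L0 arithCtx :=
  .and (.all 0 (.iff (pred1 w1 w0) numF))
    (.and (.all 0 (.all 0 (.all 0 (.iff (pred3 w6 w0 w1 w2) addF))))
      (.all 0 (.all 0 (.all 0 (.iff (pred3 w7 w0 w1 w2) mulF)))))

/-- Zero is the extension of the empty concept, and the successor of `x` is the extension of the
concept that has the only instance `x`. -/
def succF : Formula L1 arithCtx :=
  .and (.ex 1 (.and (.all 0 (.neg (pred1 w1 w0)))
      (.eq (.var w2) (delT (ar := ProvEquiv.arity) .identity (.var w0)))))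
    (.all 0 (.all 0 (.iff (pred2 w4 w1 w0) (.ex 1 (.and
      (.all 0 (.iff (pred1 w1 w0) (eqv w0 w3)))
      (.eq (.var w1) (delT (ar := ProvEquiv.arity) .identity (.var w0))))))))

section

variable {M : Struc L0} (zero : M.C 0) (succ : M.C 0 → M.C 0) {d : Asg M.C arithCtx}
  (h₀ : d 0 w1 = zero) (hS : ∀ x y, M.pr2 (d 2 w2) x y ↔ y = succ x)

include h₀ hS

theorem sat_numF (x : M.C 0) : numF.Sat M (Asg.cons x d) ↔
    ∀ X, M.pr1 X zero → (∀ y, M.pr1 X y → M.pr1 X (succ y)) → M.pr1 X x := by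
  simp only [numF, Formula.sat_all, Formula.sat_imp, sat_pred1, sat_pred2, Asg.cons_zero,
    Asg.cons_succ, hS, h₀]
  simp only [forall_eq_apply_imp_iff]

theorem sat_addF (x y z : M.C 0) : addF.Sat M (Asg.cons x (Asg.cons y (Asg.cons z d))) ↔
    ∀ X : M.C 3, (∀ x z, z = x → M.pr3 X x zero z) →
      (∀ x y z z', M.pr3 X x y z → z' = succ z → M.pr3 X x (succ y) z') → M.pr3 X x y z := by
  simp only [addF, recF, Formula.sat_all, Formula.sat_imp, sat_pred3, sat_pred2, sat_eqv,
    Asg.cons_zero, Asg.cons_succ, hS, h₀]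
  -- The formula has a fifth variable in the step clause, tied to y by the successor relation, in
  -- place of the term for the successor of y.
  refine forall_congr' fun X => imp_congr Iff.rfl (imp_congr ⟨?_, ?_⟩ Iff.rfl)
  · exact fun h x y z z' h₁ h₂ => h x y z z' _ h₁ h₂ rfl
  · rintro h x y z z' _ h₁ h₂ rfl
    exact h x y z z' h₁ h₂

theorem sat_mulF (x y z : M.C 0) : mulF.Sat M (Asg.cons x (Asg.cons y (Asg.cons z d))) ↔
    ∀ X : M.C 3, (∀ x z, z = zero → M.pr3 X x zero z) →
      (∀ x y z z', M.pr3 X x y z → M.pr3 (d 3 w3) z x z' → M.pr3 X x (succ y) z') →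
        M.pr3 X x y z := by
  simp only [mulF, recF, Formula.sat_all, Formula.sat_imp, sat_pred3, sat_pred2, sat_eqv,
    Asg.cons_zero, Asg.cons_succ, hS, h₀]
  refine forall_congr' fun X => imp_congr Iff.rfl (imp_congr ⟨?_, ?_⟩ Iff.rfl)
  · exact fun h x y z z' h₁ h₂ => h x y z z' _ h₁ h₂ rfl
  · rintro h x y z z' _ h₁ h₂ rfl
    exact h x y z z' h₁ h₂

end

/-- The clause for multiplication mentions the addition of d, so it can be compared with that of K
only after the clause for addition is known to hold. -/
theorem sat_arithF {M : Struc L0} (K : Arith M) {d : Asg M.C arithCtx} (h₀ : d 0 w1 = K.zero)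
    (hS : ∀ x y, M.pr2 (d 2 w2) x y ↔ y = K.succ x) : arithF.Sat M d ↔
      (∀ x, M.pr1 (d 1 w0) x ↔ M.pr1 K.N x) ∧
      (∀ x y z, M.pr3 (d 3 w3) x y z ↔ M.pr3 K.A x y z) ∧
      ∀ x y z, M.pr3 (d 3 w4) x y z ↔ M.pr3 K.P x y z := by
  have hN : ∀ x, numF.Sat M (Asg.cons x d) ↔ M.pr1 K.N x := fun x =>
    (sat_numF K.zero K.succ h₀ hS x).trans (K.hN x).symm
  have hA : ∀ x y z, addF.Sat M (Asg.cons x (Asg.cons y (Asg.cons z d))) ↔ M.pr3 K.A x y z :=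
    fun x y z => (sat_addF K.zero K.succ h₀ hS x y z).trans (K.hA x y z).symm
  have hP : (∀ x y z, M.pr3 (d 3 w3) x y z ↔ M.pr3 K.A x y z) → ∀ x y z,
      (mulF.Sat M (Asg.cons x (Asg.cons y (Asg.cons z d))) ↔ M.pr3 K.P x y z) := by
    intro h x y z
    rw [sat_mulF K.zero K.succ h₀ hS x y z]
    simp only [h]
    exact (K.hP x y z).symm
  have e : ∀ p : M.C 0 → M.C 0 → M.C 0 → Prop, (∀ z y x, p x y z) ↔ ∀ x y z, p x y z :=
    fun p => ⟨fun h x y z => h z y x, fun h z y x => h x y z⟩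
  simp only [arithF, Formula.sat_and, Formula.sat_all, Formula.sat_iff, sat_pred1, sat_pred3,
    Asg.cons_zero, Asg.cons_succ, hN, hA]
  refine and_congr Iff.rfl ((and_congr_right fun h => ?_).trans (and_congr_left' (e _)))
  have h' := hP ((e _).1 h)
  simp only [h']
  exact e _

namespace Rich

variable {M : Struc L0} (hM : Rich M)

include hM

theorem ext1 {R R' : M.C 1} (h : ∀ x, M.pr1 R x ↔ M.pr1 R' x) : R = R' :=
  hM.ext (n := 0) fun a => by
    have : a = ![a 0] := by
      funext i
      fin_cases i; rfl
    rw [this]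
    exact h _

theorem ext2 {R R' : M.C 2} (h : ∀ x y, M.pr2 R x y ↔ M.pr2 R' x y) : R = R' :=
  hM.ext (n := 1) fun a => by
    have : a = ![a 0, a 1] := by
      funext i
      fin_cases i <;> rfl
    rw [this]
    exact h _ _

theorem ext3 {R R' : M.C 3} (h : ∀ x y z, M.pr3 R x y z ↔ M.pr3 R' x y z) : R = R' :=
  hM.ext (n := 2) fun a => by
    have : a = ![a 0, a 1, a 2] := by
      funext i
      fin_cases i <;> rfl
    rw [this]
    exact h _ _ _

theorem exists_arith (zero : M.C 0) (succ : M.C 0 → M.C 0) (hi : Function.Injective succ)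
    (hn : ∀ x, succ x ≠ zero) (S : M.C 2) (hS : ∀ x y, M.pr2 S x y ↔ y = succ x) :
    ∃ K : Arith M, K.zero = zero ∧ K.succ = succ ∧ K.S = S := by
  obtain ⟨N₀⟩ := M.ne 1
  obtain ⟨A₀⟩ := M.ne 3
  -- The places of the concepts still to be found are filled arbitrarily: `numF` and `addF` depend
  -- only on zero and successor, and `mulF` in addition only on A.
  let d (A : M.C 3) : Asg M.C arithCtx :=
    Asg.cons N₀ (Asg.cons zero (Asg.cons S (Asg.cons A (Asg.cons A₀ Asg.nil))))
  obtain ⟨N, hN⟩ := hM.define1 numF (d A₀)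
  obtain ⟨A, hA⟩ := hM.define3 addF (d A₀)
  obtain ⟨P, hP⟩ := hM.define3 mulF (d A)
  exact ⟨⟨zero, succ, hi, hn, S, hS, N, fun x => (hN x).trans (sat_numF zero succ rfl hS x),
    A, fun x y z => (hA x y z).trans (sat_addF zero succ rfl hS x y z),
    P, fun x y z => (hP x y z).trans (sat_mulF zero succ rfl hS x y z)⟩, rfl, rfl, rfl⟩

end Rich

/-! ### Infinity and the definability of the parameters -/

section

variable {M : Struc L1} (hM : Models M PFT)

include hM

/-- The models of the predicative Fregean theory are Dedekind infinite. -/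
theorem Models.exists_succ : ∃ (zero : M.C 0) (succ : M.C 0 → M.C 0) (S : M.C 2),
    Function.Injective succ ∧ (∀ x, succ x ≠ zero) ∧ (∀ x y, M.pr2 S x y ↔ y = succ x) ∧
    ∀ d : Asg M.C arithCtx, succF.Sat M d ↔
      d 0 w1 = zero ∧ ∀ x y, M.pr2 (d 2 w2) x y ↔ y = succ x := by
  obtain ⟨O, hO⟩ := hM.comp (n := 0) (Γ := []) .falsum Asg.nil trivial
  -- Projecting the identity relation I yields the singleton of x as the term I[x], so that the
  -- graph of successor is definable from I without concept quantifiers.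
  obtain ⟨I, hI⟩ := hM.comp (n := 1) (Γ := []) (eqv w1 w0) Asg.nil trivial
  have hO' : ∀ x, ¬ M.pr1 O x := fun x h => (hO ![x]).1 h
  let sing (x : M.C 0) : M.C 1 := M.prj (m := 0) (n := 0) I ![x]
  have hsing : ∀ x z, M.pr1 (sing x) z ↔ z = x := fun x z =>
    (hM.proj (m := 0) (n := 0) I ![x] ![z]).trans (hI _)
  have ext1 : ∀ {R R' : M.C 1}, (∀ x, M.pr1 R x ↔ M.pr1 R' x) → R = R' := hM.rich.ext1
  obtain ⟨S, hS⟩ := hM.comp (n := 1) (Γ := [2])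
    (.eq (.var w1) (delT (ar := ProvEquiv.arity) .identity
      (projT 0 0 (.var w2) ![.var w0]))) (Asg.cons I Asg.nil) trivial
  have hS' : ∀ x y, M.pr2 S x y ↔ y = M.del .identity (sing x) := by
    intro x y
    refine (hS ![x, y]).trans ?_
    simp only [Formula.sat_eq, eval_delT, eval_projT]
    have : (fun i => Term.eval M (![Term.var w0] i)
        (Asg.append (Γ := [2]) (Asg.tuple (1 + 1) ![x, y]) (Asg.cons I Asg.nil))) = ![x] := by
      funext i
      fin_cases i; rfl
    exact iff_of_eq (congrArg
      (fun a => y = M.del .identity (M.prj (m := 0) (n := 0) I a)) this)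
  refine ⟨M.del .identity O, fun x => M.del .identity (sing x), S, ?_, ?_, hS', ?_⟩
  · intro x y h
    rw [hM.del_identity] at h
    exact (hsing y x).1 (h ▸ (hsing x x).2 rfl)
  · intro x h
    rw [hM.del_identity] at h
    exact hO' x (h ▸ (hsing x x).2 rfl)
  · intro d
    simp only [succF, Formula.sat_and, Formula.sat_ex, Formula.sat_all, Formula.sat_neg,
      Formula.sat_iff, Formula.sat_eq, sat_pred1, sat_pred2, sat_eqv, eval_delT, Term.eval_var,
      Asg.cons_zero, Asg.cons_succ]
    -- By extensionality the concepts quantified in `succF` can only be the empty concept and the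
    -- singleton of x.
    refine and_congr ⟨?_, fun h => ⟨O, hO', h⟩⟩ (forall₂_congr fun x y => iff_congr Iff.rfl
      ⟨?_, fun h => ⟨sing x, hsing x, h⟩⟩)
    · rintro ⟨X, hX, h⟩
      rw [h, ext1 fun x => iff_of_false (hX x) (hO' x)]
    · rintro ⟨X, hX, h⟩
      rw [h, ext1 fun z => (hX z).trans (hsing x z).symm]

/-- The formula `succF` fixes zero and the extension of successor, and relative to these `arithF`
fixes the extensions of the other three; extensionality then makes the tuple unique. -/
theorem Models.exists_params : ∃ K : Arith M.red, ∀ d : Asg M.C arithCtx,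
    (succF.and (arithF.expand _)).Sat M d ↔ d = K.params := by
  obtain ⟨zero, succ, S, hi, hn, hS, hd⟩ := hM.exists_succ
  obtain ⟨K, rfl, rfl, rfl⟩ := hM.rich.exists_arith zero succ hi hn S hS
  refine ⟨K, fun d => ?_⟩
  rw [Formula.sat_and, hd, sat_expand]
  constructor
  · rintro ⟨⟨h₀, hS'⟩, h⟩
    obtain ⟨hN, hA, hP⟩ := (sat_arithF K h₀ hS').1 h
    have e₁ : d 2 w2 = K.S := hM.rich.ext2 fun x y => (hS' x y).trans (hS x y).symm
    have e₂ := hM.rich.ext1 hN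
    have e₃ := hM.rich.ext3 hA
    have e₄ := hM.rich.ext3 hP
    funext s v
    rcases v with _ | _ | _ | _ | _ | ⟨⟨⟩⟩
    exacts [e₂, h₀, e₁, e₃, e₄]
  · rintro rfl
    have h : K.params 0 w1 = K.zero ∧ ∀ x y, M.pr2 (K.params 2 w2) x y ↔ y = K.succ x :=
      ⟨rfl, hS⟩
    exact ⟨h, (sat_arithF K h.1 h.2).2 ⟨fun _ => Iff.rfl, fun _ _ _ => Iff.rfl,
      fun _ _ _ => Iff.rfl⟩⟩

end

/-- The formula that says that `φ` holds for the numbers, zero, successor, addition and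
multiplication. -/
def wrap {Γ : List ℕ} (φ : Formula (LC arithCtx) Γ) : Formula L1 Γ :=
  .exBlock arithCtx (.and ((succF.and (arithF.expand _)).rename (Ren.inBlock arithCtx))
    ((φ.elim (Ren.inBlock arithCtx) (Ren.weakBlock arithCtx)).expand _))

/-- The existential quantifiers have the parameters as their only possible witnesses, so they act as
a definite description. -/
theorem sat_wrap {M : Struc L1} {K : Arith M.red} (hK : ∀ d : Asg M.C arithCtx,
    (succF.and (arithF.expand _)).Sat M d ↔ d = K.params) {Γ : List ℕ}
    (φ : Formula (LC arithCtx) Γ) (e : Asg M.C Γ) :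
    (wrap φ).Sat M e ↔ φ.Sat (M.red.const K.params) e := by
  rw [wrap, Formula.sat_exBlock]
  have h : ∀ d : Asg M.C arithCtx,
      (((succF.and (arithF.expand _)).rename (Ren.inBlock arithCtx)).and
        ((φ.elim (Ren.inBlock arithCtx) (Ren.weakBlock arithCtx)).expand _)).Sat M
          (Asg.append d e) ↔ d = K.params ∧ φ.Sat (M.red.const d) e := by
    intro d
    rw [Formula.sat_and, Formula.sat_rename, sat_expand]
    refine and_congr (Iff.trans (iff_of_eq (congrArg _ ?_)) (hK d))
      (Formula.sat_elim_block M.red φ d e)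
    exact funext₂ fun s v => Asg.append_inBlock ..
  exact (exists_congr h).trans exists_eq_left

/-- The translation of second-order arithmetic into the predicative Fregean theory. -/
abbrev fregeTr : Translation LPA L1 where
  srt := fun s => s
  dom s := wrap (arithTr.dom s)
  rel r := wrap (arithTr.rel r)
  fn f := wrap (arithTr.fn f)

theorem mapAsg_fregeTr {M : Struc L0} (K : Arith M) {Γ : List ℕ} (e : Asg K.Car Γ) :
    Translation.mapAsg (τ := fregeTr) (C' := M.C) K.emb e =
      Translation.mapAsg (τ := arithTr) (C' := M.C) K.emb e := by
  induction Γ with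
  | nil => rfl
  | cons s Γ ih => exact congrArg (Asg.cons _) (ih _)

end Fregean

theorem theorem3p2 : Fregean.Interprets Fregean.PFT Fregean.PA2 := by
  refine Fregean.interprets_of_defines Fregean.fregeTr fun M hM => ?_
  obtain ⟨K, hK⟩ := hM.exists_params
  have h := K.defines hM.rich
  refine ⟨K.struc hM.rich, K.emb, K.models hM.rich, K.emb_inj,
    fun s a => (Fregean.sat_wrap hK _ _).trans (h.dom s a), fun r e => ?_, fun f e y => ?_⟩
  · refine Iff.trans ?_ (h.rel r e)
    rw [Fregean.mapAsg_fregeTr K e]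
    exact Fregean.sat_wrap hK _ _
  · refine Iff.trans ?_ (h.fn f e y)
    rw [Fregean.mapAsg_fregeTr K e]
    exact Fregean.sat_wrap hK _ _
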